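/- Let $k$ be a finite field, $n\ge 2$ an integer, and suppose that $(n,k)\notin\{(2,\mathbb F_2),(2,\mathbb F_3),(2,\mathbb F_5),(3,\mathbb F_2)\}$. Let $\hat{\mathcal C}$ be the category of complete noetherian local commutative rings $R$ with residue field $k$ (the reduction map $R\to k$ being part of the data), whose morphisms are the local ring homomorphisms inducing the identity on $k$. Let $R\in\hat{\mathcal C}$ have maximal ideal $\mathfrak m_R$, put $R_1^\times:=1+\mathfrak m_R\le R^\times$ and $\mu_R:=\{x\in R: x^{\#k-1}=1\}$, and let $\bar\rho:\mathrm{GL}_n(R)\to\mathrm{GL}_n(k)$ be the homomorphism induced by the reduction $R\to k$; rings in $\hat{\mathcal C}$ carry their $\mathfrak m$-adic topology. For a closed subgroup $G\le\mathrm{GL}_n(R)$ let $\mathrm{Def}_{\bar\rho|_G}:\hat{\mathcal C}\to\mathrm{Sets}$ be the functor sending $S$ to the set of continuous homomorphisms $G\to\mathrm{GL}_n(S)$ that reduce to $\bar\rho|_G$, modulo conjugation by $\ker(\mathrm{GL}_n(S)\to\mathrm{GL}_n(k))$. We say that $A\in\hat{\mathcal C}$ represents this functor, or is the universal deformation ring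 of $\bar\rho|_G$, if $\mathrm{Def}_{\bar\rho|_G}\cong\mathrm{Hom}_{\hat{\mathcal C}}(A,-)$ naturally. For a profinite group $\Gamma$ let $R[[\Gamma]]:=\varprojlim_N R[\Gamma/N]$, $N$ ranging over the open normal subgroups of $\Gamma$, with reduction map $R[[\Gamma]]\to R\to k$ (augmentation followed by reduction). (i) Either $\mathrm{Def}_{\bar\rho}$ (the case $G=\mathrm{GL}_n(R)$) is represented by an object of $\hat{\mathcal C}$ isomorphic, as a ring with reduction map to $k$, to $R[[R_1^\times]]$, or $\mathrm{Def}_{\bar\rho}$ is not representable over $\hat{\mathcal C}$. In particular, $R$ represents $\mathrm{Def}_{\bar\rho}$ if and only if $R=k$, i.e. the reduction map $R\to k$ is an isomorphism. (ii) Let $\mu L_n(R):=\{A\in\mathrm{GL}_n(R):\det A\in\mu_R\}$ and let $\mathfrak F$ be the set of closed subgroups $G$ of $\mathrm{GL}_n(R)$ containing $\mathrm{SL}_n(R)$. The set of all $G\in\mathfrak F$ such that $R$ represents $\mathrm{Def}_{\bar\rho|_G}$ coincides with $\{G\in\mathfrak F: G\le\mu L_n(R)\}$. -/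

import Mathlib

open CategoryTheory

universe u

/-- The objects of the category of complete noetherian local commutative rings with residue
field `k`; the identification of the residue field with `k` is recorded by the reduction map
`residue`, a surjection onto `k` (whose kernel is then the maximal ideal). -/
structure CHat (k : Type u) [Field k] : Type (u + 1) where
  carrier : Type u
  [commRing : CommRing carrier]
  [isLocalRing : IsLocalRing carrier]
  [isNoetherianRing : IsNoetherianRing carrier]
  [isAdicComplete : IsAdicComplete (IsLocalRing.maximalIdeal carrier) carrier]
  residue : carrier →+* k
  residue_surjective : Function.Surjective residue

namespace CHat

variable {k : Type u} [Field k]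

instance : CoeSort (CHat k) (Type u) := ⟨CHat.carrier⟩

attribute [instance] commRing isLocalRing isNoetherianRing isAdicComplete

/-- Every object carries its adic topology (for the maximal ideal). -/
instance (R : CHat k) : TopologicalSpace R := (IsLocalRing.maximalIdeal R).adicTopology

instance (R : CHat k) : NonarchimedeanRing R := (IsLocalRing.maximalIdeal R).nonarchimedean

theorem ker_residue (R : CHat k) : RingHom.ker R.residue = IsLocalRing.maximalIdeal R :=
  IsLocalRing.eq_maximalIdeal
    (RingHom.ker_isMaximal_of_surjective R.residue R.residue_surjective)

/-- Morphisms: local ring homomorphisms inducing the identity on `k`. -/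
@[ext]
structure Hom (R S : CHat k) : Type u where
  toRingHom : R →+* S
  isLocalHom : IsLocalHom toRingHom
  residue_comp : S.residue.comp toRingHom = R.residue

instance : Category.{u} (CHat k) where
  Hom := Hom
  id R := ⟨RingHom.id R, ⟨fun _ h => h⟩, rfl⟩
  comp {R S T} f g := ⟨g.toRingHom.comp f.toRingHom,
    ⟨fun a h => f.isLocalHom.map_nonunit a (g.isLocalHom.map_nonunit _ h)⟩,
    by rw [← RingHom.comp_assoc, g.residue_comp, f.residue_comp]⟩

theorem Hom.continuous {R S : CHat k} (f : Hom R S) : Continuous f.toRingHom := by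
  refine continuous_of_continuousAt_zero f.toRingHom ?_
  have hle : (IsLocalRing.maximalIdeal R).map f.toRingHom ≤ IsLocalRing.maximalIdeal S := by
    rw [Ideal.map_le_iff_le_comap]
    intro x hx
    have h1 : R.residue x = 0 := by
      have := R.ker_residue ▸ hx
      simpa [RingHom.mem_ker] using this
    have h2 : f.toRingHom x ∈ RingHom.ker S.residue := by
      rw [RingHom.mem_ker, ← RingHom.comp_apply, f.residue_comp, h1]
    exact S.ker_residue ▸ h2
  have hR := (IsLocalRing.maximalIdeal R).hasBasis_nhds_zero_adic
  have hS := (IsLocalRing.maximalIdeal S).hasBasis_nhds_zero_adic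
  rw [ContinuousAt, map_zero]
  refine (hR.tendsto_iff hS).2 fun n _ => ⟨n, trivial, fun x hx => ?_⟩
  have h3 : f.toRingHom x ∈ ((IsLocalRing.maximalIdeal R) ^ n).map f.toRingHom :=
    Ideal.mem_map_of_mem _ hx
  rw [Ideal.map_pow] at h3
  exact Ideal.pow_right_mono hle n h3

/-- The subgroup `1 + 𝔪` of the group of units of `R`. -/
def oneUnits (R : CHat k) : Subgroup (R : Type u)ˣ where
  carrier := {x | (x : R) - 1 ∈ IsLocalRing.maximalIdeal R}
  one_mem' := by simp
  mul_mem' {x y} hx hy := by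
    have h : ((x * y : (R : Type u)ˣ) : R) - 1 = x * (y - 1) + (x - 1) := by
      push_cast; ring
    rw [Set.mem_ofPred_eq, h]
    exact add_mem (Ideal.mul_mem_left _ _ hy) hx
  inv_mem' {x} hx := by
    have h : ((x⁻¹ : (R : Type u)ˣ) : R) - 1 = -((x⁻¹ : (R : Type u)ˣ) : R) * (x - 1) := by
      rw [neg_mul, mul_sub, Units.inv_mul]; ring
    rw [Set.mem_ofPred_eq, h]
    exact Ideal.mul_mem_left _ _ hx

end CHat

section CompletedGroupRing

variable (R Γ : Type u) [CommRing R] [Group Γ] [TopologicalSpace Γ]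

/-- The transition map `R[Γ/N] → R[Γ/M]` for open normal subgroups `N ≤ M`. -/
noncomputable def groupRingTransition {N M : OpenNormalSubgroup Γ} (h : N ≤ M) :
    MonoidAlgebra R (Γ ⧸ N.toSubgroup) →+* MonoidAlgebra R (Γ ⧸ M.toSubgroup) :=
  MonoidAlgebra.mapDomainRingHom R
    (QuotientGroup.map N.toSubgroup M.toSubgroup (MonoidHom.id Γ) (fun _ hx => h hx))

/-- The completed group ring `R[[Γ]]`: the inverse limit of the group rings `R[Γ/N]`, over all
open normal subgroups `N` of `Γ`, realised as the ring of compatible families. -/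
def CompletedGroupRing :
    Subring (∀ N : OpenNormalSubgroup Γ, MonoidAlgebra R (Γ ⧸ N.toSubgroup)) where
  carrier := {x | ∀ (N M : OpenNormalSubgroup Γ) (h : N ≤ M),
    groupRingTransition R Γ h (x N) = x M}
  zero_mem' _ _ _ := map_zero _
  one_mem' _ _ _ := map_one _
  add_mem' hx hy N M h := by simp only [Pi.add_apply, map_add, hx N M h, hy N M h]
  mul_mem' hx hy N M h := by simp only [Pi.mul_apply, map_mul, hx N M h, hy N M h]
  neg_mem' hx N M h := by simp only [Pi.neg_apply, map_neg, hx N M h]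

/-- The whole group as an open normal subgroup. -/
def topOpenNormalSubgroup : OpenNormalSubgroup Γ where
  toOpenSubgroup := ⊤
  isNormal' := (inferInstance : (⊤ : Subgroup Γ).Normal)

/-- The augmentation `R[[Γ]] → R[Γ/Γ] → R`, sending every group element to `1`. -/
noncomputable def CompletedGroupRing.augmentation : CompletedGroupRing R Γ →+* R :=
  ((MonoidAlgebra.lift R R (Γ ⧸ (topOpenNormalSubgroup Γ).toSubgroup) 1).toRingHom.comp
    (Pi.evalRingHom _ (topOpenNormalSubgroup Γ))).comp (CompletedGroupRing R Γ).subtype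

end CompletedGroupRing

section Deformations

variable {k : Type u} [Field k] {G : Type u} [Group G] [TopologicalSpace G] {n : ℕ}

/-- A lift of `ρbar` to `R`: a continuous representation `G → GL_n(R)` reducing to `ρbar`. -/
@[ext]
structure Lift (ρbar : G →* GL (Fin n) k) (R : CHat k) : Type u where
  toHom : G →* GL (Fin n) R
  continuous_toHom : Continuous toHom
  reduction : (Matrix.GeneralLinearGroup.map R.residue).comp toHom = ρbar

/-- Strict equivalence of lifts: conjugacy by an element of `ker (GL_n(R) → GL_n(k))`. -/
def strictEquiv (ρbar : G →* GL (Fin n) k) (R : CHat k) : Setoid (Lift ρbar R) where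
  r ρ ρ' := ∃ K ∈ (Matrix.GeneralLinearGroup.map (n := Fin n) R.residue).ker,
    ∀ g, ρ'.toHom g = K * ρ.toHom g * K⁻¹
  iseqv :=
    { refl := fun _ => ⟨1, one_mem _, fun _ => by simp⟩
      symm := fun ⟨K, hK, h⟩ => ⟨K⁻¹, inv_mem hK, fun g => by rw [h g]; group⟩
      trans := fun ⟨K, hK, h⟩ ⟨L, hL, h'⟩ =>
        ⟨L * K, mul_mem hL hK, fun g => by rw [h' g, h g]; group⟩ }

/-- The map on lifts induced by a morphism `f : R ⟶ S`. -/
def Lift.map {ρbar : G →* GL (Fin n) k} {R S : CHat k} (f : CHat.Hom R S)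
    (ρ : Lift ρbar R) : Lift ρbar S where
  toHom := (Matrix.GeneralLinearGroup.map f.toRingHom).comp ρ.toHom
  continuous_toHom := by
    have h : Continuous (Matrix.GeneralLinearGroup.map (n := Fin n) f.toRingHom) :=
      Continuous.units_map _ (continuous_id.matrix_map f.continuous)
    exact h.comp ρ.continuous_toHom
  reduction := by
    rw [← MonoidHom.comp_assoc, ← Matrix.GeneralLinearGroup.map_comp, f.residue_comp,
      ρ.reduction]

/-- The set of deformations of `ρbar` to `R`. -/
def Deformation (ρbar : G →* GL (Fin n) k) (R : CHat k) : Type u :=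
  Quotient (strictEquiv ρbar R)

/-- The map on deformations induced by a morphism `f : R ⟶ S`. -/
def Deformation.map {ρbar : G →* GL (Fin n) k} {R S : CHat k} (f : CHat.Hom R S) :
    Deformation ρbar R → Deformation ρbar S :=
  Quotient.map (Lift.map f) (by
    rintro ρ ρ' ⟨K, hK, h⟩
    refine ⟨Matrix.GeneralLinearGroup.map f.toRingHom K, ?_, fun g => ?_⟩
    · rw [MonoidHom.mem_ker] at hK ⊢
      rw [← MonoidHom.comp_apply, ← Matrix.GeneralLinearGroup.map_comp, f.residue_comp, hK]
    · simp only [Lift.map, MonoidHom.comp_apply, h g, map_mul, map_inv])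

/-- The deformation functor of `ρbar`. -/
def deformationFunctor (ρbar : G →* GL (Fin n) k) : CHat k ⥤ Type u where
  obj R := Deformation ρbar R
  map f := ↾(Deformation.map f)
  map_id R := by
    ext x
    induction x using Quotient.inductionOn
    rfl
  map_comp f g := by
    ext x
    induction x using Quotient.inductionOn
    rfl

/-- `R` is a universal deformation ring of `ρbar`: the deformation functor is naturally isomorphic
to `Hom(R, -)`. -/
def IsUniversalDeformationRing (ρbar : G →* GL (Fin n) k) (R : CHat k) : Prop :=
  Nonempty ((deformationFunctor ρbar).CorepresentableBy R)

end Deformations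

/-- The natural representation `GL_n(R) → GL_n(k)`. -/
abbrev naturalRep {k : Type u} [Field k] (n : ℕ) (R : CHat k) :
    GL (Fin n) R →* GL (Fin n) k :=
  Matrix.GeneralLinearGroup.map R.residue

/-- The subgroup `μL_n(R)` of matrices whose determinant is a `(#k - 1)`-st root of unity. -/
noncomputable def muL {k : Type u} [Field k] (n : ℕ) (R : CHat k) : Subgroup (GL (Fin n) R) :=
  (rootsOfUnity (Nat.card k - 1) R).comap Matrix.GeneralLinearGroup.det

/-- The set of all closed subgroups `G` of `GL_n(R)` containing `SL_n(R)`. -/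
def closedSubgroupsOverSL {k : Type u} [Field k] (n : ℕ) (R : CHat k) :
    Set (Subgroup (GL (Fin n) R)) :=
  {G | IsClosed (G : Set (GL (Fin n) R)) ∧
    (Matrix.SpecialLinearGroup.toGL (n := Fin n) (R := R)).range ≤ G}

/-! Everything rests on a rigidity statement, `exists_ringHom_of_reduction`: in the allowed degrees,
a representation of SL_n(R) over a noetherian local ring T that reduces to the natural one is, up to
conjugation by a matrix reducing to 1, the entrywise application of a ring homomorphism f : R → T.
No continuity is needed. Write N_ij(r) for the image of a transvection minus 1, and let J be the
ideal generated by the entries of the products N_ij(r) N_ml(s) with j ≠ m, which vanish in the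
natural representation. Modulo J the representation can be straightened: in a suitable basis the
N_ij(1) are matrix units, and the Steinberg relations (for n = 2, Weyl and torus relations) turn the
coefficients into a ring homomorphism. Hence over T/𝔪J the representation is standard up to J/𝔪J, an
ideal killed by 𝔪, and a first-order computation (`hasZeroProducts`, `hasZeroProducts_two`) shows
that the products vanish there as well. So J = 𝔪J, and J = 0 by Nakayama. The excluded pairs (n, k)
matter only in the first-order computation.

Let q = #k and let G contain SL_n(R). Since SL_n(R) is normal, any lift to S is, after strict
conjugation, the representation given by some f : R → S twisted by a character χ with values in 1 +
𝔪_S and trivial on SL_n(R) (`exists_hom_of_lift`); traces determine f. If det^(q-1) = 1 on G, then χ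
= 1 and R is universal. Conversely, if R is universal, the inclusion of G and its twist by det^(q-1)
turn out to be induced by the same endomorphism of R, and this forces det^(q-1) = 1. This settles
(ii) and the criterion R = k.

For G = GL_n(R), χ factors through det and then through the projection R^× → Γ := 1 + 𝔪_R. A
universal ring A therefore carries a universal pair: a morphism R → A and a character of Γ
(`exists_universalPair`). The quotients Γ/N by open subgroups are finite p-groups, so the rings
R[Γ/N] are objects of the category. Mapping A to them, and R[Γ/N_j] to A/𝔪^j for suitable N_j, gives
A ≅ R[[Γ]] (`exists_ringEquiv`). -/

/-! ### Generation of SL_n of a local ring by transvections. -/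

open Matrix in
/-- Clearing a column: if the `s`-th column of `g` has entry `1` at `s` and the earlier columns are
standard, then row operations make the column standard on any set of rows. -/
theorem Matrix.SpecialLinearGroup.exists_clear_column {n : ℕ} {R : Type*} [CommRing R]
    {E : Subgroup (SpecialLinearGroup (Fin n) R)}
    (hE : ∀ (i j : Fin n) (h : i ≠ j) (c : R), SpecialLinearGroup.transvection h c ∈ E)
    (s : Fin n) (g : SpecialLinearGroup (Fin n) R)
    (hg : ∀ a b, b < s → g a b = (1 : Matrix (Fin n) (Fin n) R) a b) (hs : g s s = 1)
    (t : Finset (Fin n)) :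
    ∃ e ∈ E, (∀ a b, b < s → (e * g) a b = (1 : Matrix (Fin n) (Fin n) R) a b) ∧
      (e * g) s s = 1 ∧ ∀ a ∈ t, a ≠ s → (e * g) a s = 0 := by
  induction t using Finset.induction_on with
  | empty => exact ⟨1, one_mem _, by simpa using hg, by simpa using hs, by simp⟩
  | insert i t hi ih =>
    obtain ⟨e, he, h1, h2, h3⟩ := ih
    by_cases his : i = s
    · refine ⟨e, he, h1, h2, fun a ha has => ?_⟩
      rcases Finset.mem_insert.1 ha with rfl | ha
      · exact absurd his has
      · exact h3 a ha has
    · set g' := e * g with hg'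
      refine ⟨SpecialLinearGroup.transvection his (-(g' i s)) * e, E.mul_mem (hE _ _ _ _) he, ?_⟩
      rw [mul_assoc, ← hg']
      have key : ∀ a b, (SpecialLinearGroup.transvection his (-(g' i s)) * g') a b =
          if a = i then g' i b - g' i s * g' s b else g' a b := by
        intro a b
        change (Matrix.transvection i s (-(g' i s)) * (g' : Matrix (Fin n) (Fin n) R)) a b = _
        split_ifs with h
        · subst h
          rw [transvection_mul_apply_same]; ring
        · rw [transvection_mul_apply_of_ne _ _ _ _ h]
      refine ⟨fun a b hb => ?_, ?_, fun a ha has => ?_⟩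
      · rw [key]
        split_ifs with h
        · subst h
          rw [h1 _ _ hb, h1 _ _ hb, Matrix.one_apply_ne hb.ne', mul_zero, sub_zero]
        · exact h1 _ _ hb
      · rw [key, if_neg (Ne.symm his), h2]
      · rw [key]
        split_ifs with h
        · rw [h2]; ring
        · exact h3 a ((Finset.mem_insert.1 ha).resolve_left h) has

open Matrix in
/-- Making the `s`-th diagonal entry equal to `1` by row operations which do not disturb the
earlier, standard, columns. -/
theorem Matrix.SpecialLinearGroup.exists_pivot_eq_one {n : ℕ} {R : Type*} [CommRing R]
    [IsLocalRing R] {E : Subgroup (SpecialLinearGroup (Fin n) R)}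
    (hE : ∀ (i j : Fin n) (h : i ≠ j) (c : R), SpecialLinearGroup.transvection h c ∈ E)
    (s : Fin n) (g : SpecialLinearGroup (Fin n) R)
    (hg : ∀ a b, b < s → g a b = (1 : Matrix (Fin n) (Fin n) R) a b) :
    ∃ e ∈ E, (∀ a b, b < s → (e * g) a b = (1 : Matrix (Fin n) (Fin n) R) a b) ∧
      (e * g) s s = 1 := by
  -- a transvection with source row below the diagonal
  have key : ∀ (g' : SpecialLinearGroup (Fin n) R) (i j : Fin n) (hij : i ≠ j) (c : R) (a b),
      (SpecialLinearGroup.transvection hij c * g') a b =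
          if a = i then g' i b + c * g' j b else g' a b := by
    intro g' i j hij c a b
    change (Matrix.transvection i j c * (g' : Matrix (Fin n) (Fin n) R)) a b = _
    split_ifs with h
    · subst h
      rw [transvection_mul_apply_same]
    · rw [transvection_mul_apply_of_ne _ _ _ _ h]
  have keep : ∀ (g' : SpecialLinearGroup (Fin n) R),
      (∀ a b, b < s → g' a b = (1 : Matrix (Fin n) (Fin n) R) a b) →
      ∀ (i j : Fin n) (hij : i ≠ j) (c : R), s ≤ j → ∀ a b, b < s →
      (SpecialLinearGroup.transvection hij c * g') a b = (1 : Matrix (Fin n) (Fin n) R) a b := by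
    intro g' hg' i j hij c hj a b hb
    rw [key]
    split_ifs with h
    · subst h
      rw [hg' _ _ hb, hg' _ _ hb, Matrix.one_apply_ne (hb.trans_le hj).ne', mul_zero, add_zero]
    · exact hg' _ _ hb
  have main : ∀ (g' : SpecialLinearGroup (Fin n) R),
      (∀ a b, b < s → g' a b = (1 : Matrix (Fin n) (Fin n) R) a b) →
      ∀ i, s < i → IsUnit (g' i s) →
      ∃ e ∈ E, (∀ a b, b < s → (e * g') a b = (1 : Matrix (Fin n) (Fin n) R) a b) ∧
        (e * g') s s = 1 := by
    intro g' hg' i hi hu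
    refine ⟨SpecialLinearGroup.transvection hi.ne ((1 - g' s s) * ↑hu.unit⁻¹), hE _ _ _ _,
      keep g' hg' _ _ _ _ hi.le, ?_⟩
    rw [key, if_pos rfl, mul_assoc, IsUnit.val_inv_mul]; ring
  -- Otherwise column s is, modulo the maximal ideal, a combination of the earlier standard columns,
  -- and e_s - ∑_{b<s} M_bs e_b is a nonzero kernel vector of a matrix of determinant 1.
  have hunit : ∃ i, s ≤ i ∧ IsUnit (g i s) := by
    by_contra! hcon
    have hm : ∀ i, s ≤ i → IsLocalRing.residue R (g i s) = 0 := fun i hi =>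
      (IsLocalRing.residue_eq_zero_iff _).2 (hcon i hi)
    set M := (IsLocalRing.residue R).mapMatrix (g : Matrix (Fin n) (Fin n) R) with hM
    have hdet : M.det ≠ 0 := by
      rw [hM, ← RingHom.map_det, SpecialLinearGroup.det_coe, map_one]; exact one_ne_zero
    have := Matrix.eq_zero_of_mulVec_eq_zero hdet
      (v := fun b => if b = s then 1 else if b < s then - M b s else 0) (by
        ext a
        simp only [mulVec, dotProduct, Pi.zero_apply]
        have h2 : ∀ b, M a b * (if b = s then 1 else if b < s then - M b s else 0) =
            (if b = s then M a s else 0) - (if b = a then (if a < s then M a s else 0) else 0) := by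
          intro b
          rcases lt_trichotomy b s with h | rfl | h
          · have h3 : M a b = if a = b then 1 else 0 := by
              simp only [hM, RingHom.mapMatrix_apply, Matrix.map_apply, hg a b h, Matrix.one_apply]
              split_ifs <;> simp
            rw [h3]
            by_cases hab : a = b
            · subst hab; simp [h, h.ne]
            · simp [h.ne, hab, Ne.symm hab]
          · by_cases hab : b = a
            · subst hab; simp
            · simp [hab]
          · by_cases hab : b = a
            · subst hab; simp [h.ne', h.not_gt]
            · simp [h.ne', h.not_gt, hab]
        rw [Finset.sum_congr rfl fun b _ => h2 b, Finset.sum_sub_distrib]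
        simp only [Finset.sum_ite_eq', Finset.mem_univ, if_true]
        split_ifs with h
        · simp
        · simpa [hM] using hm a (not_lt.1 h))
    have := congrFun this s
    simp at this
  obtain ⟨i, hi, hu⟩ := hunit
  rcases hi.lt_or_eq with hi | rfl
  · exact main g hg i hi hu
  -- Only the diagonal entry is known to be a unit. If a lower row exists, its entry is first made
  -- equal to 1 to serve as the source; otherwise the matrix is upper triangular and the determinant
  -- gives the pivot.
  by_cases hlast : ∃ i, s < i
  · obtain ⟨i, hi⟩ := hlast
    set g' := SpecialLinearGroup.transvection hi.ne' ((1 - g i s) * ↑hu.unit⁻¹) * g with hg'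
    obtain ⟨e, he, h1, h2⟩ := main g' (keep g hg _ _ _ _ le_rfl) i hi (by
      rw [hg', key, if_pos rfl, mul_assoc, IsUnit.val_inv_mul]; simp)
    refine ⟨e * SpecialLinearGroup.transvection hi.ne' ((1 - g i s) * ↑hu.unit⁻¹),
      E.mul_mem he (hE _ _ _ _), ?_⟩
    rw [mul_assoc, ← hg']
    exact ⟨h1, h2⟩
  · push Not at hlast
    refine ⟨1, one_mem _, by simpa using hg, ?_⟩
    rw [one_mul]
    have hdet := SpecialLinearGroup.det_coe g
    rw [Matrix.det_of_isUpperTriangular (fun a b hab => by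
      have hab : b < a := hab
      rw [hg a b (hab.trans_le (hlast a)), Matrix.one_apply_ne hab.ne']),
      Finset.prod_eq_single s] at hdet
    · exact hdet
    · intro b _ hb
      rw [hg b b (lt_of_le_of_ne (hlast b) hb), Matrix.one_apply_eq]
    · simp

open Matrix in
/-- Over a local ring, the special linear group is generated by the transvections. -/
theorem Matrix.SpecialLinearGroup.closure_transvection_eq_top (n : ℕ) (R : Type*) [CommRing R]
    [IsLocalRing R] :
    Subgroup.closure {g : SpecialLinearGroup (Fin n) R |
      ∃ (i j : Fin n) (h : i ≠ j) (c : R), g = SpecialLinearGroup.transvection h c} = ⊤ := by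
  set E := Subgroup.closure {g : SpecialLinearGroup (Fin n) R |
      ∃ (i j : Fin n) (h : i ≠ j) (c : R), g = SpecialLinearGroup.transvection h c} with hE_def
  have hE : ∀ (i j : Fin n) (h : i ≠ j) (c : R), SpecialLinearGroup.transvection h c ∈ E :=
    fun i j h c => Subgroup.subset_closure ⟨i, j, h, c, rfl⟩
  rw [eq_top_iff]
  intro g _
  have claim : ∀ s ≤ n, ∃ e ∈ E, ∀ a b : Fin n, (b : ℕ) < s →
      (e * g) a b = (1 : Matrix (Fin n) (Fin n) R) a b := by
    intro s
    induction s with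
    | zero => exact fun _ => ⟨1, one_mem _, by simp⟩
    | succ s ih =>
      intro hs
      obtain ⟨e, he, h⟩ := ih (by omega)
      let s' : Fin n := ⟨s, by omega⟩
      obtain ⟨e1, he1, h1, h1'⟩ := exists_pivot_eq_one hE s' (e * g) (fun a b hb => h a b hb)
      obtain ⟨e2, he2, h2, h2', h2''⟩ :=
        exists_clear_column hE s' (e1 * (e * g)) h1 h1' Finset.univ
      refine ⟨e2 * (e1 * e), E.mul_mem he2 (E.mul_mem he1 he), fun a b hb => ?_⟩
      have heq : e2 * (e1 * e) * g = e2 * (e1 * (e * g)) := by group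
      rw [heq]
      rcases (Nat.lt_succ_iff_lt_or_eq.1 hb) with hb | hb
      · exact h2 a b hb
      · obtain rfl : b = s' := Fin.ext hb
        by_cases ha : a = s'
        · subst ha; rw [h2', Matrix.one_apply_eq]
        · rw [h2'' a (Finset.mem_univ _) ha, Matrix.one_apply_ne ha]
  obtain ⟨e, he, h⟩ := claim n le_rfl
  have : e * g = 1 := SpecialLinearGroup.ext _ _ fun a b => h a b b.2
  rw [(inv_eq_of_mul_eq_one_right this).symm]
  exact E.inv_mem he

/-! ### Steinberg and torus relations in SL_n. -/

section Relations

open Matrix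

variable {ι R : Type*} [Fintype ι] [DecidableEq ι] [CommRing R]

theorem Matrix.SpecialLinearGroup.transvection_commute {i j m l : ι} (hij : i ≠ j) (hml : m ≠ l)
    (hjm : j ≠ m) (hil : i ≠ l) (r s : R) :
    SpecialLinearGroup.transvection hij r * SpecialLinearGroup.transvection hml s =
      SpecialLinearGroup.transvection hml s * SpecialLinearGroup.transvection hij r := by
  apply Subtype.ext
  simp only [SpecialLinearGroup.coe_mul, SpecialLinearGroup.transvection_coe, mul_add, add_mul,
    one_mul, mul_one, single_mul_single_of_ne _ _ _ _ hjm,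
    single_mul_single_of_ne _ _ _ _ hil.symm]
  abel

theorem Matrix.SpecialLinearGroup.transvection_mul_transvection {i j l : ι} (hij : i ≠ j)
    (hil : i ≠ l) (hlj : l ≠ j) (r s : R) :
    SpecialLinearGroup.transvection hil r * SpecialLinearGroup.transvection hlj s =
      SpecialLinearGroup.transvection hij (r * s) * SpecialLinearGroup.transvection hlj s *
        SpecialLinearGroup.transvection hil r := by
  apply Subtype.ext
  simp only [SpecialLinearGroup.coe_mul, SpecialLinearGroup.transvection_coe, mul_add, add_mul,
    one_mul, mul_one, single_mul_single_same, single_mul_single_of_ne _ _ _ _ hij.symm,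
    single_mul_single_of_ne _ _ _ _ hlj.symm, add_zero]
  abel

/-- The element of the special linear group with diagonal entries `α` at `i`, `α⁻¹` at `j` and `1`
elsewhere. -/
def Matrix.SpecialLinearGroup.coroot {i j : ι} (hij : i ≠ j) (α : Rˣ) : SpecialLinearGroup ι R :=
  ⟨diagonal fun m => if m = i then (α : R) else if m = j then ((α⁻¹ : Rˣ) : R) else 1, by
    rw [det_diagonal, ← Finset.mul_prod_erase _ _ (Finset.mem_univ i), if_pos rfl,
      ← Finset.mul_prod_erase _ _ (Finset.mem_erase.2 ⟨hij.symm, Finset.mem_univ j⟩),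
      if_neg hij.symm, if_pos rfl, Finset.prod_eq_one, mul_one, Units.mul_inv]
    intro m hm
    simp only [Finset.mem_erase] at hm
    rw [if_neg hm.2.1, if_neg hm.1]⟩

theorem Matrix.SpecialLinearGroup.coe_coroot {i j : ι} (hij : i ≠ j) (α : Rˣ) :
    (SpecialLinearGroup.coroot hij α : Matrix ι ι R) =
      diagonal fun m => if m = i then (α : R) else if m = j then ((α⁻¹ : Rˣ) : R) else 1 := rfl

theorem Matrix.SpecialLinearGroup.coroot_mul_transvection {i j l : ι} (hij : i ≠ j) (hil : i ≠ l)
    (hlj : l ≠ j) (α : Rˣ) (r : R) :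
    SpecialLinearGroup.coroot hil α * SpecialLinearGroup.transvection hij r =
      SpecialLinearGroup.transvection hij (α * r) * SpecialLinearGroup.coroot hil α := by
  apply Subtype.ext
  simp only [SpecialLinearGroup.coe_mul, SpecialLinearGroup.transvection_coe,
    SpecialLinearGroup.coe_coroot, mul_add, add_mul, one_mul, mul_one]
  congr 1
  ext a b
  rw [diagonal_mul, mul_diagonal, single_apply, single_apply]
  by_cases hab : i = a ∧ j = b
  · obtain ⟨rfl, rfl⟩ := hab
    simp [hij.symm, hlj.symm]
  · rw [if_neg hab, if_neg hab, mul_zero, zero_mul]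

theorem Matrix.SpecialLinearGroup.coroot_mul_transvection_self {i j : ι} (hij : i ≠ j)
    (α : Rˣ) (r : R) :
    SpecialLinearGroup.coroot hij α * SpecialLinearGroup.transvection hij r =
      SpecialLinearGroup.transvection hij (α ^ 2 * r) * SpecialLinearGroup.coroot hij α := by
  apply Subtype.ext
  simp only [SpecialLinearGroup.coe_mul, SpecialLinearGroup.transvection_coe,
    SpecialLinearGroup.coe_coroot, mul_add, add_mul, one_mul, mul_one]
  congr 1
  ext a b
  rw [diagonal_mul, mul_diagonal, single_apply, single_apply]
  by_cases hab : i = a ∧ j = b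
  · obtain ⟨rfl, rfl⟩ := hab
    simp only [and_self, if_true, hij.symm, if_false]
    rw [mul_right_comm, pow_two, mul_assoc (α : R), Units.mul_inv, mul_one]
  · rw [if_neg hab, if_neg hab, mul_zero, zero_mul]

end Relations

/-! ### Representations that are standard up to an ideal killed by the maximal ideal. -/

section ZeroProducts

open Matrix

variable {ι R T k : Type*} [Fintype ι] [DecidableEq ι] [CommRing R] [CommRing T] [Field k]

/-- The difference between the image of a transvection and the identity. -/
def transvectionPart (X : SpecialLinearGroup ι R →* Matrix ι ι T) {i j : ι} (h : i ≠ j) (r : R) :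
    Matrix ι ι T :=
  X (SpecialLinearGroup.transvection h r) - 1

theorem map_transvection (X : SpecialLinearGroup ι R →* Matrix ι ι T) {i j : ι} (h : i ≠ j)
    (r : R) : X (SpecialLinearGroup.transvection h r) = 1 + transvectionPart X h r := by
  rw [transvectionPart]; abel

/-- The products of (the images of) elementary nilpotent matrices which vanish in the standard
representation, vanish. -/
def HasZeroProducts (X : SpecialLinearGroup ι R →* Matrix ι ι T) : Prop :=
  ∀ (i j m l : ι) (hij : i ≠ j) (hml : m ≠ l) (r s : R), j ≠ m →
    transvectionPart X hij r * transvectionPart X hml s = 0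

/-- `X` agrees modulo the ideal `I`, which is killed by the kernel of the reduction `πT` and
contained in it, with the representation given by a ring homomorphism. -/
structure IsStandardModulo (π : R →+* k) (πT : T →+* k) (I : Ideal T)
    (X : SpecialLinearGroup ι R →* Matrix ι ι T) : Prop where
  le_ker : ∀ x ∈ I, πT x = 0
  mul_eq_zero : ∀ x ∈ I, ∀ y, πT y = 0 → x * y = 0
  offDiag : ∀ (g : SpecialLinearGroup ι R) a b, g a b = 0 → X g a b ∈ I
  diag : ∀ (g : SpecialLinearGroup ι R) a, g a a = 1 → X g a a - 1 ∈ I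
  reduction : ∀ (g : SpecialLinearGroup ι R) a b, πT (X g a b) = π (g a b)

namespace IsStandardModulo

variable {π : R →+* k} {πT : T →+* k} {I : Ideal T} {X : SpecialLinearGroup ι R →* Matrix ι ι T}

theorem mul_eq_zero_of_mem (H : IsStandardModulo π πT I X) {x y : T} (hx : x ∈ I) (hy : y ∈ I) :
    x * y = 0 := H.mul_eq_zero x hx y (H.le_ker y hy)

theorem part_mem (H : IsStandardModulo π πT I X) {i j : ι} (h : i ≠ j) (r : R) {a b : ι}
    (hab : ¬ (a = i ∧ b = j)) : transvectionPart X h r a b ∈ I := by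
  have hs : (single i j r : Matrix ι ι R) a b = 0 := by
    rw [single_apply, if_neg]; exact fun hc => hab ⟨hc.1.symm, hc.2.symm⟩
  rw [transvectionPart, Matrix.sub_apply]
  by_cases hd : a = b
  · subst hd
    rw [one_apply_eq]
    refine H.diag _ _ ?_
    rw [SpecialLinearGroup.transvection_coe, Matrix.add_apply, hs, one_apply_eq, add_zero]
  · rw [one_apply_ne hd, sub_zero]
    refine H.offDiag _ _ _ ?_
    rw [SpecialLinearGroup.transvection_coe, Matrix.add_apply, hs, one_apply_ne hd, add_zero]

theorem reduction_part (H : IsStandardModulo π πT I X) {i j : ι} (h : i ≠ j) (r : R) :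
    πT (transvectionPart X h r i j) = π r := by
  rw [transvectionPart, Matrix.sub_apply, one_apply_ne h, sub_zero, H.reduction]
  congr 1
  rw [SpecialLinearGroup.transvection_coe, Matrix.add_apply, one_apply_ne h, single_apply_same, zero_add]

theorem part_one_isUnit [IsLocalHom πT] (H : IsStandardModulo π πT I X) {i j : ι} (h : i ≠ j) :
    IsUnit (transvectionPart X h (1 : R) i j) :=
  isUnit_of_map_unit πT _ (by rw [H.reduction_part, map_one]; exact isUnit_one)

/-- Every entry of a part lies in I except the one at its own position, and I has square zero. In
the sum over c only c = j (in row i) and c = m (in column l) can therefore contribute. -/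
theorem part_mul_part (H : IsStandardModulo π πT I X) {i j m l : ι} (hij : i ≠ j) (hml : m ≠ l)
    (r s : R) (hjm : j ≠ m) (a b : ι) :
    (transvectionPart X hij r * transvectionPart X hml s) a b =
      (if a = i then transvectionPart X hij r i j * transvectionPart X hml s j b else 0) +
      (if b = l then transvectionPart X hij r a m * transvectionPart X hml s m l else 0) := by
  set N := transvectionPart X hij r
  set M := transvectionPart X hml s
  have key : ∀ c, N a c * M c b = (if c = j then if a = i then N i j * M j b else 0 else 0) +
      (if c = m then if b = l then N a m * M m l else 0 else 0) := by
    intro c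
    have hz : ¬ (a = i ∧ c = j) → ¬ (c = m ∧ b = l) → N a c * M c b = 0 := fun h1 h2 =>
      H.mul_eq_zero_of_mem (H.part_mem hij r h1) (H.part_mem hml s h2)
    by_cases h1 : c = j
    · subst h1
      rw [if_pos rfl, if_neg hjm, add_zero]
      split_ifs with h2
      · rw [h2]
      · exact hz (fun h => h2 h.1) (fun h => hjm h.1)
    · rw [if_neg h1, zero_add]
      by_cases h2 : c = m
      · subst h2
        rw [if_pos rfl]
        split_ifs with h3
        · rw [h3]
        · exact hz (fun h => h1 h.2) (fun h => h3 h.2)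
      · rw [if_neg h2]
        exact hz (fun h => h1 h.2) (fun h => h2 h.1)
  rw [mul_apply, Finset.sum_congr rfl fun c _ => key c, Finset.sum_add_distrib]
  simp only [Finset.sum_ite_eq', Finset.mem_univ, if_true]

theorem part_comm (X : SpecialLinearGroup ι R →* Matrix ι ι T) {i j m l : ι} (hij : i ≠ j)
    (hml : m ≠ l) (r s : R) (hjm : j ≠ m) (hil : i ≠ l) :
    transvectionPart X hij r * transvectionPart X hml s =
      transvectionPart X hml s * transvectionPart X hij r := by
  have := congrArg X (SpecialLinearGroup.transvection_commute hij hml hjm hil r s)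
  rw [map_mul, map_mul, map_transvection, map_transvection] at this
  rw [← sub_eq_zero] at this ⊢
  rw [← this]
  noncomm_ring

theorem part_comm_apply (H : IsStandardModulo π πT I X) {i j m l : ι} (hij : i ≠ j) (hml : m ≠ l)
    (r s : R) (hjm : j ≠ m) (hil : i ≠ l) (a b : ι) :
    (if a = i then transvectionPart X hij r i j * transvectionPart X hml s j b else 0) +
      (if b = l then transvectionPart X hij r a m * transvectionPart X hml s m l else 0) =
    (if a = m then transvectionPart X hml s m l * transvectionPart X hij r l b else 0) +
      (if b = j then transvectionPart X hml s a i * transvectionPart X hij r i j else 0) := by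
  rw [← H.part_mul_part hij hml r s hjm, ← H.part_mul_part hml hij s r hil.symm,
    part_comm X hij hml r s hjm hil]

theorem part_add (X : SpecialLinearGroup ι R →* Matrix ι ι T) {i j : ι} (hij : i ≠ j) (r s : R) :
    transvectionPart X hij (r + s) = transvectionPart X hij r + transvectionPart X hij s +
      transvectionPart X hij r * transvectionPart X hij s := by
  have := congrArg X (SpecialLinearGroup.transvection_add hij r s)
  rw [map_mul, map_transvection, map_transvection, map_transvection] at this
  rw [← sub_eq_zero] at this ⊢
  rw [← this]
  noncomm_ring

theorem part_commutator (X : SpecialLinearGroup ι R →* Matrix ι ι T) {i j l : ι} (hij : i ≠ j)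
    (hil : i ≠ l) (hlj : l ≠ j) (r s : R) :
    transvectionPart X hil r * transvectionPart X hlj s =
      transvectionPart X hij (r * s) + transvectionPart X hlj s * transvectionPart X hil r +
      transvectionPart X hij (r * s) * transvectionPart X hlj s +
      transvectionPart X hij (r * s) * transvectionPart X hil r +
      transvectionPart X hij (r * s) * transvectionPart X hlj s * transvectionPart X hil r := by
  have := congrArg X (SpecialLinearGroup.transvection_mul_transvection hij hil hlj r s)
  simp only [map_mul, map_transvection] at this
  rw [← sub_eq_zero] at this ⊢
  rw [← this]
  noncomm_ring

end IsStandardModulo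

end ZeroProducts

/-! ### The first-order computation: vanishing of the products. -/

section ZeroProductsProof

open Matrix

variable {ι R T k : Type*} [Fintype ι] [DecidableEq ι] [CommRing R] [CommRing T] [Field k]
  {π : R →+* k} {πT : T →+* k} {I : Ideal T} {X : SpecialLinearGroup ι R →* Matrix ι ι T}

namespace IsStandardModulo

/-- Commutation with the transvection at (i, l), l a third index, read at the entry (m, l), leaves a
single product, whose other factor is a unit. The next two lemmas use the same device with (l, j)
and with (m, l). -/
theorem part_apply_col [IsLocalHom πT] (H : IsStandardModulo π πT I X)
    (h3 : ∀ i j : ι, ∃ l, l ≠ i ∧ l ≠ j) {i j : ι} (hij : i ≠ j) (r : R) {m : ι} (hm : m ≠ i) :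
    transvectionPart X hij r m i = 0 := by
  obtain ⟨l, hli, hlj⟩ := h3 i j
  have := H.part_comm_apply hij hli.symm r 1 hij.symm hli.symm m l
  rw [if_neg hm, if_pos rfl, if_neg hm, if_neg hlj, zero_add, add_zero] at this
  exact (H.part_one_isUnit hli.symm).mul_left_eq_zero.1 this

theorem part_apply_row [IsLocalHom πT] (H : IsStandardModulo π πT I X)
    (h3 : ∀ i j : ι, ∃ l, l ≠ i ∧ l ≠ j) {i j : ι} (hij : i ≠ j) (r : R) {m : ι} (hm : m ≠ j) :
    transvectionPart X hij r j m = 0 := by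
  obtain ⟨l, hli, hlj⟩ := h3 i j
  have := H.part_comm_apply hij hlj r 1 hlj.symm hij l m
  rw [if_neg hli, if_neg hm, if_pos rfl, if_neg hm, zero_add, add_zero] at this
  exact (H.part_one_isUnit hlj).mul_right_eq_zero.1 this.symm

theorem part_apply_of_ne [IsLocalHom πT] (H : IsStandardModulo π πT I X) {i j : ι} (hij : i ≠ j)
    (r : R) {l m : ι} (hlm : l ≠ m) (hli : l ≠ i) (hmi : m ≠ i) (hmj : m ≠ j) :
    transvectionPart X hij r l m = 0 := by
  have := H.part_comm_apply hij hlm.symm r 1 hmj.symm hli.symm m m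
  rw [if_neg hmi, if_neg hlm.symm, if_pos rfl, if_neg hmj, zero_add, add_zero] at this
  exact (H.part_one_isUnit hlm.symm).mul_right_eq_zero.1 this.symm

/-- The diagonal entries away from `i, j` vanish: torus argument. -/
theorem part_apply_diag_of_unit [IsLocalHom π] [IsLocalHom πT] (H : IsStandardModulo π πT I X)
    {α : Rˣ} (hα : π α ≠ 1) {i j : ι} (hij : i ≠ j) (r : R) {l : ι} (hli : l ≠ i) (hlj : l ≠ j) :
    transvectionPart X hij r l l = 0 := by
  set h := SpecialLinearGroup.coroot hli.symm α with hh
  have hmem : ∀ (r : R) c, transvectionPart X hij r c l ∈ I := fun r c =>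
    H.part_mem hij r (fun hc => hlj hc.2)
  have hmem' : ∀ (r : R) c, transvectionPart X hij r l c ∈ I := fun r c =>
    H.part_mem hij r (fun hc => hli hc.1)
  have hoff : ∀ c, c ≠ l → X h l c ∈ I ∧ X h c l ∈ I := by
    intro c hc
    constructor <;> refine H.offDiag _ _ _ ?_
    · rw [hh, SpecialLinearGroup.coe_coroot, diagonal_apply_ne _ hc.symm]
    · rw [hh, SpecialLinearGroup.coe_coroot, diagonal_apply_ne _ hc]
  have hunit : IsUnit (X h l l) := by
    refine isUnit_of_map_unit πT _ ?_
    rw [H.reduction]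
    rw [hh, SpecialLinearGroup.coe_coroot, diagonal_apply_eq, if_neg hli, if_pos rfl]
    exact (Units.isUnit _).map π
  have hinv : ∀ r, transvectionPart X hij (α * r) l l = transvectionPart X hij r l l := by
    intro r
    have h1 := congrArg X
      (SpecialLinearGroup.coroot_mul_transvection hij hli.symm hlj α r)
    rw [map_mul, map_mul, map_transvection, map_transvection, mul_add, add_mul, one_mul, mul_one,
      add_right_inj] at h1
    have h2 := congrFun (congrFun h1 l) l
    rw [mul_apply, mul_apply, Finset.sum_eq_single l, Finset.sum_eq_single l, mul_comm] at h2
    · exact (hunit.mul_right_cancel h2).symm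
    · intro c _ hc
      exact H.mul_eq_zero_of_mem (hmem' _ c) (hoff c hc).2
    · simp
    · intro c _ hc
      exact H.mul_eq_zero_of_mem (hoff c hc).1 (hmem _ c)
    · simp
  have hadd : ∀ r s, transvectionPart X hij (r + s) l l =
      transvectionPart X hij r l l + transvectionPart X hij s l l := by
    intro r s
    rw [part_add, Matrix.add_apply, Matrix.add_apply, mul_apply, Finset.sum_eq_zero, add_zero]
    intro c _
    exact H.mul_eq_zero_of_mem (hmem' _ _) (hmem _ _)
  have hw : IsUnit ((α : R) - 1) := isUnit_of_map_unit π _ (by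
    rw [map_sub, map_one]; exact (sub_ne_zero.2 hα).isUnit)
  -- The (l, l) entry is additive in r and invariant under r ↦ αr, so it vanishes on multiples of
  -- the unit α - 1.
  obtain ⟨s, rfl⟩ : ∃ s, (α - 1) * s = r := ⟨↑hw.unit⁻¹ * r, by rw [← mul_assoc]; simp⟩
  have h1 := hadd ((α - 1) * s) s
  rw [show ((α : R) - 1) * s + s = α * s by ring, hinv, right_eq_add] at h1
  exact h1

/-- The diagonal entries away from `i, j` vanish: commutator argument. -/
theorem part_apply_diag_of_exists (H : IsStandardModulo π πT I X) {i j : ι} (hij : i ≠ j) (r : R)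
    {l m : ι} (hli : l ≠ i) (hlj : l ≠ j) (hmi : m ≠ i) (hmj : m ≠ j) (hml : m ≠ l) :
    transvectionPart X hij r l l = 0 := by
  have h := congrFun (congrFun (part_commutator X hij hmi.symm hmj r 1) l) l
  rw [mul_one] at h
  set N := transvectionPart X hmi.symm r
  set P := transvectionPart X hmj 1
  set Q := transvectionPart X hij r
  have hN : ∀ c, N c l ∈ I ∧ N l c ∈ I := fun c =>
    ⟨H.part_mem _ _ fun hc => hml hc.2.symm, H.part_mem _ _ fun hc => hli hc.1⟩
  have hP : ∀ c, P c l ∈ I ∧ P l c ∈ I := fun c =>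
    ⟨H.part_mem _ _ fun hc => hlj hc.2, H.part_mem _ _ fun hc => hml hc.1.symm⟩
  have hQ : ∀ c, Q c l ∈ I ∧ Q l c ∈ I := fun c =>
    ⟨H.part_mem _ _ fun hc => hlj hc.2, H.part_mem _ _ fun hc => hli hc.1⟩
  -- The index l is not among i, j, m, so at (l, l) each product in the commutator relation is a sum
  -- of products of two elements of I; only the linear term survives.
  have hz : ∀ A B : Matrix ι ι T, (∀ c, A l c ∈ I) → (∀ c, B c l ∈ I) → (A * B) l l = 0 :=
    fun A B hA hB => by
      rw [mul_apply]
      exact Finset.sum_eq_zero fun c _ => H.mul_eq_zero_of_mem (hA c) (hB c)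
  simp only [Matrix.add_apply] at h
  rw [hz N P (fun c => (hN c).2) (fun c => (hP c).1), hz P N (fun c => (hP c).2) (fun c => (hN c).1),
    hz Q P (fun c => (hQ c).2) (fun c => (hP c).1), hz Q N (fun c => (hQ c).2) (fun c => (hN c).1),
    hz (Q * P) N (fun c => by
      rw [mul_apply]
      exact Ideal.sum_mem _ fun d _ => Ideal.mul_mem_right _ _ ((hQ d).2)) (fun c => (hN c).1)] at h
  simpa using h.symm

/-- Commutation relations settle every entry except the diagonal ones away from i and j. Those alone
need `h4`: a unit of residue different from 1, or a fourth index. This is how degree 3 over 𝔽₂ gets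
excluded. -/
theorem part_apply_eq_zero [IsLocalHom π] [IsLocalHom πT] (H : IsStandardModulo π πT I X)
    (h3 : ∀ i j : ι, ∃ l, l ≠ i ∧ l ≠ j)
    (h4 : (∃ α : Rˣ, π α ≠ 1) ∨ ∀ i j l : ι, ∃ m, m ≠ i ∧ m ≠ j ∧ m ≠ l)
    {i j : ι} (hij : i ≠ j) (r : R) {a b : ι} (ha : a ≠ i) (hb : b ≠ j) :
    transvectionPart X hij r a b = 0 := by
  by_cases hbi : b = i
  · subst hbi; exact H.part_apply_col h3 hij r ha
  by_cases haj : a = j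
  · subst haj; exact H.part_apply_row h3 hij r hb
  by_cases hab : a = b
  · subst hab
    rcases h4 with ⟨α, hα⟩ | h4
    · exact H.part_apply_diag_of_unit hα hij r ha hb
    · obtain ⟨m, hmi, hmj, hml⟩ := h4 i j a
      exact H.part_apply_diag_of_exists hij r ha hb hmi hmj hml
  · exact H.part_apply_of_ne hij r hab ha hbi hb

/-- The entry `(l, l)` of the product of the parts at `(l, j)` and `(i, l)`. -/
theorem part_mul_part_diag [IsLocalHom π] [IsLocalHom πT] (H : IsStandardModulo π πT I X)
    (h3 : ∀ i j : ι, ∃ l, l ≠ i ∧ l ≠ j)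
    (h4 : (∃ α : Rˣ, π α ≠ 1) ∨ ∀ i j l : ι, ∃ m, m ≠ i ∧ m ≠ j ∧ m ≠ l)
    {i j l : ι} (hij : i ≠ j) (hil : i ≠ l) (hlj : l ≠ j) (r s : R) :
    (transvectionPart X hlj s * transvectionPart X hil r) l l = 0 := by
  have h := congrFun (congrFun (part_commutator X hij hil hlj r s) l) l
  set N := transvectionPart X hil r
  set P := transvectionPart X hlj s
  have hQ0 : transvectionPart X hij (r * s) l l = 0 :=
    H.part_apply_eq_zero h3 h4 hij _ hil.symm hlj
  have hQi : transvectionPart X hij (r * s) l i = 0 :=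
    H.part_apply_eq_zero h3 h4 hij _ hil.symm hij
  set Q := transvectionPart X hij (r * s)
  have hN : ∀ c, N l c ∈ I := fun c => H.part_mem _ _ fun hc => hil hc.1.symm
  have hN' : ∀ c, c ≠ i → N c l ∈ I := fun c hc => H.part_mem _ _ fun hc' => hc hc'.1
  have hP : ∀ c, P c l ∈ I := fun c => H.part_mem _ _ fun hc => hlj hc.2
  have hP' : ∀ c, c ≠ l → ∀ d, P c d ∈ I := fun c hc d => H.part_mem _ _ fun hc' => hc hc'.1
  have hQ : ∀ c, Q l c ∈ I := fun c => H.part_mem _ _ fun hc => hil hc.1.symm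
  have hNP : (N * P) l l = 0 := by
    rw [mul_apply]
    exact Finset.sum_eq_zero fun c _ => H.mul_eq_zero_of_mem (hN c) (hP c)
  have hQP : ∀ d, d ≠ j → (Q * P) l d = 0 := by
    intro d hd
    rw [mul_apply]
    exact Finset.sum_eq_zero fun c _ =>
      H.mul_eq_zero_of_mem (hQ c) (H.part_mem _ _ fun hc' => hd hc'.2)
  have hQN : (Q * N) l l = 0 := by
    rw [mul_apply]
    refine Finset.sum_eq_zero fun c _ => ?_
    by_cases hc : c = i
    · rw [hc, hQi, zero_mul]
    · exact H.mul_eq_zero_of_mem (hQ c) (hN' c hc)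
  have hQPN : (Q * P * N) l l = 0 := by
    rw [mul_apply]
    refine Finset.sum_eq_zero fun c _ => ?_
    by_cases hc : c = j
    · subst hc
      refine H.mul_eq_zero_of_mem ?_ (hN' _ hij.symm)
      rw [mul_apply]
      exact Ideal.sum_mem _ fun d _ => Ideal.mul_mem_right _ _ (hQ d)
    · rw [hQP c hc, zero_mul]
  simp only [Matrix.add_apply] at h
  rw [hNP, hQ0, hQP l hlj, hQN, hQPN] at h
  simpa using h.symm

/-- Zero products in degree at least three. -/
theorem hasZeroProducts [IsLocalHom π] [IsLocalHom πT] (H : IsStandardModulo π πT I X)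
    (h3 : ∀ i j : ι, ∃ l, l ≠ i ∧ l ≠ j)
    (h4 : (∃ α : Rˣ, π α ≠ 1) ∨ ∀ i j l : ι, ∃ m, m ≠ i ∧ m ≠ j ∧ m ≠ l) :
    HasZeroProducts X := by
  have off : ∀ {i j : ι} (hij : i ≠ j) (r : R) {a b : ι} (ha : a ≠ i) (hb : b ≠ j),
    transvectionPart X hij r a b = 0 := H.part_apply_eq_zero h3 h4
  -- the distinguished entry, away from the case of two equal positions
  have main : ∀ (i j m l : ι) (hij : i ≠ j) (hml : m ≠ l) (r s : R), j ≠ m → ¬ (m = i ∧ l = j) →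
      transvectionPart X hij r i j * transvectionPart X hml s j l +
        transvectionPart X hij r i m * transvectionPart X hml s m l = 0 := by
    intro i j m l hij hml r s hjm hne
    by_cases hil : i = l
    · subst hil
      have := H.part_mul_part_diag h3 h4 hjm.symm hml hij s r
      rwa [H.part_mul_part _ _ _ _ hjm, if_pos rfl, if_pos rfl] at this
    · have := H.part_comm_apply hij hml r s hjm hil i l
      rw [if_pos rfl, if_pos rfl] at this
      rw [this]
      have h1 : (if i = m then transvectionPart X hml s m l * transvectionPart X hij r l l else 0)
          = 0 := by
        split_ifs with h
        · rw [off hij r (Ne.symm hil) (fun hlj => hne ⟨h.symm, hlj⟩), mul_zero]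
        · rfl
      have h2 : (if l = j then transvectionPart X hml s i i * transvectionPart X hij r i j else 0)
          = 0 := by
        split_ifs with h
        · rw [off hml s (fun him => hne ⟨him.symm, h⟩) hil, zero_mul]
        · rfl
      rw [h1, h2, add_zero]
  intro i j m l hij hml r s hjm
  ext a b
  rw [H.part_mul_part hij hml r s hjm, Matrix.zero_apply]
  by_cases ha : a = i
  · subst ha
    rw [if_pos rfl]
    by_cases hb : b = l
    · subst hb
      rw [if_pos rfl]
      by_cases hne : m = a ∧ b = j
      · obtain ⟨rfl, rfl⟩ := hne
        -- Two parts at the same position (m, b) are not covered by `main`. The claim follows by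
        -- eliminating between three instances of `main` that involve a third index l, after
        -- multiplication by the unit entries at (m, l) and (l, b).
        obtain ⟨l, hli, hlj⟩ := h3 m b
        have h1 := main m b m l hij hli.symm r 1 hjm (fun h => hlj h.2)
        have h2 := main l b m b hlj hij 1 s hjm (fun h => hli h.1.symm)
        have h5 := main l b m l hlj hli.symm 1 1 hjm (fun h => hlj h.2)
        have hu1 := H.part_one_isUnit hli.symm
        have hu2 := H.part_one_isUnit hlj
        apply hu1.mul_right_cancel
        apply hu2.mul_right_cancel
        linear_combination
          (transvectionPart X hij s m b * transvectionPart X hlj 1 l b) * h1 +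
          (transvectionPart X hij r m b * transvectionPart X hli.symm 1 m l) * h2 -
          (transvectionPart X hij r m b * transvectionPart X hij s m b) * h5
      · exact main a j m b hij hml r s hjm hne
    · rw [if_neg hb, off hml s hjm hb, mul_zero, add_zero]
  · rw [if_neg ha, zero_add]
    split_ifs
    · rw [off hij r ha hjm.symm, zero_mul]
    · rfl

/-- Zero products in degree two. -/
theorem hasZeroProducts_two {X : SpecialLinearGroup (Fin 2) R →* Matrix (Fin 2) (Fin 2) T}
    [IsLocalHom π] [IsLocalHom πT] (H : IsStandardModulo π πT I X)
    {t : Rˣ} (ht : π t ^ 4 ≠ 1) : HasZeroProducts X := by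
  have sum2 : ∀ {i j : Fin 2}, i ≠ j → ∀ f : Fin 2 → T, ∑ c, f c = f i + f j := by
    intro i j hij f
    rw [Fin.sum_univ_two]
    fin_cases i <;> fin_cases j <;> simp at hij ⊢
    exact add_comm _ _
  have ht0 : π t ≠ 0 := (t.isUnit.map π).ne_zero
  have hkill : ∀ x ∈ I, ∀ y, πT y ≠ 0 → x * y = 0 → x = 0 := fun x _ y hy h =>
    ((isUnit_of_map_unit πT y hy.isUnit).mul_left_eq_zero).1 h
  have main : ∀ (i j : Fin 2) (hij : i ≠ j) (r s : R),
      transvectionPart X hij r * transvectionPart X hij s = 0 := by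
    intro i j hij
    set N := fun r => transvectionPart X hij r with hN
    have hNd : ∀ r, transvectionPart X hij r = N r := fun _ => rfl
    have hii : ∀ r, N r i i ∈ I := fun r => H.part_mem _ _ fun h => hij h.2
    have hjj : ∀ r, N r j j ∈ I := fun r => H.part_mem _ _ fun h => hij h.1.symm
    have hji : ∀ r, N r j i ∈ I := fun r => H.part_mem _ _ fun h => hij h.2
    have hred : ∀ r, πT (N r i j) = π r := fun r => H.reduction_part hij r
    have hz : ∀ {x y : T}, x ∈ I → y ∈ I → x * y = 0 := H.mul_eq_zero_of_mem
    set h := SpecialLinearGroup.coroot hij t with hh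
    have hhij : X h i j ∈ I := H.offDiag _ _ _ (by
      change (h : Matrix _ _ R) i j = 0
      rw [hh, SpecialLinearGroup.coe_coroot, diagonal_apply_ne _ hij])
    have hhji : X h j i ∈ I := H.offDiag _ _ _ (by
      change (h : Matrix _ _ R) j i = 0
      rw [hh, SpecialLinearGroup.coe_coroot, diagonal_apply_ne _ hij.symm])
    have hhii : πT (X h i i) = π t := by
      rw [H.reduction]
      rw [hh, SpecialLinearGroup.coe_coroot, diagonal_apply_eq, if_pos rfl]
    have hhjj : πT (X h j j) * π t = 1 := by
      rw [H.reduction]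
      rw [hh, SpecialLinearGroup.coe_coroot, diagonal_apply_eq, if_neg hij.symm, if_pos rfl,
        ← map_mul, Units.inv_mul, map_one]
    have hconj : ∀ r, X h * N r = N (t ^ 2 * r) * X h := by
      intro r
      have h1 := congrArg X (SpecialLinearGroup.coroot_mul_transvection_self hij t r)
      rwa [map_mul, map_mul, map_transvection, map_transvection, mul_add, add_mul, one_mul,
        mul_one, add_right_inj] at h1
    have hcomm : ∀ r s, N r i j * N s j i = N s i j * N r j i := by
      intro r s
      have h1 : N r * N s = N s * N r := by
        have h2 := part_add X hij r s
        rw [add_comm r s, part_add X hij s r, add_comm (transvectionPart X hij s)] at h2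
        exact (add_left_cancel h2).symm
      have h2 := congrFun (congrFun h1 i) i
      rw [mul_apply, mul_apply, sum2 hij, sum2 hij, hz (hii _) (hii _), hz (hii _) (hii _)] at h2
      simpa using h2
    have hc1 : N 1 j i = 0 := by
      have h1 := congrFun (congrFun (hconj 1) j) i
      rw [mul_one, mul_apply, mul_apply, sum2 hij, sum2 hij, hz hhji (hii _), hz (hjj _) hhji,
        zero_add, add_zero] at h1
      have h2 := hcomm 1 (t ^ 2)
      have h3 : N 1 j i * (X h j j * N 1 i j - N (t ^ 2) i j * X h i i) = 0 := by
        linear_combination (N 1 i j) * h1 + X h i i * h2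
      refine hkill _ (hji 1) _ ?_ h3
      rw [map_sub, map_mul, map_mul, hred, hred, map_one, mul_one, hhii, map_pow]
      intro h4
      apply ht
      linear_combination (-π t) * h4 + hhjj
    have hc : ∀ r, N r j i = 0 := by
      intro r
      have h1 := hcomm 1 r
      rw [hc1, mul_zero] at h1
      exact (H.part_one_isUnit hij).mul_right_eq_zero.1 h1
    have hadd : ∀ r s, N (r + s) i i = N r i i + N s i i ∧ N (r + s) j j = N r j j + N s j j := by
      intro r s
      have h1 : N (r + s) = N r + N s + N r * N s := part_add X hij r s
      constructor
      · rw [h1, Matrix.add_apply, Matrix.add_apply, mul_apply, sum2 hij, hz (hii _) (hii _), hc]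
        simp
      · rw [h1, Matrix.add_apply, Matrix.add_apply, mul_apply, sum2 hij, hz (hjj _) (hjj _), hc]
        simp
    have hw : IsUnit ((t : R) ^ 2 - 1) := isUnit_of_map_unit π _ (by
      rw [map_sub, map_one, map_pow]
      refine (sub_ne_zero.2 fun h1 => ht ?_).isUnit
      rw [show (4 : ℕ) = 2 * 2 from rfl, pow_mul, h1, one_pow])
    have hsurj : ∀ r, ∃ s, ((t : R) ^ 2 - 1) * s = r := fun r =>
      ⟨↑hw.unit⁻¹ * r, by rw [← mul_assoc]; simp⟩
    -- The torus relation at (i, i), together with additivity of the diagonal entries, expresses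
    -- them through the single element X(h)_ji of I; `hd` does the same at (j, j).
    have ha : ∀ r, X h i i * N (((t : R) ^ 2 - 1) * r) i i = - (N (t ^ 2 * r) i j * X h j i) := by
      intro r
      have h1 := congrFun (congrFun (hconj r) i) i
      rw [mul_apply, mul_apply, sum2 hij, sum2 hij, hc, mul_zero, add_zero] at h1
      have h2 := (hadd (((t : R) ^ 2 - 1) * r) r).1
      rw [show ((t : R) ^ 2 - 1) * r + r = t ^ 2 * r by ring] at h2
      rw [h2] at h1
      linear_combination -h1
    have hd : ∀ r, X h j j * N (((t : R) ^ 2 - 1) * r) j j = X h j i * N r i j := by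
      intro r
      have h1 := congrFun (congrFun (hconj r) j) j
      rw [mul_apply, mul_apply, sum2 hij, sum2 hij, hc, zero_mul, zero_add] at h1
      have h2 := (hadd (((t : R) ^ 2 - 1) * r) r).2
      rw [show ((t : R) ^ 2 - 1) * r + r = t ^ 2 * r by ring] at h2
      rw [h2] at h1
      linear_combination -h1
    have hmain : ∀ r s, N r i i * N s i j + N r i j * N s j j = 0 := by
      intro r s
      obtain ⟨r, rfl⟩ := hsurj r
      obtain ⟨s, rfl⟩ := hsurj s
      refine hkill _ (add_mem (Ideal.mul_mem_right _ _ (hii _)) (Ideal.mul_mem_left _ _ (hjj _)))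
        (X h i i * X h j j) ?_ ?_
      · rw [map_mul, hhii, mul_comm, hhjj]; exact one_ne_zero
      -- The combination of `ha` and `hd` leaves X(h)_ji times an element of residue t·s·(t²-1)r -
      -- t⁻¹·t²r·(t²-1)s = 0, and I is killed by such elements.
      · have h1 : X h j i * (X h i i * N s i j * N (((t : R) ^ 2 - 1) * r) i j -
            X h j j * N (t ^ 2 * r) i j * N (((t : R) ^ 2 - 1) * s) i j) = 0 := by
          refine H.mul_eq_zero _ hhji _ ?_
          simp only [map_sub, map_mul, hred, hhii, map_pow, map_one]
          linear_combination (-π t * π r * π s * (π t ^ 2 - 1)) * hhjj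
        linear_combination h1 + X h j j * N (((t : R) ^ 2 - 1) * s) i j * ha r +
          X h i i * N (((t : R) ^ 2 - 1) * r) i j * hd s
    intro r s
    change N r * N s = 0
    have hcases : ∀ a : Fin 2, a = i ∨ a = j := by
      intro a; fin_cases i <;> fin_cases j <;> fin_cases a <;> simp at hij ⊢
    ext a b
    rw [mul_apply, sum2 hij, Matrix.zero_apply]
    rcases hcases a with rfl | rfl <;> rcases hcases b with rfl | rfl
    · rw [hz (hii _) (hii _), hc, mul_zero, add_zero]
    · exact hmain r s
    · rw [hc, hc, zero_mul, mul_zero, add_zero]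
    · rw [hc, hz (hjj _) (hjj _), zero_mul, add_zero]
  intro i j m l hij hml r s hjm
  obtain rfl : m = i := by
    fin_cases i <;> fin_cases j <;> fin_cases m <;> simp at hij hjm ⊢
  obtain rfl : l = j := by
    fin_cases m <;> fin_cases j <;> fin_cases l <;> simp at hij hml ⊢
  exact main _ _ hij r s

end IsStandardModulo

end ZeroProductsProof

/-! ### Weyl elements. -/

section Weyl

open Matrix

variable {ι R : Type*} [Fintype ι] [DecidableEq ι] [CommRing R]

/-- A representative of the reflection in the Weyl group, as a product of transvections. -/
def Matrix.SpecialLinearGroup.weyl {i j : ι} (hij : i ≠ j) (α : Rˣ) : SpecialLinearGroup ι R :=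
  SpecialLinearGroup.transvection hij (α : R) *
    SpecialLinearGroup.transvection hij.symm (-((α⁻¹ : Rˣ) : R)) *
    SpecialLinearGroup.transvection hij (α : R)

theorem Matrix.SpecialLinearGroup.weyl_one_mul_transvection {i j : ι} (hij : i ≠ j) :
    SpecialLinearGroup.weyl hij (1 : Rˣ) * SpecialLinearGroup.transvection hij 1 =
      SpecialLinearGroup.transvection hij.symm (-1) * SpecialLinearGroup.weyl hij 1 := by
  apply Subtype.ext
  simp only [SpecialLinearGroup.weyl, SpecialLinearGroup.coe_mul,
    SpecialLinearGroup.transvection_coe, Units.val_one, inv_one, ← single_neg]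
  have h1 : (single i j (1 : R)) * single i j 1 = 0 := single_mul_single_of_ne _ _ _ _ hij.symm _
  have h2 : (single j i (1 : R)) * single j i 1 = 0 := single_mul_single_of_ne _ _ _ _ hij _
  have h3 : (single i j (1 : R)) * single j i 1 * single i j 1 = single i j 1 := by simp
  have h4 : (single j i (1 : R)) * single i j 1 * single j i 1 = single j i 1 := by simp
  set E := single i j (1 : R)
  set F := single j i (1 : R)
  have e1 : (1 + E) * (1 + -F) * (1 + E) = 1 + E + (E - E * F * E) - F - (E * F + F * E) + E * E := by
    noncomm_ring
  rw [e1, h1, h3]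
  have e2 : (1 + E + (E - E) - F - (E * F + F * E) + 0) * (1 + E) =
      1 + E + E - F - E * F - F * E - F * E + (E * E - E * F * E - F * (E * E)) := by noncomm_ring
  have e3 : (1 + -F) * (1 + E + (E - E) - F - (E * F + F * E) + 0) =
    1 + E - F - F - E * F - F * E - F * E + (F * F + F * E * F + F * F * E) := by noncomm_ring
  rw [e2, e3, h1, h2, h3, h4]
  noncomm_ring

end Weyl

/-! ### Straightening a representation with zero products. -/

section Structure

open Matrix

variable {ι R T k : Type*} [Fintype ι] [DecidableEq ι] [CommRing R] [CommRing T] [Field k]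
  {π : R →+* k} {πT : T →+* k} {X : SpecialLinearGroup ι R →* Matrix ι ι T}

theorem Matrix.isUnit_of_isUnit_map {ι S T : Type*} [Fintype ι] [DecidableEq ι] [CommRing S]
    [CommRing T] (φ : T →+* S) [IsLocalHom φ] {M : Matrix ι ι T} (h : IsUnit (M.map φ)) :
    IsUnit M := by
  rw [isUnit_iff_isUnit_det] at h ⊢
  refine isUnit_of_map_unit φ _ ?_
  rwa [RingHom.map_det]

namespace HasZeroProducts

theorem part_add (hX : HasZeroProducts X) {i j : ι} (hij : i ≠ j) (r s : R) :
    transvectionPart X hij (r + s) = transvectionPart X hij r + transvectionPart X hij s := by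
  rw [IsStandardModulo.part_add, hX _ _ _ _ _ _ _ _ hij.symm, add_zero]

theorem part_neg (hX : HasZeroProducts X) {i j : ι} (hij : i ≠ j) (r : R) :
    transvectionPart X hij (-r) = - transvectionPart X hij r := by
  have h0 : transvectionPart X hij 0 = 0 := by
    have := hX.part_add hij 0 0
    rw [add_zero] at this
    exact left_eq_add.1 this
  rw [eq_neg_iff_add_eq_zero, ← hX.part_add, neg_add_cancel, h0]

theorem part_mul (hX : HasZeroProducts X) {i j l : ι} (hij : i ≠ j) (hil : i ≠ l) (hlj : l ≠ j)
    (r s : R) : transvectionPart X hil r * transvectionPart X hlj s =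
      transvectionPart X hij (r * s) := by
  rw [IsStandardModulo.part_commutator X hij hil hlj, hX _ _ _ _ hlj hil _ _ hij.symm,
    hX _ _ _ _ hij hlj _ _ hlj.symm, hX _ _ _ _ hij hil _ _ hij.symm]
  simp

theorem reduction_part (hred : ∀ (g : SpecialLinearGroup ι R) a b, πT (X g a b) = π (g a b))
    {i j : ι} (hij : i ≠ j) (r : R) :
    (transvectionPart X hij r).map πT = single i j (π r) := by
  ext a b
  have h2 : (SpecialLinearGroup.transvection hij r : SpecialLinearGroup ι R) a b =
    (1 : Matrix ι ι R) a b + single i j r a b := rfl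
  rw [map_apply, transvectionPart, Matrix.sub_apply, map_sub, hred, h2, map_add, single_apply,
    single_apply, one_apply, one_apply]
  split_ifs <;> simp

/-- With a third index this is formal from `part_mul`. In rank two the relation w t_ij(1) = t_ji(-1)
w yields H(F - FHF) = 0, while F² = 0 yields F(F - FHF) = 0; and F + H is invertible because it
reduces to a permutation matrix. -/
theorem part_mul_part_mul_part [IsLocalHom πT] (hX : HasZeroProducts X)
    (hred : ∀ (g : SpecialLinearGroup ι R) a b, πT (X g a b) = π (g a b)) {i j : ι} (hij : i ≠ j) :
    transvectionPart X hij 1 * transvectionPart X hij.symm 1 * transvectionPart X hij 1 =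
      transvectionPart X hij 1 := by
  by_cases h3 : ∃ l, l ≠ i ∧ l ≠ j
  · obtain ⟨l, hli, hlj⟩ := h3
    have h1 := hX.part_mul hij.symm hlj.symm hli 1 1
    have h2 := hX.part_mul hli.symm hij hlj.symm 1 1
    have h4 := hX.part_mul hlj hli hij 1 1
    have h5 := hX.part_mul hij hli.symm hlj 1 1
    rw [mul_one] at h1 h2 h4 h5
    rw [← h1, ← mul_assoc, h2, mul_assoc, h4, h5]
  · push Not at h3
    have hF : transvectionPart X hij 1 * transvectionPart X hij 1 = 0 :=
      hX _ _ _ _ _ _ _ _ hij.symm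
    have hH : transvectionPart X hij.symm 1 * transvectionPart X hij.symm 1 = 0 :=
      hX _ _ _ _ _ _ _ _ hij
    have hunit : IsUnit (transvectionPart X hij 1 + transvectionPart X hij.symm 1) := by
      refine isUnit_of_isUnit_map πT ?_
      rw [Matrix.map_add _ (map_add πT), reduction_part hred, reduction_part hred, map_one]
      refine isUnit_iff_exists_inv.2 ⟨single i j 1 + single j i 1, ?_⟩
      rw [add_mul, mul_add, mul_add, single_mul_single_same, single_mul_single_same,
        single_mul_single_of_ne _ _ _ _ hij, single_mul_single_of_ne _ _ _ _ hij.symm, zero_add,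
        add_zero, mul_one]
      ext a b
      rw [Matrix.add_apply, single_apply, single_apply, one_apply]
      have := h3 a
      grind
    have hrel := congrArg X (SpecialLinearGroup.weyl_one_mul_transvection (R := R) hij)
    simp only [SpecialLinearGroup.weyl, map_mul, map_transvection, Units.val_one, inv_one,
      hX.part_neg] at hrel
    set F := transvectionPart X hij 1
    set H := transvectionPart X hij.symm 1
    have e1 : (1 + F) * (1 + -H) * (1 + F) * (1 + F) - (1 + -H) * ((1 + F) * (1 + -H) * (1 + F)) =
        (F - F * H * F) + (H - H * F * H) + (H * F - H * F * H * F) +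
        (F * F + F * F + F * (F * F) - F * H * (F * F) - H * H - H * H * F) := by
      noncomm_ring
    rw [sub_eq_zero.2 hrel, hF, hH] at e1
    have e2 : (F - F * H * F) + (H - H * F * H) + (H * F - H * F * H * F) = 0 := by
      rw [e1]; simp
    have e3 : H * (F - F * H * F) = 0 := by
      have h := congrArg (H * ·) e2
      simp only [mul_zero] at h
      rw [← h]
      have e4 : H * (F - F * H * F + (H - H * F * H) + (H * F - H * F * H * F)) =
        H * (F - F * H * F) + (H * H - H * H * F * H + H * H * F - H * H * F * H * F) := by
        noncomm_ring
      rw [e4, hH]; simp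
    have e5 : F * (F - F * H * F) = 0 := by
      have e6 : F * (F - F * H * F) = F * F - F * F * H * F := by noncomm_ring
      rw [e6, hF]; simp
    have e7 : (F + H) * (F - F * H * F) = 0 := by rw [add_mul, e5, e3, add_zero]
    exact (sub_eq_zero.1 (hunit.mul_right_eq_zero.1 e7)).symm

/-- After conjugation, the images of the transvections are transvections. -/
theorem exists_conj [Nontrivial ι] [IsLocalHom πT] (hX : HasZeroProducts X)
    (hred : ∀ (g : SpecialLinearGroup ι R) a b, πT (X g a b) = π (g a b)) :
    ∃ P : (Matrix ι ι T)ˣ, (P : Matrix ι ι T).map πT = 1 ∧ ∃ σ : ι → ι → R → T,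
      (∀ (i j : ι) (hij : i ≠ j) (r : R),
        transvectionPart X hij r * P = P * single i j (σ i j r)) ∧
      ∀ i j : ι, i ≠ j → σ i j 1 = 1 := by
  obtain ⟨o, o', ho⟩ := exists_pair_ne ι
  obtain ⟨F, hF⟩ : ∃ F : ∀ {i j : ι}, i ≠ j → Matrix ι ι T,
      ∀ {i j : ι} (h : i ≠ j), F h = transvectionPart X h 1 := ⟨fun h => _, fun _ => rfl⟩
  have hzero : ∀ {i j m l : ι} (hij : i ≠ j) (hml : m ≠ l), j ≠ m → F hij * F hml = 0 :=
    fun hij hml h => by rw [hF, hF, hX _ _ _ _ hij hml _ _ h]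
  have hmul : ∀ {i j l : ι} (hij : i ≠ j) (hil : i ≠ l) (hlj : l ≠ j), F hil * F hlj = F hij :=
    fun hij hil hlj => by rw [hF, hF, hF, hX.part_mul hij hil hlj, mul_one]
  -- the columns of the conjugating matrix
  let p : ι → ι → T := fun i =>
    if h : i = o then F ho *ᵥ Pi.single o' 1 else F h *ᵥ (F ho *ᵥ Pi.single o' 1)
  have hpo : p o = F ho *ᵥ Pi.single o' 1 := dif_pos rfl
  have hpi : ∀ {i} (h : i ≠ o), p i = F h *ᵥ p o := fun h => by rw [hpo]; exact dif_neg h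
  -- This and `hFp` say that the F_ij act on the vectors p as matrix units act on the standard
  -- basis. The case `j = o'` below, with i = o, is where FHF = F is used.
  have hFp0 : ∀ {i j l : ι} (hij : i ≠ j), l ≠ j → F hij *ᵥ p l = 0 := by
    intro i j l hij hl
    by_cases hlo : l = o
    · subst hlo
      rw [hpo, mulVec_mulVec, hzero _ _ hl.symm, zero_mulVec]
    · rw [hpi hlo, mulVec_mulVec, hzero _ _ hl.symm, zero_mulVec]
  have hFp : ∀ {i j : ι} (hij : i ≠ j), F hij *ᵥ p j = p i := by
    intro i j hij
    by_cases hjo : j = o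
    · subst hjo; rw [hpi hij]
    by_cases hio : i = o
    · subst hio
      rw [hpi hjo, hpo, mulVec_mulVec, mulVec_mulVec]
      congr 1
      by_cases hjo' : j = o'
      · subst hjo'
        rw [hF, hF]
        exact hX.part_mul_part_mul_part hred ho
      · rw [mul_assoc, hmul hjo' hjo ho, hmul ho hij hjo']
    · rw [hpi hjo, hpi hio, mulVec_mulVec, hmul hio hij hjo]
  set M : Matrix ι ι T := Matrix.of fun a b => p b a with hM
  have hcol : ∀ (A : Matrix ι ι T) a b, (A * M) a b = (A *ᵥ p b) a := fun A a b => rfl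
  have hredF : ∀ {i j : ι} (hij : i ≠ j), (F hij).map πT = single i j 1 := fun hij => by
    rw [hF, reduction_part hred, map_one]
  have hmapvec : ∀ (A : Matrix ι ι T) (v : ι → T), πT ∘ (A *ᵥ v) = A.map πT *ᵥ (πT ∘ v) := by
    intro A v
    ext a
    exact RingHom.map_mulVec πT A v a
  have hredpo : πT ∘ p o = Pi.single o 1 := by
    rw [hpo, hmapvec, hredF]
    have : (πT ∘ (Pi.single o' 1 : ι → T)) = Pi.single o' 1 := by
      ext a; by_cases ha : a = o'
      · subst ha; simp
      · simp [ha]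
    rw [this]
    ext a
    simp [single_apply, Pi.single_apply, eq_comm]
  have hredp : ∀ i, πT ∘ p i = Pi.single i 1 := by
    intro i
    by_cases h : i = o
    · subst h; exact hredpo
    · rw [hpi h, hmapvec, hredF, hredpo]
      ext a
      simp [single_apply, Pi.single_apply, eq_comm]
  have hMred : M.map πT = 1 := by
    ext a b
    rw [map_apply, hM, of_apply]
    have := congrFun (hredp b) a
    rw [Function.comp_apply] at this
    rw [this, one_apply, Pi.single_apply]
  obtain ⟨P, hP⟩ : IsUnit M := isUnit_of_isUnit_map πT (by rw [hMred]; exact isUnit_one)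
  have hconjF : ∀ {i j : ι} (hij : i ≠ j),
      (↑P⁻¹ : Matrix ι ι T) * F hij * (P : Matrix ι ι T) = single i j 1 := by
    intro i j hij
    rw [mul_assoc, Units.inv_mul_eq_iff_eq_mul, hP]
    ext a b
    rw [hcol]
    by_cases hb : b = j
    · subst hb; rw [hFp]; simp [hM]
    · rw [hFp0 _ hb]; simp [hb]
  refine ⟨P, by rw [hP, hMred], fun i j r => if h : i ≠ j then
    ((↑P⁻¹ : Matrix ι ι T) * transvectionPart X h r * P) i j else 0, ?_, ?_⟩
  · intro i j hij r
    simp only [hij, ne_eq, not_false_eq_true, dif_pos]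
    rw [← Units.inv_mul_eq_iff_eq_mul, ← mul_assoc]
    set N := (↑P⁻¹ : Matrix ι ι T) * transvectionPart X hij r * P with hN
    -- Matrix units are themselves conjugates of the F_ml, so the zero products annihilate every row
    -- of N but the i-th and, by `hr`, every column but the j-th.
    have hl : ∀ {m l : ι} (hml : m ≠ l), l ≠ i → single m l (1 : T) * N = 0 := by
      intro m l hml hl
      have : single m l (1 : T) * N =
          (↑P⁻¹ : Matrix ι ι T) * (F hml * transvectionPart X hij r) * P := by
        rw [← hconjF hml, hN]
        simp only [mul_assoc, Units.mul_inv_cancel_left]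
      rw [this, hF, hX _ _ _ _ hml hij _ _ hl, mul_zero, zero_mul]
    have hr : ∀ {m l : ι} (hml : m ≠ l), j ≠ m → N * single m l (1 : T) = 0 := by
      intro m l hml hl
      have : N * single m l (1 : T) =
          (↑P⁻¹ : Matrix ι ι T) * (transvectionPart X hij r * F hml) * P := by
        rw [← hconjF hml, hN]
        simp only [mul_assoc, Units.mul_inv_cancel_left]
      rw [this, hF, hX _ _ _ _ hij hml _ _ hl, mul_zero, zero_mul]
    ext a b
    rw [single_apply]
    by_cases ha : a = i
    · subst ha
      by_cases hb : b = j
      · subst hb; simp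
      · rw [if_neg (fun h => hb h.2.symm)]
        obtain ⟨l, hl⟩ := exists_ne b
        have := congrFun (congrFun (hr hl.symm (Ne.symm hb)) a) l
        simpa using this
    · rw [if_neg (fun h => ha h.1.symm)]
      obtain ⟨m, hm⟩ := exists_ne a
      have := congrFun (congrFun (hl hm ha) m) b
      simpa using this
  · intro i j hij
    simp only [hij, ne_eq, not_false_eq_true, dif_pos]
    have := hconjF hij
    rw [hF] at this
    rw [this]; simp

end HasZeroProducts
end Structure

/-! ### From coefficients of transvections to a ring homomorphism. -/

section RingHomOfTransvections

open Matrix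

variable {ι R T : Type*} [Fintype ι] [DecidableEq ι] [CommRing R] [CommRing T]

namespace Matrix.SpecialLinearGroup

theorem coeff_add {X : SpecialLinearGroup ι R →* Matrix ι ι T} {σ : ι → ι → R → T}
    (hσ : ∀ (i j : ι) (hij : i ≠ j) (r : R),
      X (SpecialLinearGroup.transvection hij r) = 1 + single i j (σ i j r))
    {i j : ι} (hij : i ≠ j) (r s : R) : σ i j (r + s) = σ i j r + σ i j s := by
  have h := congrArg X (SpecialLinearGroup.transvection_add hij r s)
  simp only [map_mul, hσ, mul_add, add_mul, mul_one, one_mul,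
    single_mul_single_of_ne _ _ _ _ hij.symm, add_zero] at h
  have h2 := congrFun (congrFun h i) j
  simpa [hij] using h2

/-- Degree at least three: a family of maps describing the images of the transvections comes from
a ring homomorphism. -/
theorem exists_ringHom_of_three {X : SpecialLinearGroup ι R →* Matrix ι ι T} {σ : ι → ι → R → T}
    [Nontrivial ι] (h3 : ∀ i j : ι, ∃ l, l ≠ i ∧ l ≠ j)
    (hσ : ∀ (i j : ι) (hij : i ≠ j) (r : R),
      X (SpecialLinearGroup.transvection hij r) = 1 + single i j (σ i j r))
    (h1 : ∀ i j : ι, i ≠ j → σ i j 1 = 1) :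
    ∃ f : R →+* T, ∀ i j : ι, i ≠ j → ∀ r, σ i j r = f r := by
  -- The commutator relation. With r or s equal to 1 it makes σ independent of its indices; in
  -- general it then gives multiplicativity.
  have hmul : ∀ {i j l : ι}, i ≠ j → i ≠ l → l ≠ j → ∀ r s, σ i l r * σ l j s = σ i j (r * s) := by
    intro i j l hij hil hlj r s
    have h := congrArg X (SpecialLinearGroup.transvection_mul_transvection hij hil hlj r s)
    simp only [map_mul, hσ, add_mul, mul_add, one_mul, mul_one, single_mul_single_same,
      single_mul_single_of_ne _ _ _ _ hij.symm, single_mul_single_of_ne _ _ _ _ hlj.symm,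
      add_zero] at h
    have h2 := congrFun (congrFun h i) j
    simpa [single_apply, hij, hil, hlj, hil.symm, hlj.symm] using h2
  have hrow : ∀ {i j l : ι}, i ≠ j → i ≠ l → ∀ r, σ i j r = σ i l r := by
    intro i j l hij hil r
    by_cases hlj : l = j
    · rw [hlj]
    · have := hmul hij hil hlj r 1
      rw [h1 _ _ hlj, mul_one, mul_one] at this
      exact this.symm
  have hcol : ∀ {i j l : ι}, i ≠ j → l ≠ j → ∀ r, σ i j r = σ l j r := by
    intro i j l hij hlj r
    by_cases hil : i = l
    · rw [hil]
    · have := hmul hij hil hlj 1 r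
      rw [h1 _ _ hil, one_mul, one_mul] at this
      exact this.symm
  obtain ⟨o, o', ho⟩ := exists_pair_ne ι
  have hall : ∀ i j : ι, i ≠ j → ∀ r, σ i j r = σ o o' r := by
    intro i j hij r
    by_cases hjo : j = o
    · subst hjo
      obtain ⟨l, hli, hlo⟩ := h3 i j
      rw [hrow hij hli.symm, hcol hli.symm hlo.symm, hrow hlo.symm ho]
    · rw [hcol hij (Ne.symm hjo), hrow (Ne.symm hjo) ho]
  obtain ⟨l, hlo, hlo'⟩ := h3 o o'
  have hadd := fun r s => coeff_add hσ ho r s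
  exact ⟨RingHom.mk' ⟨⟨σ o o', h1 _ _ ho⟩, fun r s => by
    change σ o o' (r * s) = σ o o' r * σ o o' s
    rw [← hall o l hlo.symm (r * s), ← hmul hlo.symm ho hlo'.symm, hall o' l hlo'.symm s]⟩ hadd,
    hall⟩

theorem coe_transvection_zero_one (c : R) :
    (transvection (zero_ne_one (α := Fin 2)) c : Matrix (Fin 2) (Fin 2) R) = !![1, c; 0, 1] := by
  rw [transvection_coe]
  ext a b; fin_cases a <;> fin_cases b <;> simp

theorem coe_transvection_one_zero (c : R) :
    (transvection (zero_ne_one (α := Fin 2)).symm c : Matrix (Fin 2) (Fin 2) R) =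
      !![1, 0; c, 1] := by
  rw [transvection_coe]
  ext a b; fin_cases a <;> fin_cases b <;> simp

theorem coe_weyl_zero_one (α : Rˣ) :
    (weyl (zero_ne_one (α := Fin 2)) α : Matrix (Fin 2) (Fin 2) R) =
      !![0, (α : R); -((α⁻¹ : Rˣ) : R), 0] := by
  rw [weyl, coe_mul, coe_mul, coe_transvection_zero_one, coe_transvection_one_zero]
  ext a b; fin_cases a <;> fin_cases b <;> simp [Matrix.mul_apply, Fin.sum_univ_two]

theorem weyl_mul_transvection_inv_sq (α : Rˣ) :
    weyl (zero_ne_one (α := Fin 2)) α * transvection zero_ne_one 1 =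
      transvection zero_ne_one.symm (-((α⁻¹ : Rˣ) : R) ^ 2) * weyl zero_ne_one α := by
  apply Subtype.ext
  rw [coe_mul, coe_mul, coe_weyl_zero_one, coe_transvection_zero_one, coe_transvection_one_zero]
  ext a b; fin_cases a <;> fin_cases b <;> simp [Matrix.mul_apply, Fin.sum_univ_two, pow_two]

theorem coroot_mul_weyl_one (α : Rˣ) :
    coroot (zero_ne_one (α := Fin 2)) α * weyl zero_ne_one 1 = weyl zero_ne_one α := by
  apply Subtype.ext
  rw [coe_mul, coe_weyl_zero_one, coe_weyl_zero_one, coe_coroot]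
  ext a b; fin_cases a <;> fin_cases b <;> simp [Matrix.mul_apply, Fin.sum_univ_two]

theorem coroot_mul_coroot {i j : ι} (hij : i ≠ j) (α β : Rˣ) :
    SpecialLinearGroup.coroot hij (α * β) =
      SpecialLinearGroup.coroot hij α * SpecialLinearGroup.coroot hij β := by
  apply Subtype.ext
  rw [coe_mul, coe_coroot, coe_coroot, coe_coroot, diagonal_mul_diagonal]
  congr 1
  ext m
  split_ifs
  · simp
  · simp [mul_comm]
  · simp

/-- A map on a local ring which is additive and multiplicative on units is multiplicative. -/
theorem _root_.IsLocalRing.map_mul_of_isUnit [IsLocalRing R] {f : R → T}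
    (hadd : ∀ r s, f (r + s) = f r + f s) (h1 : f 1 = 1)
    (hmul : ∀ r s, IsUnit r → IsUnit s → f (r * s) = f r * f s) (r s : R) :
    f (r * s) = f r * f s := by
  -- Translation by 1 turns a nonunit into a unit, and additivity transports the product formula
  -- back.
  have step : ∀ r : R, IsUnit r ∨ IsUnit (r + 1) := by
    intro r
    rcases IsLocalRing.isUnit_or_isUnit_one_sub_self (-r) with h | h
    · exact Or.inl (by simpa using h.neg)
    · right; rwa [sub_neg_eq_add, add_comm] at h
  have h2 : ∀ r s, IsUnit s → f (r * s) = f r * f s := by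
    intro r s hs
    rcases step r with h | h
    · exact hmul r s h hs
    · have h3 := hmul (r + 1) s h hs
      rw [add_mul, one_mul, hadd, hadd, h1, add_mul, one_mul] at h3
      exact add_right_cancel h3
  rcases step s with h | h
  · exact h2 r s h
  · have h3 := h2 r (s + 1) h
    rw [mul_add, mul_one, hadd, hadd, h1, mul_add, mul_one] at h3
    exact add_right_cancel h3

/-- Degree two: a family of maps describing the images of the transvections comes from
a ring homomorphism. -/
theorem exists_ringHom_of_two [IsLocalRing R]
    {X : SpecialLinearGroup (Fin 2) R →* Matrix (Fin 2) (Fin 2) T} {σ : Fin 2 → Fin 2 → R → T}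
    (hσ : ∀ (i j : Fin 2) (hij : i ≠ j) (r : R),
      X (SpecialLinearGroup.transvection hij r) = 1 + single i j (σ i j r))
    (h1 : ∀ i j : Fin 2, i ≠ j → σ i j 1 = 1) :
    ∃ f : R →+* T, ∀ i j : Fin 2, i ≠ j → ∀ r, σ i j r = f r := by
  set s := σ 0 1 with hs
  set t := σ 1 0 with ht
  have h01 : (0 : Fin 2) ≠ 1 := zero_ne_one
  have hXs : ∀ r, X (SpecialLinearGroup.transvection h01 r) = !![1, s r; 0, 1] := by
    intro r
    rw [hσ]; ext a b; fin_cases a <;> fin_cases b <;> simp [hs]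
  have hXt : ∀ r, X (SpecialLinearGroup.transvection h01.symm r) = !![1, 0; t r, 1] := by
    intro r
    rw [hσ]; ext a b; fin_cases a <;> fin_cases b <;> simp [ht]
  have hsadd : ∀ r r', s (r + r') = s r + s r' := fun r r' => coeff_add hσ h01 r r'
  have htadd : ∀ r r', t (r + r') = t r + t r' := fun r r' => coeff_add hσ h01.symm r r'
  have htneg : ∀ r, t (-r) = - t r := by
    intro r
    have h0 : t 0 = 0 := by
      have := htadd 0 0
      rw [add_zero] at this
      exact left_eq_add.1 this
    rw [eq_neg_iff_add_eq_zero, ← htadd, neg_add_cancel, h0]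
  have hs1 : s 1 = 1 := h1 0 1 h01
  have hw : ∀ u : Rˣ, X (weyl h01 u) = !![1 - s u * t ↑u⁻¹, (1 - s u * t ↑u⁻¹) * s u + s u;
      - t ↑u⁻¹, 1 - t ↑u⁻¹ * s u] := by
    intro u
    rw [weyl, map_mul, map_mul, hXs, hXt, htneg]
    ext a b; fin_cases a <;> fin_cases b <;> simp [Matrix.mul_apply, Fin.sum_univ_two] <;> ring
  -- The (0, 1) entries of the Weyl relation differ exactly by 1 - s(u) t(u⁻¹).
  have hst : ∀ u : Rˣ, s u * t ↑u⁻¹ = 1 := by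
    intro u
    have h := congrArg X (weyl_mul_transvection_inv_sq u)
    rw [map_mul, map_mul, hw, hXs, hXt] at h
    have h2 := congrFun (congrFun h 0) 1
    simp [Matrix.mul_apply, Fin.sum_univ_two, hs1] at h2
    exact (sub_eq_zero.1 h2).symm
  have hw' : ∀ u : Rˣ, X (weyl h01 u) = !![0, s u; - t ↑u⁻¹, 0] := by
    intro u
    rw [hw, mul_comm (t _), hst]; simp
  -- The torus consists of quotients of Weyl elements; since it maps to diagonal matrices with s(u)
  -- as first entry, s is multiplicative on units.
  have hc : ∀ u : Rˣ, X (coroot h01 u) = !![s u, 0; 0, t ↑u⁻¹] := by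
    intro u
    have h := congrArg X (coroot_mul_weyl_one u)
    rw [map_mul, hw', hw', inv_one, Units.val_one, hs1] at h
    have ht1 : t 1 = 1 := h1 1 0 h01.symm
    rw [ht1] at h
    ext a b
    have h00 := congrFun (congrFun h a) 1
    have h11 := congrFun (congrFun h a) 0
    fin_cases a <;> fin_cases b <;> simp [Matrix.mul_apply, Fin.sum_univ_two] at h00 h11 ⊢ <;>
      assumption
  have hsmul : ∀ u v : Rˣ, s (u * v) = s u * s v := by
    intro u v
    have h := congrArg X (coroot_mul_coroot h01 u v)
    rw [map_mul, hc, hc, hc] at h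
    have h2 := congrFun (congrFun h 0) 0
    simpa [Matrix.mul_apply, Fin.sum_univ_two] using h2
  have hts : ∀ u : Rˣ, t u = s u := by
    intro u
    have h2 := hst u⁻¹
    have h4 := hsmul u u⁻¹
    rw [Units.mul_inv, hs1] at h4
    rw [inv_inv] at h2
    linear_combination (s u) * h2 + (-t u) * h4.symm
  have hts' : ∀ r, t r = s r := by
    intro r
    rcases IsLocalRing.isUnit_or_isUnit_one_sub_self r with ⟨u, rfl⟩ | ⟨u, hu⟩
    · exact hts u
    · have h2 := hts u
      have e1 : t 1 = t r + t u := by rw [← htadd, hu]; ring_nf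
      have e2 : s 1 = s r + s u := by rw [← hsadd, hu]; ring_nf
      have ht1 : t 1 = 1 := h1 1 0 h01.symm
      linear_combination e2 - e1 + ht1 - hs1 - h2
  refine ⟨RingHom.mk' ⟨⟨s, hs1⟩, IsLocalRing.map_mul_of_isUnit hsadd hs1 ?_⟩ hsadd, ?_⟩
  · rintro _ _ ⟨u, rfl⟩ ⟨v, rfl⟩
    exact hsmul u v
  · intro i j hij r
    fin_cases i <;> fin_cases j
    · exact absurd rfl hij
    · rfl
    · exact hts' r
    · exact absurd rfl hij

end Matrix.SpecialLinearGroup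

end RingHomOfTransvections

/-! ### Rigidity of the natural representation of SL_n. -/

section Rigidity

open Matrix

variable {n : ℕ} {R T k : Type*} [CommRing R] [CommRing T] [Field k]
  {π : R →+* k} {πT : T →+* k}

theorem exists_third_index {n : ℕ} (hn : 3 ≤ n) (i j : Fin n) : ∃ l, l ≠ i ∧ l ≠ j := by
  obtain ⟨l, hl⟩ := Finset.exists_mem_notMem_of_card_lt_card
    (s := {i, j}) (t := (Finset.univ : Finset (Fin n)))
    (by rw [Finset.card_univ, Fintype.card_fin]; exact Finset.card_le_two.trans_lt (by omega))
  exact ⟨l, by simpa [not_or] using hl.2⟩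

theorem exists_fourth_index {n : ℕ} (hn : 4 ≤ n) (i j m : Fin n) :
    ∃ l, l ≠ i ∧ l ≠ j ∧ l ≠ m := by
  obtain ⟨l, hl⟩ := Finset.exists_mem_notMem_of_card_lt_card
    (s := {i, j, m}) (t := (Finset.univ : Finset (Fin n)))
    (by rw [Finset.card_univ, Fintype.card_fin]; exact Finset.card_le_three.trans_lt (by omega))
  exact ⟨l, by simpa [not_or] using hl.2⟩

/-- Conjugation of a representation by an invertible matrix. -/
def conjRep {G ι T : Type*} [Fintype ι] [DecidableEq ι] [CommRing T] [Monoid G]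
    (P : (Matrix ι ι T)ˣ) (X : G →* Matrix ι ι T) : G →* Matrix ι ι T where
  toFun g := (↑P⁻¹ : Matrix ι ι T) * X g * P
  map_one' := by simp
  map_mul' g h := by simp only [map_mul, mul_assoc, Units.mul_inv_cancel_left]

/-- A representation with zero products over a local ring is conjugate to one coming from a
ring homomorphism. -/
theorem HasZeroProducts.exists_ringHom [IsLocalRing R] [IsLocalHom πT] (hn : 2 ≤ n)
    {X : SpecialLinearGroup (Fin n) R →* Matrix (Fin n) (Fin n) T} (hX : HasZeroProducts X)
    (hred : ∀ (g : SpecialLinearGroup (Fin n) R) a b, πT (X g a b) = π (g a b)) :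
    ∃ P : (Matrix (Fin n) (Fin n) T)ˣ, (P : Matrix (Fin n) (Fin n) T).map πT = 1 ∧
      ∃ f : R →+* T, (∀ r, πT (f r) = π r) ∧
        ∀ g : SpecialLinearGroup (Fin n) R,
          X g * P = P * (g : Matrix (Fin n) (Fin n) R).map f := by
  have : Nontrivial (Fin n) := Fin.nontrivial_iff_two_le.2 hn
  obtain ⟨P, hP, σ, hσ, h1⟩ := hX.exists_conj hred
  have hσ' : ∀ (i j : Fin n) (hij : i ≠ j) (r : R),
      conjRep P X (SpecialLinearGroup.transvection hij r) = 1 + single i j (σ i j r) := by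
    intro i j hij r
    change (↑P⁻¹ : Matrix (Fin n) (Fin n) T) * X _ * (P : Matrix (Fin n) (Fin n) T) = _
    rw [map_transvection, mul_add, add_mul, mul_one, Units.inv_mul, mul_assoc, hσ,
      Units.inv_mul_cancel_left]
  have hf : ∃ f : R →+* T, ∀ i j : Fin n, i ≠ j → ∀ r, σ i j r = f r := by
    rcases hn.eq_or_lt with rfl | hn
    · exact SpecialLinearGroup.exists_ringHom_of_two hσ' h1
    · exact SpecialLinearGroup.exists_ringHom_of_three (exists_third_index hn) hσ' h1
  obtain ⟨f, hf⟩ := hf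
  refine ⟨P, hP, f, fun r => ?_, fun g => ?_⟩
  · obtain ⟨i, j, hij⟩ := exists_pair_ne (Fin n)
    have h := congrArg (fun M : Matrix (Fin n) (Fin n) T => M.map πT) (hσ i j hij r)
    simp only [Matrix.map_mul, hP, mul_one, one_mul, HasZeroProducts.reduction_part hred] at h
    have h2 := congrFun (congrFun h i) j
    rw [map_apply, single_apply_same, single_apply_same, hf i j hij] at h2
    exact h2.symm
  · have heq : conjRep P X =
        SpecialLinearGroup.coeMonoidHom.comp (SpecialLinearGroup.map (n := Fin n) f) := by
      refine MonoidHom.eq_of_eqOn_dense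
        (SpecialLinearGroup.closure_transvection_eq_top n R) ?_
      rintro _ ⟨i, j, hij, r, rfl⟩
      rw [hσ', hf i j hij]
      ext a b
      change _ = f ((1 + single i j r : Matrix (Fin n) (Fin n) R) a b)
      rw [Matrix.add_apply, Matrix.add_apply, map_add, single_apply, single_apply, one_apply,
        one_apply]
      split_ifs <;> simp
    have h2 := DFunLike.congr_fun heq g
    have h3 : (↑P⁻¹ : Matrix (Fin n) (Fin n) T) * (X g * P) = (g : Matrix (Fin n) (Fin n) R).map f := by
      rw [← mul_assoc]; exact h2
    rw [← Units.inv_mul_eq_iff_eq_mul, h3]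

/-- The condition on the degree and the residue field under which the natural representation of
the special linear group is rigid. -/
def IsRigidDegree (n : ℕ) (π : R →+* k) : Prop :=
  (n = 2 ∧ ∃ t : Rˣ, π t ^ 4 ≠ 1) ∨ (3 ≤ n ∧ ((∃ α : Rˣ, π α ≠ 1) ∨ 4 ≤ n))

theorem IsStandardModulo.hasZeroProducts_of_isRigidDegree [IsLocalHom π] [IsLocalHom πT]
    (hn : IsRigidDegree n π) {I : Ideal T}
    {X : SpecialLinearGroup (Fin n) R →* Matrix (Fin n) (Fin n) T}
    (H : IsStandardModulo π πT I X) : HasZeroProducts X := by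
  rcases hn with ⟨rfl, t, ht⟩ | ⟨hn, h⟩
  · exact H.hasZeroProducts_two ht
  · exact H.hasZeroProducts (exists_third_index hn) (h.imp_right exists_fourth_index)

theorem transvectionPart_mapMatrix {S : Type*} [CommRing S] (q : T →+* S)
    (X : SpecialLinearGroup (Fin n) R →* Matrix (Fin n) (Fin n) T) {i j : Fin n} (hij : i ≠ j)
    (r : R) : transvectionPart (q.mapMatrix.toMonoidHom.comp X) hij r =
      (transvectionPart X hij r).map q := by
  ext a b
  simp [transvectionPart, one_apply, apply_ite q]

theorem transvectionPart_conjRep (P : (Matrix (Fin n) (Fin n) T)ˣ)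
    (X : SpecialLinearGroup (Fin n) R →* Matrix (Fin n) (Fin n) T) {i j : Fin n} (hij : i ≠ j)
    (r : R) : transvectionPart (conjRep P X) hij r =
      (↑P⁻¹ : Matrix (Fin n) (Fin n) T) * transvectionPart X hij r * P := by
  rw [transvectionPart, transvectionPart, mul_sub, sub_mul, mul_one, Units.inv_mul]
  rfl

theorem transvectionPart_mul_conjRep (P : (Matrix (Fin n) (Fin n) T)ˣ)
    (X : SpecialLinearGroup (Fin n) R →* Matrix (Fin n) (Fin n) T) {i j m l : Fin n} (hij : i ≠ j)
    (hml : m ≠ l) (r s : R) : transvectionPart X hij r * transvectionPart X hml s =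
      (P : Matrix (Fin n) (Fin n) T) * (transvectionPart (conjRep P X) hij r *
        transvectionPart (conjRep P X) hml s) * (↑P⁻¹ : Matrix (Fin n) (Fin n) T) := by
  rw [transvectionPart_conjRep, transvectionPart_conjRep]
  simp only [mul_assoc, Units.mul_inv_cancel_left, Units.mul_inv, mul_one]

/-- If a representation has zero products modulo the kernel of `q₁`, then it is conjugate, modulo
that kernel, to a representation coming from a ring homomorphism. -/
theorem exists_conjRep_map_eq [IsLocalRing R] [IsLocalHom πT] (h2 : 2 ≤ n)
    {X : SpecialLinearGroup (Fin n) R →* Matrix (Fin n) (Fin n) T}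
    (hred : ∀ (g : SpecialLinearGroup (Fin n) R) a b, πT (X g a b) = π (g a b))
    {T₁ : Type*} [CommRing T₁] {q₁ : T →+* T₁} (hq₁ : Function.Surjective q₁) {π₁ : T₁ →+* k}
    (hπ₁ : ∀ x, π₁ (q₁ x) = πT x) (hX₁ : HasZeroProducts (q₁.mapMatrix.toMonoidHom.comp X)) :
    ∃ P : (Matrix (Fin n) (Fin n) T)ˣ, (P : Matrix (Fin n) (Fin n) T).map πT = 1 ∧
      ∃ f : R →+* T₁, ∀ g : SpecialLinearGroup (Fin n) R,
        (conjRep P X g).map q₁ = (g : Matrix (Fin n) (Fin n) R).map f := by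
  have hloc₁ : IsLocalHom π₁ := ⟨fun x hx => by
    obtain ⟨x, rfl⟩ := hq₁ x
    rw [hπ₁] at hx
    exact (isUnit_of_map_unit πT x hx).map _⟩
  obtain ⟨P₁, hP₁, f, hf, hPf⟩ := hX₁.exists_ringHom (π := π) (πT := π₁) h2
    (fun g a b => by rw [← hred g a b, ← hπ₁]; rfl)
  -- Any entrywise lift of the conjugating matrix will do: it reduces to 1, hence is invertible.
  obtain ⟨M, hM⟩ : ∃ M : Matrix (Fin n) (Fin n) T, M.map q₁ = P₁ := by
    choose M hM using fun a b => hq₁ ((P₁ : Matrix (Fin n) (Fin n) T₁) a b)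
    exact ⟨Matrix.of M, by ext a b; exact hM a b⟩
  have hMπ : M.map πT = 1 := by
    rw [← hP₁, ← hM]
    ext a b
    rw [map_apply, map_apply, map_apply, hπ₁]
  obtain ⟨P, rfl⟩ : IsUnit M := isUnit_of_isUnit_map πT (by rw [hMπ]; exact isUnit_one)
  refine ⟨P, hMπ, f, fun g => ?_⟩
  have hinv : (↑P⁻¹ : Matrix (Fin n) (Fin n) T).map q₁ = (↑P₁⁻¹ : Matrix (Fin n) (Fin n) T₁) := by
    rw [eq_comm, Units.inv_eq_of_mul_eq_one_left]
    rw [← hM, ← Matrix.map_mul, Units.inv_mul, Matrix.map_one _ (map_zero _) (map_one _)]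
  have h3 := hPf g
  rw [← Units.inv_mul_eq_iff_eq_mul] at h3
  rw [← h3, ← hinv, ← hM]
  change ((↑P⁻¹ : Matrix (Fin n) (Fin n) T) * X g * (P : Matrix (Fin n) (Fin n) T)).map q₁ = _
  rw [mul_assoc, Matrix.map_mul, Matrix.map_mul]
  rfl

/-- The inductive step towards Nakayama. After a conjugation straightening the representation modulo
J, its image over T/𝔪J is standard modulo J/𝔪J, an ideal killed by 𝔪, and the first-order
computation applies. Conjugation does not affect whether products vanish. -/
theorem mul_mem_maximalIdeal_mul [IsLocalRing R] [IsLocalRing T] [IsLocalHom π]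
    (hπT : RingHom.ker πT = IsLocalRing.maximalIdeal T) [IsLocalHom πT]
    (h2 : 2 ≤ n) (hn : IsRigidDegree n π)
    {X : SpecialLinearGroup (Fin n) R →* Matrix (Fin n) (Fin n) T}
    (hred : ∀ (g : SpecialLinearGroup (Fin n) R) a b, πT (X g a b) = π (g a b))
    {J : Ideal T} (hJ : J ≤ RingHom.ker πT)
    (hX : ∀ (i j m l : Fin n) (hij : i ≠ j) (hml : m ≠ l) (r s : R), j ≠ m → ∀ a b,
      (transvectionPart X hij r * transvectionPart X hml s) a b ∈ J)
    {i j m l : Fin n} (hij : i ≠ j) (hml : m ≠ l) (r s : R) (hjm : j ≠ m) (a b : Fin n) :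
    (transvectionPart X hij r * transvectionPart X hml s) a b ∈ IsLocalRing.maximalIdeal T * J := by
  obtain ⟨P, hP, f, hconj⟩ := exists_conjRep_map_eq (π := π) (πT := πT) h2 hred
    (q₁ := Ideal.Quotient.mk J) Ideal.Quotient.mk_surjective
    (π₁ := Ideal.Quotient.lift J πT hJ) (fun _ => rfl) (by
      intro i j m l hij hml r s hjm
      rw [transvectionPart_mapMatrix, transvectionPart_mapMatrix, ← Matrix.map_mul]
      ext a b
      exact Ideal.Quotient.eq_zero_iff_mem.2 (hX i j m l hij hml r s hjm a b))
  have hPinv : (↑P⁻¹ : Matrix (Fin n) (Fin n) T).map πT = 1 := by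
    have := congrArg (fun A : Matrix (Fin n) (Fin n) T => A.map πT) P.inv_mul
    simpa only [Matrix.map_mul, hP, mul_one, Matrix.map_one _ (map_zero πT) (map_one πT)]
      using this
  obtain ⟨q, hq, hker⟩ : ∃ q : T →+* T ⧸ (IsLocalRing.maximalIdeal T * J),
      Function.Surjective q ∧ ∀ x, q x = 0 ↔ x ∈ IsLocalRing.maximalIdeal T * J :=
    ⟨Ideal.Quotient.mk _, Ideal.Quotient.mk_surjective, fun _ => Ideal.Quotient.eq_zero_iff_mem⟩
  obtain ⟨π₂, hπ₂⟩ : ∃ π₂ : T ⧸ (IsLocalRing.maximalIdeal T * J) →+* k, ∀ x, π₂ (q x) = πT x := by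
    have hle : ∀ x, q x = 0 → πT x = 0 := fun x hx => hJ (Ideal.mul_le_right ((hker x).1 hx))
    refine ⟨(RingHom.liftOfSurjective q hq) ⟨πT, fun x hx => hle x hx⟩, fun x => ?_⟩
    exact RingHom.liftOfRightInverse_comp_apply _ _ _ _ x
  have hloc₂ : IsLocalHom π₂ := ⟨fun x hx => by
    obtain ⟨x, rfl⟩ := hq x
    rw [hπ₂] at hx
    exact (isUnit_of_map_unit πT x hx).map _⟩
  have H : IsStandardModulo π π₂ (J.map q) (q.mapMatrix.toMonoidHom.comp (conjRep P X)) := by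
    refine ⟨fun x hx => ?_, fun x hx y hy => ?_, fun g a b hab => ?_, fun g a ha => ?_,
      fun g a b => ?_⟩
    · obtain ⟨x, hxJ, rfl⟩ := (Ideal.mem_map_iff_of_surjective q hq).1 hx
      rw [hπ₂]
      exact hJ hxJ
    · obtain ⟨x, hxJ, rfl⟩ := (Ideal.mem_map_iff_of_surjective q hq).1 hx
      obtain ⟨y, rfl⟩ := hq y
      rw [hπ₂] at hy
      have hy : y ∈ IsLocalRing.maximalIdeal T := by rw [← hπT]; exact hy
      rw [← map_mul, hker, mul_comm x y]
      exact Ideal.mul_mem_mul hy hxJ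
    · refine Ideal.mem_map_of_mem q (Ideal.Quotient.eq_zero_iff_mem.1 ?_)
      have := congrFun (congrFun (hconj g) a) b
      rwa [map_apply, map_apply, hab, map_zero] at this
    · have h4 : (q.mapMatrix.toMonoidHom.comp (conjRep P X)) g a a - 1 =
        q (conjRep P X g a a - 1) := by rw [map_sub, map_one]; rfl
      rw [h4]
      refine Ideal.mem_map_of_mem q (Ideal.Quotient.eq_zero_iff_mem.1 ?_)
      have := congrFun (congrFun (hconj g) a) a
      rw [map_apply, map_apply, ha, map_one] at this
      rw [map_sub, map_one, this, sub_self]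
    · change π₂ (q (conjRep P X g a b)) = _
      rw [hπ₂]
      change (((↑P⁻¹ : Matrix (Fin n) (Fin n) T) * X g *
        (P : Matrix (Fin n) (Fin n) T)).map πT) a b = _
      rw [Matrix.map_mul, Matrix.map_mul, hPinv, hP, one_mul, mul_one, map_apply, hred]
  have h5 := H.hasZeroProducts_of_isRigidDegree hn i j m l hij hml r s hjm
  rw [transvectionPart_mapMatrix, transvectionPart_mapMatrix, ← Matrix.map_mul] at h5
  have h6 : (transvectionPart X hij r * transvectionPart X hml s).map q = 0 := by
    rw [transvectionPart_mul_conjRep P, Matrix.map_mul, Matrix.map_mul, h5, mul_zero, zero_mul]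
  exact (hker _).1 (congrFun (congrFun h6 a) b)

theorem isLocalHom_of_ker_eq [IsLocalRing T] (hπT : RingHom.ker πT = IsLocalRing.maximalIdeal T) :
    IsLocalHom πT := ⟨fun x hx => by
  by_contra h
  have : x ∈ RingHom.ker πT := hπT ▸ (IsLocalRing.mem_maximalIdeal x).2 h
  rw [RingHom.mem_ker] at this
  exact hx.ne_zero this⟩

/-- The ideal J spanned by all entries of the products satisfies J ≤ 𝔪J by the previous lemma and is
finitely generated, so Nakayama gives J = 0. -/
theorem hasZeroProducts_of_reduction [IsLocalRing R] [IsLocalRing T] [IsNoetherianRing T]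
    [IsLocalHom π] (hπT : RingHom.ker πT = IsLocalRing.maximalIdeal T)
    (h2 : 2 ≤ n) (hn : IsRigidDegree n π)
    {X : SpecialLinearGroup (Fin n) R →* Matrix (Fin n) (Fin n) T}
    (hred : ∀ (g : SpecialLinearGroup (Fin n) R) a b, πT (X g a b) = π (g a b)) :
    HasZeroProducts X := by
  have hloc := isLocalHom_of_ker_eq hπT
  obtain ⟨S, hS⟩ : ∃ S : Set T, ∀ x, x ∈ S ↔ ∃ (i j m l : Fin n) (hij : i ≠ j) (hml : m ≠ l)
      (r s : R) (_ : j ≠ m) (a b : Fin n),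
      x = (transvectionPart X hij r * transvectionPart X hml s) a b := ⟨{x | _}, fun _ => Iff.rfl⟩
  have hmem : ∀ (i j m l : Fin n) (hij : i ≠ j) (hml : m ≠ l) (r s : R), j ≠ m → ∀ a b,
      (transvectionPart X hij r * transvectionPart X hml s) a b ∈ Ideal.span S :=
    fun i j m l hij hml r s hjm a b =>
      Ideal.subset_span ((hS _).2 ⟨i, j, m, l, hij, hml, r, s, hjm, a, b, rfl⟩)
  have hker : Ideal.span S ≤ RingHom.ker πT := by
    rw [Ideal.span_le]
    intro x hx
    obtain ⟨i, j, m, l, hij, hml, r, s, hjm, a, b, rfl⟩ := (hS x).1 hx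
    rw [SetLike.mem_coe, RingHom.mem_ker]
    have := congrFun (congrFun (Matrix.map_mul (f := πT) (L := transvectionPart X hij r)
      (M := transvectionPart X hml s)) a) b
    rw [HasZeroProducts.reduction_part hred, HasZeroProducts.reduction_part hred,
      single_mul_single_of_ne _ _ _ _ hjm, map_apply, Matrix.zero_apply] at this
    exact this
  have hle : Ideal.span S ≤ IsLocalRing.maximalIdeal T • Ideal.span S := by
    rw [smul_eq_mul]
    refine Ideal.span_le.2 fun x hx => ?_
    obtain ⟨i, j, m, l, hij, hml, r, s, hjm, a, b, rfl⟩ := (hS x).1 hx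
    exact mul_mem_maximalIdeal_mul hπT h2 hn hred hker hmem hij hml r s hjm a b
  have h0 : Ideal.span S = ⊥ := Submodule.eq_bot_of_le_smul_of_le_jacobson_bot
    (IsLocalRing.maximalIdeal T) (Ideal.span S) (IsNoetherian.noetherian _) hle
    (IsLocalRing.maximalIdeal_le_jacobson _)
  intro i j m l hij hml r s hjm
  ext a b
  have := hmem i j m l hij hml r s hjm a b
  rwa [h0, Ideal.mem_bot] at this

/-- Rigidity of the natural representation of the special linear group: each lift to a noetherian
local ring is strictly conjugate to one induced by a ring homomorphism. -/
theorem exists_ringHom_of_reduction [IsLocalRing R] [IsLocalRing T] [IsNoetherianRing T]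
    [IsLocalHom π] (hπT : RingHom.ker πT = IsLocalRing.maximalIdeal T)
    (h2 : 2 ≤ n) (hn : IsRigidDegree n π)
    {X : SpecialLinearGroup (Fin n) R →* Matrix (Fin n) (Fin n) T}
    (hred : ∀ (g : SpecialLinearGroup (Fin n) R) a b, πT (X g a b) = π (g a b)) :
    ∃ P : (Matrix (Fin n) (Fin n) T)ˣ, (P : Matrix (Fin n) (Fin n) T).map πT = 1 ∧
      ∃ f : R →+* T, (∀ r, πT (f r) = π r) ∧
        ∀ g : SpecialLinearGroup (Fin n) R,
          X g * P = P * (g : Matrix (Fin n) (Fin n) R).map f := by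
  have hloc := isLocalHom_of_ker_eq hπT
  exact (hasZeroProducts_of_reduction hπT h2 hn hred).exists_ringHom h2 hred

end Rigidity

/-! ### The excluded pairs (n, k). -/

section RigidDegree

/-- The group kˣ is cyclic of order q - 1, so it has exponent dividing 4 only when q - 1 divides 4,
that is, q = 2, 3 or 5. -/
theorem exists_pow_four_ne_one {k : Type*} [Field k] [Finite k] (h2 : Nat.card k ≠ 2)
    (h3 : Nat.card k ≠ 3) (h5 : Nat.card k ≠ 5) : ∃ t : kˣ, (t : k) ^ 4 ≠ 1 := by
  obtain ⟨g, hg⟩ := IsCyclic.exists_generator (α := kˣ)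
  refine ⟨g, fun h => ?_⟩
  have h4 : g ^ 4 = 1 := Units.ext (by simpa using h)
  have hord := orderOf_dvd_of_pow_eq_one h4
  rw [orderOf_eq_card_of_forall_mem_zpowers hg, Nat.card_units] at hord
  have hk : 1 < Nat.card k := Finite.one_lt_card
  have hle := Nat.le_of_dvd (by norm_num) hord
  generalize Nat.card k = c at *
  have hc : c ≤ 5 := by omega
  interval_cases c <;> omega

theorem exists_unit_ne_one {k : Type*} [Field k] [Finite k] (h2 : Nat.card k ≠ 2) :
    ∃ t : kˣ, (t : k) ≠ 1 := by
  have hk : 1 < Nat.card k := Finite.one_lt_card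
  have : 1 < Nat.card kˣ := by rw [Nat.card_units]; omega
  have := Finite.one_lt_card_iff_nontrivial.1 this
  obtain ⟨t, ht⟩ := exists_ne (1 : kˣ)
  exact ⟨t, fun h => ht (Units.ext (by simpa using h))⟩

namespace CHat

variable {k : Type u} [Field k]

instance isLocalHom_residue (R : CHat k) : IsLocalHom R.residue :=
  isLocalHom_of_ker_eq R.ker_residue

theorem exists_unit_residue_eq (R : CHat k) (t : kˣ) : ∃ u : (R : Type u)ˣ, R.residue u = t := by
  obtain ⟨x, hx⟩ := R.residue_surjective t
  have : IsUnit x := isUnit_of_map_unit R.residue x (by rw [hx]; exact t.isUnit)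
  exact ⟨this.unit, hx⟩

theorem isRigidDegree [Finite k] (R : CHat k) {n : ℕ} (hn : 2 ≤ n)
    (hnk : (n, Nat.card k) ∉ ({(2, 2), (2, 3), (2, 5), (3, 2)} : Set (ℕ × ℕ))) :
    IsRigidDegree n R.residue := by
  simp only [Set.mem_insert_iff, Set.mem_singleton_iff, Prod.mk.injEq, not_or, not_and] at hnk
  obtain ⟨h1, h2, h3, h4⟩ := hnk
  rcases hn.eq_or_lt with rfl | hn
  · obtain ⟨t, ht⟩ := exists_pow_four_ne_one (h1 rfl) (h2 rfl) (h3 rfl)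
    obtain ⟨u, hu⟩ := R.exists_unit_residue_eq t
    exact Or.inl ⟨rfl, u, by rwa [hu]⟩
  · refine Or.inr ⟨hn, ?_⟩
    rcases (Nat.succ_le_of_lt hn).eq_or_lt with rfl | hn
    · obtain ⟨t, ht⟩ := exists_unit_ne_one (h4 rfl)
      obtain ⟨u, hu⟩ := R.exists_unit_residue_eq t
      exact Or.inl ⟨u, by rwa [hu]⟩
    · exact Or.inr hn

end CHat

end RigidDegree

/-! ### Lifts on groups containing SL_n(R): twists by characters. -/

section LiftsOverSL

open Matrix

variable {k : Type u} [Field k] {n : ℕ} {R S : CHat k} {Γ : Type u} [Group Γ] [TopologicalSpace Γ]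

/-- A topological group embedded in `GL_n(R)`, containing `SL_n(R)`. -/
structure GroupOverSL (n : ℕ) (R : CHat k) (Γ : Type u) [Group Γ] [TopologicalSpace Γ] where
  toGL : Γ →* GL (Fin n) R
  continuous_toGL : Continuous toGL
  injective_toGL : Function.Injective toGL
  ofSL : SpecialLinearGroup (Fin n) R →* Γ
  toGL_ofSL : ∀ g, toGL (ofSL g) = SpecialLinearGroup.toGL g

/-- A homomorphism between the rings is determined by the induced homomorphism on the special
linear group up to conjugacy. -/
theorem CHat.Hom.eq_of_conj {f f' : CHat.Hom R S} (hn : 2 ≤ n) (K : GL (Fin n) S)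
    (h : ∀ g : SpecialLinearGroup (Fin n) R,
      GeneralLinearGroup.map f'.toRingHom (SpecialLinearGroup.toGL g) =
        K * GeneralLinearGroup.map f.toRingHom (SpecialLinearGroup.toGL g) * K⁻¹) : f = f' := by
  have : Nontrivial (Fin n) := Fin.nontrivial_iff_two_le.2 hn
  obtain ⟨i, j, hij⟩ := exists_pair_ne (Fin n)
  have htr : ∀ g : SpecialLinearGroup (Fin n) R,
      f.toRingHom (g : Matrix (Fin n) (Fin n) R).trace =
        f'.toRingHom (g : Matrix (Fin n) (Fin n) R).trace := by
    intro g
    have h1 := congrArg (fun A : GL (Fin n) S => (A : Matrix (Fin n) (Fin n) S).trace) (h g)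
    simp only [Units.val_mul] at h1
    rw [Matrix.trace_mul_comm, Units.inv_mul_cancel_left] at h1
    simp only [Matrix.trace, map_sum]
    exact h1.symm
  refine CHat.Hom.ext (RingHom.ext fun r => ?_)
  -- The trace of this product is n + r, so conjugation-invariant data recover the image of r.
  have h2 := htr (SpecialLinearGroup.transvection hij r * SpecialLinearGroup.transvection hij.symm 1)
  have h3 : ((SpecialLinearGroup.transvection hij r * SpecialLinearGroup.transvection hij.symm 1 :
      SpecialLinearGroup (Fin n) R) : Matrix (Fin n) (Fin n) R).trace = n + r := by
    change ((1 + single i j r) * (1 + single j i 1) : Matrix (Fin n) (Fin n) R).trace = _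
    simp only [mul_add, add_mul, mul_one, one_mul,
      single_mul_single_same]
    rw [trace_add, trace_add, trace_add, trace_one,
      trace_single_eq_of_ne _ _ _ hij, trace_single_eq_of_ne _ _ _ hij.symm, trace_single_eq_same]
    simp
  rw [h3, map_add, map_add, map_natCast, map_natCast] at h2
  exact add_left_cancel h2

theorem exists_eq_scalar_of_commute {S : Type*} [CommRing S] (hn : 2 ≤ n) {A : GL (Fin n) S}
    (h : ∀ (i j : Fin n) (hij : i ≠ j),
      Commute (SpecialLinearGroup.toGL (SpecialLinearGroup.transvection hij (1 : S))) A) :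
    ∃ c : Sˣ, A = GeneralLinearGroup.scalar (Fin n) c := by
  obtain ⟨a, ha⟩ := mem_range_scalar_of_commute_single (M := (A : Matrix (Fin n) (Fin n) S)) (by
    intro i j hij
    have h1 := congrArg (fun B : GL (Fin n) S => (B : Matrix (Fin n) (Fin n) S)) (h i j hij)
    have h2 : ((SpecialLinearGroup.toGL (SpecialLinearGroup.transvection hij (1 : S)) :
      GL (Fin n) S) : Matrix (Fin n) (Fin n) S) = 1 + single i j 1 := rfl
    simp only [Units.val_mul, h2, add_mul, mul_add, one_mul, mul_one, add_right_inj] at h1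
    exact h1)
  have hunit : IsUnit a := by
    have h3 : IsUnit (A : Matrix (Fin n) (Fin n) S).det :=
      (isUnit_iff_isUnit_det _).1 A.isUnit
    rw [← ha, scalar_apply, det_diagonal, Finset.prod_const, Finset.card_univ,
      Fintype.card_fin] at h3
    exact (isUnit_pow_iff (by omega)).1 h3
  obtain ⟨c, rfl⟩ := hunit
  exact ⟨c, Units.ext (by rw [GeneralLinearGroup.coe_scalar, ha])⟩

namespace GroupOverSL

/-- The residual representation. -/
abbrev residual (D : GroupOverSL n R Γ) : Γ →* GL (Fin n) k := (naturalRep n R).comp D.toGL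

theorem exists_ofSL_eq (D : GroupOverSL n R Γ) {γ : Γ}
    (h : GeneralLinearGroup.det (D.toGL γ) = 1) : ∃ g, D.ofSL g = γ :=
  let g : SpecialLinearGroup (Fin n) R := ⟨D.toGL γ, congrArg Units.val h⟩
  ⟨g, D.injective_toGL ((D.toGL_ofSL g).trans (Units.ext rfl))⟩

/-- The structure of the lifts: up to strict equivalence, they are twists by characters of
representations induced by homomorphisms. -/
theorem exists_hom_of_lift (D : GroupOverSL n R Γ) (hn : 2 ≤ n) (hR : IsRigidDegree n R.residue)
    (ρ : Lift D.residual S) :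
    ∃ f : CHat.Hom R S, ∃ K ∈ (GeneralLinearGroup.map (n := Fin n) S.residue).ker,
      ∃ χ : Γ →* (S : Type u)ˣ, (∀ γ, ρ.toHom γ = K * (GeneralLinearGroup.scalar (Fin n) (χ γ) *
        GeneralLinearGroup.map f.toRingHom (D.toGL γ)) * K⁻¹) ∧
        (∀ γ, S.residue (χ γ) = 1) ∧ ∀ g, χ (D.ofSL g) = 1 := by
  have : Nontrivial (Fin n) := Fin.nontrivial_iff_two_le.2 hn
  have hρ : ∀ γ, GeneralLinearGroup.map S.residue (ρ.toHom γ) =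
      GeneralLinearGroup.map R.residue (D.toGL γ) := fun γ => DFunLike.congr_fun ρ.reduction γ
  obtain ⟨K, hK, f, hf, hKf⟩ := exists_ringHom_of_reduction (π := R.residue) (πT := S.residue)
    S.ker_residue hn hR (X := (Units.coeHom _).comp (ρ.toHom.comp D.ofSL)) (by
      intro g a b
      have h1 := hρ (D.ofSL g)
      rw [D.toGL_ofSL] at h1
      exact congrArg (fun A : GL (Fin n) k => (A : Matrix (Fin n) (Fin n) k) a b) h1)
  let F : CHat.Hom R S := ⟨f, ⟨fun x hx => isUnit_of_map_unit R.residue x (by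
    rw [← hf]; exact hx.map _)⟩, RingHom.ext hf⟩
  have hKker : K ∈ (GeneralLinearGroup.map (n := Fin n) S.residue).ker := Units.ext hK
  let φ : Γ →* GL (Fin n) S := (GeneralLinearGroup.map F.toRingHom).comp D.toGL
  have hSL : ∀ g, K⁻¹ * ρ.toHom (D.ofSL g) * K = φ (D.ofSL g) := by
    intro g
    rw [mul_assoc, inv_mul_eq_iff_eq_mul]
    apply Units.ext
    change _ = (K : Matrix (Fin n) (Fin n) S) * (D.toGL (D.ofSL g) : Matrix (Fin n) (Fin n) R).map f
    rw [D.toGL_ofSL]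
    exact hKf g
  set ρ' : Γ → GL (Fin n) S := fun γ => K⁻¹ * ρ.toHom γ * K with hρ'
  have hρ'mul : ∀ γ δ, ρ' (γ * δ) = ρ' γ * ρ' δ := by
    intro γ δ
    simp only [hρ', map_mul]; group
  -- The representations ρ' and φ agree on SL_n(R), and γ normalises it; hence ρ'(γ)φ(γ)⁻¹
  -- centralises the image of SL_n(R), which contains the transvections with coefficient 1, and is
  -- scalar.
  have hcomm : ∀ γ g, Commute (φ (D.ofSL g)) (ρ' γ * (φ γ)⁻¹) := by
    intro γ g
    obtain ⟨g', hg'⟩ := D.exists_ofSL_eq (γ := γ⁻¹ * D.ofSL g * γ) (by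
      have h0 : GeneralLinearGroup.det (SpecialLinearGroup.toGL g : GL (Fin n) R) = 1 :=
        Units.ext g.2
      rw [map_mul, map_mul, map_mul, map_mul, D.toGL_ofSL, h0, map_inv, map_inv]
      simp)
    have h1 : φ (D.ofSL g') = (φ γ)⁻¹ * φ (D.ofSL g) * φ γ := by
      rw [hg', map_mul, map_mul, map_inv]
    have h2 : ρ' γ * ρ' (D.ofSL g') = ρ' (D.ofSL g) * ρ' γ := by
      rw [← hρ'mul, ← hρ'mul, hg']; congr 1; group
    have h3 : ∀ g, ρ' (D.ofSL g) = φ (D.ofSL g) := hSL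
    rw [h3, h3, h1] at h2
    rw [commute_iff_eq, ← mul_assoc, ← h2]; group
  have hscal : ∀ γ, ∃ c : (S : Type u)ˣ, ρ' γ * (φ γ)⁻¹ = GeneralLinearGroup.scalar (Fin n) c := by
    intro γ
    refine exists_eq_scalar_of_commute hn fun i j hij => ?_
    have h1 := hcomm γ (SpecialLinearGroup.transvection hij 1)
    have h2 : φ (D.ofSL (SpecialLinearGroup.transvection hij 1)) =
        SpecialLinearGroup.toGL (SpecialLinearGroup.transvection hij (1 : S)) := by
      apply Units.ext
      change (D.toGL (D.ofSL (SpecialLinearGroup.transvection hij 1)) : Matrix (Fin n) (Fin n) R).map f = _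
      rw [D.toGL_ofSL]
      ext a b
      change f ((1 + single i j 1 : Matrix (Fin n) (Fin n) R) a b) =
        (1 + single i j 1 : Matrix (Fin n) (Fin n) S) a b
      rw [Matrix.add_apply, Matrix.add_apply, map_add, single_apply, single_apply, one_apply,
        one_apply]
      split_ifs <;> simp
    rwa [h2] at h1
  choose c hc using hscal
  have hinj : Function.Injective (GeneralLinearGroup.scalar (Fin n) : (S : Type u)ˣ →* _) := by
    intro a b hab
    have h1 := congrArg Units.val hab
    rw [GeneralLinearGroup.coe_scalar, GeneralLinearGroup.coe_scalar] at h1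
    obtain ⟨i, -⟩ := exists_pair_ne (Fin n)
    exact Units.ext (by simpa using congrFun (congrFun h1 i) i)
  have hρc : ∀ γ, ρ' γ = GeneralLinearGroup.scalar (Fin n) (c γ) * φ γ := fun γ => by
    rw [← hc, inv_mul_cancel_right]
  have hc1 : c 1 = 1 := hinj (by rw [← hc, map_one φ, map_one]; simp [hρ'])
  have hcmul : ∀ γ δ, c (γ * δ) = c γ * c δ := by
    intro γ δ
    apply hinj
    rw [← hc, hρ'mul, hρc γ, hρc δ, map_mul φ, map_mul]
    have h1 := GeneralLinearGroup.scalar_commute (c δ) (φ γ)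
    generalize GeneralLinearGroup.scalar (Fin n) (c δ) = b at *
    generalize GeneralLinearGroup.scalar (Fin n) (c γ) = a at *
    rw [show a * φ γ * (b * φ δ) * (φ γ * φ δ)⁻¹ = a * (φ γ * b) * (φ γ)⁻¹ by group, ← h1]
    group
  refine ⟨F, K, hKker, ⟨⟨c, hc1⟩, hcmul⟩, fun γ => ?_, fun γ => ?_, fun g => ?_⟩
  · change ρ.toHom γ = K * (GeneralLinearGroup.scalar (Fin n) (c γ) * φ γ) * K⁻¹
    rw [← hρc]
    simp only [hρ']; group
  · have h1 := congrArg (GeneralLinearGroup.map (n := Fin n) S.residue) (hc γ)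
    have h2 : GeneralLinearGroup.map (n := Fin n) S.residue (φ γ) =
        GeneralLinearGroup.map R.residue (D.toGL γ) := by
      rw [← F.residue_comp, GeneralLinearGroup.map_comp]; rfl
    simp only [hρ', map_mul, map_inv] at h1
    rw [MonoidHom.mem_ker.1 hKker, hρ, h2, GeneralLinearGroup.map_scalar] at h1
    obtain ⟨i, -⟩ := exists_pair_ne (Fin n)
    have h3 := congrArg (fun A : GL (Fin n) k => (A : Matrix (Fin n) (Fin n) k) i i) h1
    simp only [GeneralLinearGroup.coe_scalar] at h3
    simpa using h3.symm
  · apply hinj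
    change GeneralLinearGroup.scalar (Fin n) (c (D.ofSL g)) = _
    rw [← hc, map_one]
    have h3 : ρ' (D.ofSL g) = φ (D.ofSL g) := hSL g
    rw [h3, mul_inv_cancel]

end GroupOverSL

end LiftsOverSL

/-! ### When R itself is the universal deformation ring. -/

section Universal

open Matrix

variable {k : Type u} [Field k] {n : ℕ} {R S : CHat k} {Γ : Type u} [Group Γ] [TopologicalSpace Γ]

/-- In x^(q-1) - 1 = (x - 1) ∑ x^i the sum has residue q - 1 = -1, hence is a unit. -/
theorem CHat.eq_one_of_pow_eq_one [Finite k] {x : S} (hx : S.residue x = 1)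
    (h : x ^ (Nat.card k - 1) = 1) : x = 1 := by
  have hq : 1 < Nat.card k := Finite.one_lt_card
  have h0 : ((Nat.card k : ℕ) : k) = 0 := by
    have := Fintype.ofFinite k
    rw [Nat.card_eq_fintype_card]
    exact Nat.cast_card_eq_zero k
  have hunit : IsUnit (∑ i ∈ Finset.range (Nat.card k - 1), x ^ i) := by
    refine isUnit_of_map_unit S.residue _ ?_
    rw [map_sum]
    simp only [map_pow, hx, one_pow, Finset.sum_const, Finset.card_range, nsmul_eq_mul, mul_one]
    rw [Nat.cast_sub hq.le, h0, Nat.cast_one, zero_sub]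
    exact isUnit_one.neg
  have h1 := mul_geom_sum x (Nat.card k - 1)
  rw [h, sub_self] at h1
  exact sub_eq_zero.1 (hunit.mul_left_eq_zero.1 h1)

/-- The kernels of the iterates stabilise, say at m. Writing an element x of the kernel as g^m(y),
the element y lies in ker g^(m+1) = ker g^m, so x = 0. -/
theorem RingHom.injective_of_surjective_of_isNoetherianRing {A : Type*} [CommRing A]
    [IsNoetherianRing A] (g : A →+* A) (hg : Function.Surjective g) : Function.Injective g := by
  let I : ℕ →o Ideal A := ⟨fun m => RingHom.ker (g ^ m), monotone_nat_of_le_succ fun m x hx => by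
    rw [RingHom.mem_ker] at hx ⊢
    rw [pow_succ', RingHom.mul_def, RingHom.comp_apply, hx, map_zero]⟩
  obtain ⟨m, hm⟩ := monotone_stabilizes_iff_noetherian.2 (inferInstance : IsNoetherian A A) I
  refine (injective_iff_map_eq_zero g).2 fun x hx => ?_
  obtain ⟨y, rfl⟩ : ∃ y, (g ^ m) y = x := by
    rw [RingHom.coe_pow]; exact hg.iterate m x
  have h1 : y ∈ I (m + 1) := by
    change (g ^ (m + 1)) y = 0
    rw [pow_succ', RingHom.mul_def, RingHom.comp_apply, hx]
  rw [← hm (m + 1) m.le_succ] at h1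
  exact h1

theorem continuous_scalar {S : Type*} [CommRing S] [TopologicalSpace S] :
    Continuous (GeneralLinearGroup.scalar (Fin n) : Sˣ → GL (Fin n) S) :=
  Continuous.units_map (Matrix.scalar (Fin n) : S →+* Matrix (Fin n) (Fin n) S).toMonoidHom
    ((continuous_pi fun _ => continuous_id).matrix_diagonal)

/-- The universal element of a corepresented deformation functor, as a lift. -/
theorem exists_lift_of_isUniversal {ρbar : Γ →* GL (Fin n) k} {A : CHat k}
    (h : IsUniversalDeformationRing ρbar A) : ∃ ρ : Lift ρbar A,
      (∀ (S : CHat k) (σ : Lift ρbar S), ∃ g : CHat.Hom A S, strictEquiv ρbar S (ρ.map g) σ) ∧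
      ∀ (S : CHat k) (g g' : CHat.Hom A S), strictEquiv ρbar S (ρ.map g) (ρ.map g') → g = g' := by
  obtain ⟨e⟩ := h
  obtain ⟨ρ, hρ⟩ := Quotient.exists_rep (e.homEquiv (𝟙 A) : Deformation ρbar A)
  have key : ∀ {S : CHat k} (g : A ⟶ S),
      e.homEquiv g = (Quotient.mk (strictEquiv ρbar S) (ρ.map g) : Deformation ρbar S) := by
    intro S g
    rw [e.homEquiv_eq g, ← hρ]; rfl
  refine ⟨ρ, fun S σ => ?_, fun S g g' hgg => ?_⟩
  · refine ⟨e.homEquiv.symm (Quotient.mk (strictEquiv ρbar S) σ : Deformation ρbar S), ?_⟩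
    apply Quotient.exact
    exact (key _).symm.trans (e.homEquiv.apply_symm_apply _)
  · apply e.homEquiv.injective (a₁ := (g : A ⟶ S)) (a₂ := (g' : A ⟶ S))
    rw [key, key]
    exact Quotient.sound hgg

namespace GroupOverSL

/-- The tautological lift. -/
def standardLift (D : GroupOverSL n R Γ) : Lift D.residual R := ⟨D.toGL, D.continuous_toGL, rfl⟩

/-- The twisting character χ of a lift dies: γ^(q-1) has determinant 1, so χ(γ)^(q-1) = 1, while
χ(γ) has residue 1. -/
theorem isUniversalDeformationRing [Finite k] (D : GroupOverSL n R Γ) (hn : 2 ≤ n)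
    (hR : IsRigidDegree n R.residue)
    (hμ : ∀ γ, GeneralLinearGroup.det (D.toGL γ) ^ (Nat.card k - 1) = 1) :
    IsUniversalDeformationRing D.residual R := by
  let e : ∀ S : CHat k, (R ⟶ S) → Deformation D.residual S := fun S f =>
    Quotient.mk (strictEquiv D.residual S) (D.standardLift.map f)
  have hinj : ∀ S, Function.Injective (e S) := by
    intro S f f' hff
    obtain ⟨K, -, hK⟩ := Quotient.exact hff
    refine CHat.Hom.eq_of_conj hn K fun g => ?_
    have := hK (D.ofSL g)
    change GeneralLinearGroup.map f'.toRingHom (D.toGL (D.ofSL g)) =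
      K * GeneralLinearGroup.map f.toRingHom (D.toGL (D.ofSL g)) * K⁻¹ at this
    rwa [D.toGL_ofSL] at this
  have hsurj : ∀ S, Function.Surjective (e S) := by
    intro S x
    obtain ⟨ρ, rfl⟩ := Quotient.exists_rep x
    obtain ⟨f, K, hK, χ, hρ, hχ, hχ1⟩ := D.exists_hom_of_lift hn hR ρ
    refine ⟨f, Quotient.sound ⟨K, hK, fun γ => ?_⟩⟩
    have h1 : χ γ = 1 := by
      obtain ⟨g, hg⟩ := D.exists_ofSL_eq (γ := γ ^ (Nat.card k - 1))
        (by rw [map_pow, map_pow, hμ])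
      refine Units.ext (CHat.eq_one_of_pow_eq_one (hχ γ) ?_)
      have := hχ1 g
      rw [hg, map_pow] at this
      rw [← Units.val_pow_eq_pow_val, this, Units.val_one]
    rw [hρ, h1, map_one, one_mul]
    rfl
  exact ⟨⟨fun {S} => Equiv.ofBijective (e S) ⟨hinj S, hsurj S⟩, fun g f => rfl⟩⟩

/-- The lift induced by a morphism `h`, twisted by a character `τ`. -/
noncomputable def twist (D : GroupOverSL n R Γ) (h : CHat.Hom R S) (τ : Γ →* (S : Type u)ˣ)
    (hτ : Continuous τ) (hτ1 : ∀ γ, S.residue (τ γ) = 1) : Lift D.residual S where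
  toHom :=
    { toFun := fun γ => GeneralLinearGroup.scalar (Fin n) (τ γ) *
        GeneralLinearGroup.map h.toRingHom (D.toGL γ)
      map_one' := by simp
      map_mul' := fun γ δ => by
        simp only [map_mul]
        rw [mul_assoc, mul_assoc, ← mul_assoc _ (GeneralLinearGroup.map h.toRingHom (D.toGL γ)),
          GeneralLinearGroup.scalar_commute (τ δ)]
        simp only [mul_assoc] }
  continuous_toHom := (continuous_scalar.comp hτ).mul
    ((Continuous.units_map _ (continuous_id.matrix_map h.continuous)).comp D.continuous_toGL)
  reduction := by
    ext1 γ
    change GeneralLinearGroup.map S.residue (_ * GeneralLinearGroup.map h.toRingHom (D.toGL γ)) =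
      GeneralLinearGroup.map R.residue (D.toGL γ)
    have h1 : Units.map (S.residue : S →* k) (τ γ) = 1 := Units.ext (hτ1 γ)
    rw [map_mul, GeneralLinearGroup.map_scalar, h1, map_one, one_mul, ← h.residue_comp,
      GeneralLinearGroup.map_comp]
    rfl

/-- The tautological lift twisted by a power of the determinant. -/
noncomputable def twistedLift [Finite k] (D : GroupOverSL n R Γ) : Lift D.residual R :=
  D.twist (𝟙 R) ((powMonoidHom (Nat.card k - 1)).comp (GeneralLinearGroup.det.comp D.toGL))
    ((GeneralLinearGroup.continuous_det.comp D.continuous_toGL).pow _) fun γ => by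
      have := Fintype.ofFinite k
      change R.residue ((GeneralLinearGroup.det (D.toGL γ) ^ (Nat.card k - 1) : (R : Type u)ˣ)) = 1
      rw [Units.val_pow_eq_pow_val, map_pow, Nat.card_eq_fintype_card]
      exact FiniteField.pow_card_sub_one_eq_one _ ((Units.isUnit _).map R.residue).ne_zero

/-- Let f be the morphism underlying the universal lift. The tautological lift and its twist by
det^(q-1) agree on SL_n(R), so the endomorphisms g and g' of R inducing them are both left inverses
of f. Since R is noetherian, f is bijective and g = g'. The two lifts are then conjugate by a matrix
centralising SL_n(R), that is, by a scalar, and so they coincide. -/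
theorem det_pow_eq_one [Finite k] (D : GroupOverSL n R Γ) (hn : 2 ≤ n)
    (hR : IsRigidDegree n R.residue) (h : IsUniversalDeformationRing D.residual R) (γ : Γ) :
    GeneralLinearGroup.det (D.toGL γ) ^ (Nat.card k - 1) = 1 := by
  have : Nontrivial (Fin n) := Fin.nontrivial_iff_two_le.2 hn
  obtain ⟨ρ, hex, -⟩ := exists_lift_of_isUniversal h
  obtain ⟨f, K, hK, χ, hρ, hχ, hχ1⟩ := D.exists_hom_of_lift hn hR ρ
  have hdetSL : ∀ g : SpecialLinearGroup (Fin n) R,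
      GeneralLinearGroup.det (SpecialLinearGroup.toGL g : GL (Fin n) R) = 1 := fun g => Units.ext g.2
  -- a homomorphism inducing a lift which is tautological on `SL` is a left inverse of `f`
  have left_inv : ∀ (g : CHat.Hom R R) (σ : Lift D.residual R),
      strictEquiv D.residual R (ρ.map g) σ →
      (∀ x, σ.toHom (D.ofSL x) = SpecialLinearGroup.toGL x) → (f ≫ g : R ⟶ R) = 𝟙 R := by
    rintro g σ ⟨L, -, hL⟩ hσ
    refine CHat.Hom.eq_of_conj hn (L * GeneralLinearGroup.map g.toRingHom K) fun x => ?_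
    have h1 := hL (D.ofSL x)
    rw [hσ] at h1
    change _ = L * (GeneralLinearGroup.map g.toRingHom (ρ.toHom (D.ofSL x))) * L⁻¹ at h1
    rw [hρ, hχ1, D.toGL_ofSL, map_one, one_mul, map_mul, map_mul, map_inv] at h1
    have h2 : GeneralLinearGroup.map (CHat.Hom.toRingHom (𝟙 R)) (SpecialLinearGroup.toGL x) =
        (SpecialLinearGroup.toGL x : GL (Fin n) R) := Units.ext rfl
    refine h2.trans (h1.trans ?_)
    change _ = L * GeneralLinearGroup.map g.toRingHom K * (GeneralLinearGroup.map g.toRingHom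
      (GeneralLinearGroup.map f.toRingHom (SpecialLinearGroup.toGL x))) *
      (L * GeneralLinearGroup.map g.toRingHom K)⁻¹
    group
  obtain ⟨g, hg⟩ := hex R D.standardLift
  obtain ⟨g', hg'⟩ := hex R D.twistedLift
  have hgf := left_inv g _ hg D.toGL_ofSL
  have hgf' := left_inv g' _ hg' (fun x => by
    change GeneralLinearGroup.scalar (Fin n)
        (GeneralLinearGroup.det (D.toGL (D.ofSL x)) ^ (Nat.card k - 1)) * D.toGL (D.ofSL x) = _
    rw [D.toGL_ofSL, hdetSL, one_pow, map_one, one_mul])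
  have hsurj : Function.Surjective g.toRingHom := fun x =>
    ⟨f.toRingHom x, DFunLike.congr_fun (congrArg CHat.Hom.toRingHom hgf) x⟩
  have hinj : Function.Injective g.toRingHom :=
    g.toRingHom.injective_of_surjective_of_isNoetherianRing hsurj
  have hfsurj : Function.Surjective f.toRingHom := fun x => ⟨g.toRingHom x, hinj
    (DFunLike.congr_fun (congrArg CHat.Hom.toRingHom hgf) (g.toRingHom x))⟩
  have hgg : g' = g := by
    refine CHat.Hom.ext (RingHom.ext fun x => ?_)
    obtain ⟨x, rfl⟩ := hfsurj x
    exact (DFunLike.congr_fun (congrArg CHat.Hom.toRingHom hgf') x).trans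
      (DFunLike.congr_fun (congrArg CHat.Hom.toRingHom hgf) x).symm
  rw [hgg] at hg'
  obtain ⟨L, -, hL⟩ := (strictEquiv D.residual R).trans ((strictEquiv D.residual R).symm hg) hg'
  change ∀ γ, GeneralLinearGroup.scalar (Fin n)
    (GeneralLinearGroup.det (D.toGL γ) ^ (Nat.card k - 1)) * D.toGL γ = L * D.toGL γ * L⁻¹ at hL
  obtain ⟨c, hc⟩ := exists_eq_scalar_of_commute hn (A := L) (by
    intro i j hij
    have h1 := hL (D.ofSL (SpecialLinearGroup.transvection hij 1))
    rw [D.toGL_ofSL, hdetSL, one_pow, map_one, one_mul, eq_mul_inv_iff_mul_eq] at h1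
    exact h1)
  have h1 := hL γ
  rw [hc, GeneralLinearGroup.scalar_commute c, mul_inv_cancel_right, mul_eq_right] at h1
  obtain ⟨i, -⟩ := exists_pair_ne (Fin n)
  have h2 := congrArg (fun A : GL (Fin n) R => (A : Matrix (Fin n) (Fin n) R) i i) h1
  simp only [GeneralLinearGroup.coe_scalar] at h2
  exact Units.ext (by simpa using h2)

/-- The whole general linear group. -/
def full (n : ℕ) (R : CHat k) : GroupOverSL n R (GL (Fin n) R) where
  toGL := MonoidHom.id _
  continuous_toGL := continuous_id
  injective_toGL := Function.injective_id
  ofSL := SpecialLinearGroup.toGL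
  toGL_ofSL _ := rfl

/-- A subgroup containing the special linear group. -/
def ofSubgroup (G : Subgroup (GL (Fin n) R))
    (hG : (SpecialLinearGroup.toGL (n := Fin n) (R := R)).range ≤ G) : GroupOverSL n R G where
  toGL := G.subtype
  continuous_toGL := continuous_subtype_val
  injective_toGL := G.subtype_injective
  ofSL := SpecialLinearGroup.toGL.codRestrict G fun g => hG ⟨g, rfl⟩
  toGL_ofSL _ := rfl

end GroupOverSL

theorem exists_det_eq (hn : 2 ≤ n) (u : (R : Type u)ˣ) :
    ∃ g : GL (Fin n) R, GeneralLinearGroup.det g = u := by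
  let i : Fin n := ⟨0, by omega⟩
  have hdet : (diagonal fun a : Fin n => if a = i then (u : R) else 1).det = u := by
    rw [det_diagonal, Finset.prod_ite_eq']; simp
  exact ⟨GeneralLinearGroup.mk'' (diagonal fun a : Fin n => if a = i then (u : R) else 1)
    (by rw [hdet]; exact u.isUnit), Units.ext hdet⟩

/-- On the full group det takes every value 1 + x with x in the maximal ideal, and (1 + x)^(q-1) = 1
forces x = 0. -/
theorem isUniversal_naturalRep_iff [Finite k] (hn : 2 ≤ n) (hR : IsRigidDegree n R.residue) :
    IsUniversalDeformationRing (naturalRep n R) R ↔ Function.Bijective R.residue := by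
  have := Fintype.ofFinite k
  constructor
  · intro h
    refine ⟨(injective_iff_map_eq_zero _).2 fun x hx => ?_, R.residue_surjective⟩
    have hu : IsUnit (1 + x) := isUnit_of_map_unit R.residue _ (by rw [map_add, hx]; simp)
    obtain ⟨g, hg⟩ := exists_det_eq hn hu.unit
    have h1 := (GroupOverSL.full n R).det_pow_eq_one hn hR h g
    change GeneralLinearGroup.det g ^ _ = 1 at h1
    rw [hg] at h1
    have h2 := CHat.eq_one_of_pow_eq_one (x := 1 + x) (by rw [map_add, hx]; simp)
      (congrArg Units.val h1)
    exact add_eq_left.1 h2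
  · intro h
    refine (GroupOverSL.full n R).isUniversalDeformationRing hn hR fun γ => Units.ext (h.1 ?_)
    rw [Units.val_pow_eq_pow_val, map_pow, Units.val_one, map_one, Nat.card_eq_fintype_card]
    exact FiniteField.pow_card_sub_one_eq_one _ ((Units.isUnit _).map R.residue).ne_zero

theorem setOf_isUniversal_eq [Finite k] (hn : 2 ≤ n) (hR : IsRigidDegree n R.residue) :
    {G | G ∈ closedSubgroupsOverSL n R ∧
        IsUniversalDeformationRing ((naturalRep n R).comp G.subtype) R} =
      {G | G ∈ closedSubgroupsOverSL n R ∧ G ≤ muL n R} := by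
  ext G
  refine and_congr_right fun hG => ⟨fun h g hg => ?_, fun h => ?_⟩
  · rw [muL, Subgroup.mem_comap, mem_rootsOfUnity]
    exact (GroupOverSL.ofSubgroup G hG.2).det_pow_eq_one hn hR h ⟨g, hg⟩
  · refine (GroupOverSL.ofSubgroup G hG.2).isUniversalDeformationRing hn hR fun γ => ?_
    have := h γ.2
    rwa [muL, Subgroup.mem_comap, mem_rootsOfUnity] at this

end Universal

/-! ### Adic completeness of finite free modules and change of ideal. -/

section Completeness

variable {A : Type*} [CommRing A] {I : Ideal A}

theorem Module.Basis.mem_smul_top_iff {ι M : Type*} [Finite ι] [AddCommGroup M] [Module A M]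
    (b : Module.Basis ι A M) {x : M} :
    x ∈ (I • ⊤ : Submodule A M) ↔ ∀ i, b.repr x i ∈ I := by
  have := Fintype.ofFinite ι
  constructor
  · intro hx i
    refine Submodule.smul_induction_on hx (fun r hr y _ => ?_) fun y z hy hz => ?_
    · rw [map_smul, Finsupp.smul_apply, smul_eq_mul]
      exact I.mul_mem_right _ hr
    · rw [map_add, Finsupp.add_apply]
      exact I.add_mem hy hz
  · intro h
    rw [← b.sum_repr x]
    exact Submodule.sum_mem _ fun i _ => Submodule.smul_mem_smul (h i) Submodule.mem_top

theorem Module.Basis.isAdicComplete {ι M : Type*} [Finite ι] [AddCommGroup M] [Module A M]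
    (b : Module.Basis ι A M) [IsAdicComplete I A] : IsAdicComplete I M where
  haus' x hx := by
    refine b.ext_elem fun i => ?_
    rw [map_zero, Finsupp.zero_apply]
    refine IsHausdorff.haus (I := I) inferInstance _ fun m => ?_
    have h := SModEq.zero.1 (hx m)
    rw [b.mem_smul_top_iff] at h
    rw [SModEq.zero, smul_eq_mul, Ideal.mul_top]
    exact h i
  prec' f hf := by
    have := Fintype.ofFinite ι
    have h : ∀ i, ∃ L : A, ∀ m, b.repr (f m) i ≡ L [SMOD (I ^ m • ⊤ : Ideal A)] := fun i => by
      refine IsPrecomplete.prec (I := I) inferInstance fun {m l} hml => ?_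
      have h := SModEq.sub_mem.1 (hf hml)
      rw [b.mem_smul_top_iff] at h
      rw [SModEq.sub_mem, smul_eq_mul, Ideal.mul_top]
      simpa using h i
    choose L hL using h
    refine ⟨∑ i, L i • b i, fun m => SModEq.sub_mem.2 ?_⟩
    rw [b.mem_smul_top_iff]
    intro i
    have h := SModEq.sub_mem.1 (hL i m)
    rw [smul_eq_mul, Ideal.mul_top] at h
    rwa [map_sub, Finsupp.sub_apply, b.repr_sum_self]

theorem IsAdicComplete.of_pow_le {J : Ideal A} [IsAdicComplete I A] (hIJ : I ≤ J) {M : ℕ}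
    (hJI : J ^ M ≤ I) : IsAdicComplete J A where
  haus' x hx := by
    refine IsHausdorff.haus (I := I) inferInstance _ fun m => ?_
    have h := SModEq.zero.1 (hx (M * m))
    rw [SModEq.zero, smul_eq_mul, Ideal.mul_top]
    rw [smul_eq_mul, Ideal.mul_top, pow_mul] at h
    exact Ideal.pow_right_mono hJI m h
  prec' f hf := by
    simp only [smul_eq_mul, Ideal.mul_top, SModEq.sub_mem] at hf ⊢
    -- The subsequence f((M+1)m) is I-adically Cauchy because J^(M+1) ≤ I. The factor is M + 1
    -- rather than M so that the index is at least m even when M = 0.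
    obtain ⟨L, hL⟩ := IsPrecomplete.prec (I := I) (M := A) inferInstance
      (f := fun m => f ((M + 1) * m)) (by
        intro m l hml
        rw [SModEq.sub_mem, smul_eq_mul, Ideal.mul_top]
        have h := hf (Nat.mul_le_mul_left (M + 1) hml)
        rw [pow_mul] at h
        exact Ideal.pow_right_mono ((Ideal.pow_le_pow_right M.le_succ).trans hJI) m h)
    refine ⟨L, fun m => ?_⟩
    have h1 := SModEq.sub_mem.1 (hL m)
    rw [smul_eq_mul, Ideal.mul_top] at h1
    have h2 := hf (Nat.le_mul_of_pos_left m M.succ_pos)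
    simpa using (J ^ m).add_mem h2 (Ideal.pow_right_mono hIJ m h1)

/-- Every maximal ideal contains I, hence its radical, hence J. -/
theorem IsLocalRing.of_le_jacobson_of_le_radical {J : Ideal A} [hJ : J.IsMaximal]
    (hI : I ≤ (⊥ : Ideal A).jacobson) (h : J ≤ I.radical) : IsLocalRing A := by
  refine IsLocalRing.of_unique_max_ideal ⟨J, hJ, fun K (hK : K.IsMaximal) => ?_⟩
  have hIK : I ≤ K := hI.trans (sInf_le ⟨bot_le, hK⟩)
  exact (hJ.eq_of_le hK.ne_top (h.trans ((Ideal.radical_mono hIK).trans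
    hK.isPrime.radical.le))).symm

end Completeness

/-! ### Constructing objects and morphisms of the category. -/

section Objects

variable {k : Type u} [Field k]

/-- A ring complete for an ideal having the same radical as the kernel of the reduction. -/
noncomputable def CHat.ofIsAdicComplete (B : Type u) [CommRing B] [IsNoetherianRing B] (I : Ideal B)
    [IsAdicComplete I B] (π : B →+* k) (hπ : Function.Surjective π) (hI : I ≤ RingHom.ker π)
    (hr : RingHom.ker π ≤ I.radical) : CHat k :=
  have hmax : (RingHom.ker π).IsMaximal := RingHom.ker_isMaximal_of_surjective π hπ
  have hloc : IsLocalRing B :=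
    IsLocalRing.of_le_jacobson_of_le_radical (IsAdicComplete.le_jacobson_bot I) hr
  have hcomplete : IsAdicComplete (IsLocalRing.maximalIdeal B) B := by
    rw [← IsLocalRing.eq_maximalIdeal hmax]
    obtain ⟨M, hM⟩ := Ideal.exists_pow_le_of_le_radical_of_fg hr (IsNoetherian.noetherian _)
    exact IsAdicComplete.of_pow_le hI hM
  { carrier := B, residue := π, residue_surjective := hπ }

theorem CHat.residue_eq_zero_iff (R : CHat k) {x : R} :
    R.residue x = 0 ↔ x ∈ IsLocalRing.maximalIdeal R := by
  rw [← R.ker_residue, RingHom.mem_ker]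

/-- A homomorphism compatible with the reductions is a morphism. -/
def CHat.Hom.ofRingHom {R S : CHat k} (f : R →+* S) (h : S.residue.comp f = R.residue) :
    CHat.Hom R S where
  toRingHom := f
  isLocalHom := ⟨fun a ha => isUnit_of_map_unit R.residue a (by
    rw [← h]; exact ha.map S.residue)⟩
  residue_comp := h

/-- The quotient of `S` by a positive power of its maximal ideal. -/
noncomputable def CHat.quotPow (S : CHat k) {j : ℕ} (hj : j ≠ 0) : CHat k :=
  CHat.ofIsAdicComplete (S ⧸ IsLocalRing.maximalIdeal S ^ j) ⊥
    (Ideal.Quotient.lift _ S.residue fun _ ha => S.residue_eq_zero_iff.2 (Ideal.pow_le_self hj ha))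
    (Ideal.Quotient.lift_surjective_of_surjective _ _ S.residue_surjective) bot_le (by
      intro x hx
      obtain ⟨x, rfl⟩ := Ideal.Quotient.mk_surjective x
      rw [RingHom.mem_ker, Ideal.Quotient.lift_mk, S.residue_eq_zero_iff] at hx
      refine ⟨j, ?_⟩
      rw [← map_pow, Ideal.mem_bot, Ideal.Quotient.eq_zero_iff_mem]
      exact Ideal.pow_mem_pow hx j)

/-- The reduction modulo a power of the maximal ideal. -/
noncomputable def CHat.toQuotPow (S : CHat k) {j : ℕ} (hj : j ≠ 0) : CHat.Hom S (S.quotPow hj) :=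
  CHat.Hom.ofRingHom (Ideal.Quotient.mk (IsLocalRing.maximalIdeal S ^ j)) (RingHom.ext fun _ => rfl)

end Objects

/-! ### The group of one-units is pro-p. -/

section OneUnits

variable {k : Type u} [Field k] {R : CHat k}

theorem CHat.mem_oneUnits {u : (R : Type u)ˣ} : u ∈ R.oneUnits ↔ R.residue u = 1 := by
  rw [← sub_eq_zero, ← map_one R.residue, ← map_sub, R.residue_eq_zero_iff]; rfl

/-- The topology of the unit group controls both u and u⁻¹; the identity u⁻¹ - 1 = -u⁻¹(u - 1) shows
that congruence conditions on u suffice. -/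
theorem CHat.exists_pow_sub_one_mem_of_mem_nhds {U : Set (R : Type u)ˣ} (hU : U ∈ nhds 1) :
    ∃ j : ℕ, ∀ u : (R : Type u)ˣ, (u : R) - 1 ∈ IsLocalRing.maximalIdeal R ^ j → u ∈ U := by
  have hb := (IsLocalRing.maximalIdeal R).hasBasis_nhds_adic (1 : R)
  rw [Units.isInducing_embedProduct.nhds_eq_comap, Filter.mem_comap] at hU
  obtain ⟨V, hV, hVU⟩ := hU
  have h1 : V ∈ nhds ((1 : R), MulOpposite.op (1 : R)) := hV
  rw [nhds_prod_eq, Filter.mem_prod_iff] at h1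
  obtain ⟨V₁, hV₁, V₂, hV₂, hVV⟩ := h1
  have hV₂' : MulOpposite.op ⁻¹' V₂ ∈ nhds (1 : R) :=
    MulOpposite.continuous_op.continuousAt hV₂
  obtain ⟨i, -, hi⟩ := hb.mem_iff.1 hV₁
  obtain ⟨j, -, hj⟩ := hb.mem_iff.1 hV₂'
  refine ⟨i + j, fun u hu => hVU (hVV ⟨hi ⟨(u : R) - 1, ?_, by simp⟩, hj ⟨(↑u⁻¹ : R) - 1, ?_, by simp⟩⟩)⟩
  · exact Ideal.pow_le_pow_right (Nat.le_add_right i j) hu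
  · have h : ((u⁻¹ : (R : Type u)ˣ) : R) - 1 = -((u⁻¹ : (R : Type u)ˣ) : R) * (u - 1) := by
      rw [neg_mul, mul_sub, Units.inv_mul]; ring
    rw [h]
    exact Ideal.mul_mem_left _ _ (Ideal.pow_le_pow_right (Nat.le_add_left j i) hu)

theorem CHat.isOpen_setOf_sub_mem {X : Type*} [TopologicalSpace X] {f : X → R} (hf : Continuous f)
    (j : ℕ) : IsOpen {x | f x - 1 ∈ IsLocalRing.maximalIdeal R ^ j} := by
  have : IsOpen ((IsLocalRing.maximalIdeal R ^ j : Ideal R) : Set R) :=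
    AddSubgroup.isOpen_of_mem_nhds (IsLocalRing.maximalIdeal R ^ j).toAddSubgroup (g := 0)
      ((IsLocalRing.maximalIdeal R).hasBasis_nhds_zero_adic.mem_of_mem trivial)
  exact this.preimage (hf.sub continuous_const)

/-- Open subgroups of the group of one-units contain a congruence subgroup. -/
theorem CHat.exists_pow_sub_one_mem (N : OpenNormalSubgroup R.oneUnits) :
    ∃ j : ℕ, ∀ u : R.oneUnits, ((u : (R : Type u)ˣ) : R) - 1 ∈ IsLocalRing.maximalIdeal R ^ j →
      u ∈ N.toSubgroup := by
  have h : (N.toSubgroup : Set R.oneUnits) ∈ nhds (1 : R.oneUnits) :=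
    N.isOpen'.mem_nhds N.one_mem'
  rw [nhds_subtype, Filter.mem_comap] at h
  obtain ⟨V, hV, hVN⟩ := h
  obtain ⟨j, hj⟩ := CHat.exists_pow_sub_one_mem_of_mem_nhds hV
  exact ⟨j, fun u hu => hVN (hj u hu)⟩

variable [Finite k]

instance CHat.finite_quotient_pow (j : ℕ) : Finite (R ⧸ IsLocalRing.maximalIdeal R ^ j) := by
  have : Finite (R ⧸ IsLocalRing.maximalIdeal R) := by
    rw [← R.ker_residue]
    exact Finite.of_equiv k
      (RingHom.quotientKerEquivOfSurjective R.residue_surjective).symm.toEquiv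
  exact Ideal.finite_quotient_pow (IsNoetherian.noetherian _) j

instance CHat.finite_quotient_oneUnits (N : OpenNormalSubgroup R.oneUnits) :
    Finite (R.oneUnits ⧸ N.toSubgroup) := by
  obtain ⟨j, hj⟩ := CHat.exists_pow_sub_one_mem N
  -- Representatives congruent modulo 𝔪^j have their quotient in N, so the cosets inject into the
  -- finite ring R/𝔪^j.
  refine Finite.of_injective (fun x : R.oneUnits ⧸ N.toSubgroup =>
    Ideal.Quotient.mk (IsLocalRing.maximalIdeal R ^ j) ((x.out : R.oneUnits) : (R : Type u)ˣ))
    fun x y hxy => ?_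
  rw [Ideal.Quotient.eq] at hxy
  rw [← QuotientGroup.out_eq' x, ← QuotientGroup.out_eq' y]
  refine (QuotientGroup.eq.2 (hj _ ?_)).symm
  have h : (((y.out)⁻¹ * x.out : R.oneUnits) : (R : Type u)ˣ) - 1 =
      (((y.out)⁻¹ : R.oneUnits) : (R : Type u)ˣ) *
        (((x.out : R.oneUnits) : (R : Type u)ˣ) - ((y.out : R.oneUnits) : (R : Type u)ˣ) : R) := by
    rw [mul_sub]; simp
  rw [h]
  exact Ideal.mul_mem_left _ _ hxy

theorem CHat.natCard_mem_maximalIdeal : ((Nat.card k : ℕ) : R) ∈ IsLocalRing.maximalIdeal R := by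
  have := Fintype.ofFinite k
  rw [← R.residue_eq_zero_iff, map_natCast, Nat.card_eq_fintype_card]
  exact Nat.cast_card_eq_zero k

/-- Each q-th power gains one factor of 𝔪: in y^q - 1 = (y - 1) ∑ y^i the sum of q terms has residue
q = 0. -/
theorem CHat.pow_card_pow_sub_one_mem {x : R} (hx : x - 1 ∈ IsLocalRing.maximalIdeal R) (j : ℕ) :
    x ^ Nat.card k ^ j - 1 ∈ IsLocalRing.maximalIdeal R ^ (j + 1) := by
  induction j with
  | zero => simpa using hx
  | succ j ih =>
    rw [pow_succ (Nat.card k), pow_mul, pow_succ _ (j + 1)]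
    generalize x ^ Nat.card k ^ j = y at ih
    rw [← mul_geom_sum]
    refine Ideal.mul_mem_mul ih ?_
    have hy : R.residue y = 1 := by
      rw [← sub_eq_zero, ← map_one R.residue, ← map_sub, R.residue_eq_zero_iff]
      exact Ideal.pow_le_self (Nat.succ_ne_zero j) ih
    rw [← R.residue_eq_zero_iff, map_sum]
    simp only [map_pow, hy, one_pow, Finset.sum_const, Finset.card_range, nsmul_eq_mul, mul_one]
    rw [← map_natCast R.residue, R.residue_eq_zero_iff]
    exact CHat.natCard_mem_maximalIdeal

theorem CHat.exists_pow_card_pow_eq_one (N : OpenNormalSubgroup R.oneUnits)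
    (x : R.oneUnits ⧸ N.toSubgroup) : ∃ j : ℕ, x ^ Nat.card k ^ j = 1 := by
  obtain ⟨j, hj⟩ := CHat.exists_pow_sub_one_mem N
  obtain ⟨u, rfl⟩ := QuotientGroup.mk_surjective x
  refine ⟨j, (QuotientGroup.eq_one_iff (N := N.toSubgroup) (u ^ Nat.card k ^ j)).2 (hj _ ?_)⟩
  exact Ideal.pow_le_pow_right j.le_succ (CHat.pow_card_pow_sub_one_mem u.2 j)

end OneUnits

/-! ### Group rings of finite p-groups as objects of the category. -/

section GroupRings

variable {k : Type u} [Field k] {R : CHat k}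

open IsLocalRing

/-- In characteristic p the Frobenius gives (x - 1)^(p^e) = x^(p^e) - 1. -/
theorem isNilpotent_sub_one (k : Type*) [Field k] [Finite k] {C : Type*} [CommRing C] {p : ℕ}
    [CharP k p] (h : (p : C) = 0) {x : C} {j : ℕ} (hx : x ^ Nat.card k ^ j = 1) :
    IsNilpotent (x - 1) := by
  have := Fintype.ofFinite k
  obtain ⟨m, hprime, hcard⟩ := FiniteField.card k p
  rw [Nat.card_eq_fintype_card, hcard, ← pow_mul] at hx
  nontriviality C
  have := (CharP.charP_iff_prime_eq_zero hprime).2 h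
  have : Fact p.Prime := ⟨hprime⟩
  exact ⟨p ^ (m * j), by rw [sub_pow_char_pow, hx, one_pow, sub_self]⟩

/-- The augmentation of a group ring over `R`, followed by the reduction. -/
noncomputable def CHat.groupRingResidue (R : CHat k) (P : Type u) [Monoid P] :
    MonoidAlgebra R P →+* k :=
  R.residue.comp (MonoidAlgebra.lift R R P 1).toRingHom

theorem CHat.groupRingResidue_algebraMap {P : Type u} [Monoid P] (r : R) :
    R.groupRingResidue P (algebraMap R _ r) = R.residue r :=
  congrArg R.residue ((MonoidAlgebra.lift R R P 1).commutes r)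

theorem CHat.groupRingResidue_of {P : Type u} [Monoid P] (g : P) :
    R.groupRingResidue P (MonoidAlgebra.of R P g) = 1 :=
  (congrArg R.residue (MonoidAlgebra.lift_of (1 : P →* R) g)).trans (map_one _)

variable [Finite k]

/-- Modulo 𝔪 the prime p is zero, so each g - 1 is nilpotent there. By linearity every element
differs from its augmentation by an element of the radical. -/
theorem CHat.ker_groupRingResidue_le {P : Type u} [CommGroup P]
    (hP : ∀ x : P, ∃ j : ℕ, x ^ Nat.card k ^ j = 1) :
    RingHom.ker (R.groupRingResidue P) ≤
      ((maximalIdeal R).map (algebraMap R (MonoidAlgebra R P))).radical := by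
  set I := (maximalIdeal R).map (algebraMap R (MonoidAlgebra R P)) with hI
  have key : ∀ x : MonoidAlgebra R P,
      x - algebraMap R _ (MonoidAlgebra.lift R R P 1 x) ∈ I.radical := by
    intro x
    induction x using MonoidAlgebra.induction_on with
    | of g =>
      rw [MonoidAlgebra.lift_of, MonoidHom.one_apply, map_one]
      obtain ⟨p, hp⟩ := CharP.exists k
      obtain ⟨j, hj⟩ := hP g
      have hpC : ((p : ℕ) : MonoidAlgebra R P ⧸ I) = 0 := by
        have h1 : ((p : ℕ) : R) ∈ maximalIdeal R := by
          rw [← R.residue_eq_zero_iff, map_natCast, CharP.cast_eq_zero]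
        have h2 := Ideal.mem_map_of_mem (algebraMap R (MonoidAlgebra R P)) h1
        rw [map_natCast] at h2
        rw [← map_natCast (Ideal.Quotient.mk I), Ideal.Quotient.eq_zero_iff_mem]
        exact h2
      obtain ⟨m, hm⟩ := isNilpotent_sub_one k hpC
        (x := Ideal.Quotient.mk I (MonoidAlgebra.of R P g)) (j := j)
        (by rw [← map_pow, ← map_pow, hj, map_one, map_one])
      refine ⟨m, ?_⟩
      rwa [← map_one (Ideal.Quotient.mk I), ← map_sub, ← map_pow,
        Ideal.Quotient.eq_zero_iff_mem] at hm
    | add x y hx hy =>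
      rw [map_add, map_add, add_sub_add_comm]
      exact add_mem hx hy
    | smul r x hx =>
      rw [map_smul, smul_eq_mul, map_mul, Algebra.smul_def, ← mul_sub]
      exact Ideal.mul_mem_left _ _ hx
  intro x hx
  have h1 : algebraMap R (MonoidAlgebra R P) (MonoidAlgebra.lift R R P 1 x) ∈ I.radical :=
    Ideal.le_radical (Ideal.mem_map_of_mem _ (R.residue_eq_zero_iff.1 hx))
  simpa using add_mem (key x) h1

/-- The group ring of a finite abelian `p`-group, as a complete local ring. -/
noncomputable def CHat.groupRing (R : CHat k) (P : Type u) [CommGroup P] [Finite P]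
    (hP : ∀ x : P, ∃ j : ℕ, x ^ Nat.card k ^ j = 1) : CHat k :=
  have : Module.Finite R (MonoidAlgebra R P) := Module.Finite.of_basis (MonoidAlgebra.basis P R)
  have : IsNoetherianRing (MonoidAlgebra R P) := IsNoetherianRing.of_finite R _
  have : IsAdicComplete (maximalIdeal R) (MonoidAlgebra R P) :=
    (MonoidAlgebra.basis P R).isAdicComplete
  have : IsAdicComplete ((maximalIdeal R).map (algebraMap R (MonoidAlgebra R P)))
      (MonoidAlgebra R P) := (IsAdicComplete.map_algebraMap_iff _ _).2 this
  CHat.ofIsAdicComplete (MonoidAlgebra R P)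
    ((maximalIdeal R).map (algebraMap R (MonoidAlgebra R P))) (R.groupRingResidue P)
    (fun t => by
      obtain ⟨r, rfl⟩ := R.residue_surjective t
      exact ⟨_, CHat.groupRingResidue_algebraMap r⟩)
    (Ideal.map_le_iff_le_comap.2 fun r hr => by
      rw [Ideal.mem_comap, RingHom.mem_ker, CHat.groupRingResidue_algebraMap]
      exact R.residue_eq_zero_iff.2 hr)
    (CHat.ker_groupRingResidue_le hP)

end GroupRings

/-! ### Splitting the units into roots of unity and one-units. -/

section Retraction

variable {k : Type u} [Field k] [Finite k]

-- Hensel's lemma for X^(q-1) - 1: residues of units are roots, and they are simple since the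
-- derivative there has residue -ū^(q-2) ≠ 0, where ū is the residue of u.
open Polynomial in
theorem CHat.exists_root_of_unity (R : CHat k) (u : (R : Type u)ˣ) :
    ∃ t : (R : Type u)ˣ, t ^ (Nat.card k - 1) = 1 ∧ R.residue t = R.residue u := by
  have := Fintype.ofFinite k
  have hq : 1 < Nat.card k := Finite.one_lt_card
  have hq0 : ((Nat.card k : ℕ) : k) = 0 := by
    rw [Nat.card_eq_fintype_card]
    exact Nat.cast_card_eq_zero k
  have hu : (R.residue u) ≠ 0 := (u.isUnit.map R.residue).ne_zero
  obtain ⟨a, ha, hau⟩ := HenselianRing.is_henselian (I := IsLocalRing.maximalIdeal R)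
    (X ^ (Nat.card k - 1) - C 1 : (R : Type u)[X]) (monic_X_pow_sub_C 1 (by omega)) u
    (by
      rw [← R.residue_eq_zero_iff]
      simp only [eval_sub, eval_pow, eval_X, eval_one, map_sub, map_pow, map_one]
      rw [Nat.card_eq_fintype_card, FiniteField.pow_card_sub_one_eq_one _ hu, sub_self])
    (by
      refine IsUnit.map _ (isUnit_of_map_unit R.residue _ ?_)
      rw [derivative_sub, derivative_C, sub_zero, derivative_X_pow]
      simp only [eval_mul, eval_natCast, eval_pow, eval_X, map_mul, map_pow, map_natCast]
      rw [Nat.cast_sub hq.le, hq0, Nat.cast_one, zero_sub]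
      exact isUnit_one.neg.mul ((isUnit_iff_ne_zero.2 hu).pow _))
  have hres : R.residue a = R.residue u := by
    rw [← sub_eq_zero, ← map_sub, R.residue_eq_zero_iff]; exact hau
  have haunit : IsUnit a := isUnit_of_map_unit R.residue _ (by rw [hres]; exact u.isUnit.map _)
  refine ⟨haunit.unit, Units.ext ?_, hres⟩
  have h1 : a ^ (Nat.card k - 1) - 1 = 0 := by simpa using ha
  simpa using sub_eq_zero.1 h1

/-- The one-units are a direct factor of the group of units. -/
theorem CHat.exists_retraction (R : CHat k) : ∃ pr : (R : Type u)ˣ →* R.oneUnits,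
    Continuous pr ∧ (∀ v : R.oneUnits, pr v = v) ∧
      ∀ u : (R : Type u)ˣ, (u * (pr u : (R : Type u)ˣ)⁻¹) ^ (Nat.card k - 1) = 1 := by
  choose t ht htu using R.exists_root_of_unity
  -- Uniqueness of these representatives makes the chosen t multiplicative, so that u ↦ u t(u)⁻¹ is
  -- a homomorphism.
  have uniq : ∀ x y : (R : Type u)ˣ, x ^ (Nat.card k - 1) = 1 → y ^ (Nat.card k - 1) = 1 →
      R.residue x = R.residue y → x = y := by
    intro x y hx hy hxy
    rw [← mul_inv_eq_one]
    refine Units.ext (CHat.eq_one_of_pow_eq_one ?_ ?_)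
    · rw [Units.val_mul, map_mul, hxy, ← map_mul, Units.mul_inv, map_one]
    · rw [← Units.val_pow_eq_pow_val, mul_pow, inv_pow, hx, hy, inv_one, mul_one, Units.val_one]
  have hmul : ∀ x y, t (x * y) = t x * t y := fun x y => uniq _ _ (ht _)
    (by rw [mul_pow, ht, ht, mul_one]) (by simp only [htu, Units.val_mul, map_mul])
  have hone : ∀ v : R.oneUnits, t v = 1 := fun v => uniq _ _ (ht _) (one_pow _) (by
    rw [htu, Units.val_one, map_one]; exact CHat.mem_oneUnits.1 v.2)
  let pr : (R : Type u)ˣ →* R.oneUnits :=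
    { toFun := fun u => ⟨u * (t u)⁻¹, CHat.mem_oneUnits.2 (by
        rw [Units.val_mul, map_mul, ← htu, ← map_mul, Units.mul_inv, map_one])⟩
      map_one' := by
        refine Subtype.ext ?_
        have := hone 1
        rw [OneMemClass.coe_one] at this
        simp [this]
      map_mul' := fun x y => by
        refine Subtype.ext ?_
        simp only [hmul, mul_inv, Subgroup.coe_mul]
        exact mul_mul_mul_comm _ _ _ _ }
  have hpr : ∀ v : R.oneUnits, pr v = v := fun v => Subtype.ext (by
    change (v : (R : Type u)ˣ) * (t v)⁻¹ = v
    rw [hone, inv_one, mul_one])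
  refine ⟨pr, ?_, hpr, fun u => ?_⟩
  -- The map is the identity on an open subgroup, which is enough for continuity at 1.
  · have hopen : IsOpen (R.oneUnits : Set (R : Type u)ˣ) := by
      have := CHat.isOpen_setOf_sub_mem (R := R) Units.continuous_val 1
      simpa only [pow_one] using! this
    refine continuous_of_continuousAt_one pr ?_
    have h1 : ContinuousAt (pr ∘ Subtype.val) (1 : R.oneUnits) := by
      have : (pr ∘ Subtype.val : R.oneUnits → R.oneUnits) = id := funext hpr
      rw [this]
      exact continuousAt_id
    exact (hopen.isOpenEmbedding_subtypeVal.continuousAt_iff).1 h1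
  · change (u * (u * (t u)⁻¹)⁻¹) ^ _ = 1
    rw [mul_inv, inv_inv, mul_inv_cancel_left, ht]

end Retraction

/-! ### From a universal lift of GL_n(R) to a universal pair. -/

section UniversalPair

open Matrix

variable {k : Type u} [Field k] {n : ℕ} {R A : CHat k}

/-- A morphism `R ⟶ A` and a character of the one-units of `R`, universal among such pairs. -/
structure CHat.UniversalPair (R A : CHat k) where
  hom : CHat.Hom R A
  char : R.oneUnits →* (A : Type u)ˣ
  continuous_char : Continuous fun v => (char v : A)
  residue_char : ∀ v, A.residue (char v) = 1
  exists_hom : ∀ (S : CHat k) (h : CHat.Hom R S) (θ : R.oneUnits →* (S : Type u)ˣ), Continuous θ →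
    (∀ v, S.residue (θ v) = 1) → ∃ φ : CHat.Hom A S,
      φ.toRingHom.comp hom.toRingHom = h.toRingHom ∧ ∀ v, φ.toRingHom (char v) = θ v
  hom_ext : ∀ (S : CHat k) (φ φ' : CHat.Hom A S),
    φ.toRingHom.comp hom.toRingHom = φ'.toRingHom.comp hom.toRingHom →
    (∀ v, φ.toRingHom (char v) = φ'.toRingHom (char v)) → φ = φ'

/-- The diagonal matrix with one given entry, the others being `1`. -/
def diagonalUnit (S : Type*) [CommRing S] (i : Fin n) : Sˣ →* GL (Fin n) S :=
  Units.map ((diagonalRingHom (Fin n) S : (Fin n → S) →* Matrix (Fin n) (Fin n) S).comp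
    (MonoidHom.mulSingle (fun _ => S) i))

theorem det_diagonalUnit {S : Type*} [CommRing S] (i : Fin n) (u : Sˣ) :
    GeneralLinearGroup.det (diagonalUnit S i u) = u := by
  refine Units.ext ?_
  change (diagonal (Pi.mulSingle i (u : S))).det = u
  rw [det_diagonal, Finset.prod_pi_mulSingle', if_pos (Finset.mem_univ i)]

theorem continuous_diagonalUnit {S : Type*} [CommRing S] [TopologicalSpace S] (i : Fin n) :
    Continuous (diagonalUnit S i) :=
  Continuous.units_map _ ((continuous_mulSingle i).matrix_diagonal)

theorem scalar_injective {S : Type*} [CommRing S] (i : Fin n) {a b : Sˣ}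
    (h : GeneralLinearGroup.scalar (Fin n) a = GeneralLinearGroup.scalar (Fin n) b) : a = b := by
  have h2 := congrArg (fun B : GL (Fin n) S => (B : Matrix (Fin n) (Fin n) S) i i) h
  simp only [GeneralLinearGroup.coe_scalar] at h2
  exact Units.ext (by simpa using h2)

/-- Lifts correspond to pairs: a morphism from R, and a character of the one-units composed with the
projection and det. The universal lift therefore yields a universal pair, its character being χ
restricted to diagonal matrices diag(v, 1, …, 1). -/
theorem exists_universalPair [Finite k] (hn : 2 ≤ n) (hR : IsRigidDegree n R.residue)
    (h : IsUniversalDeformationRing (naturalRep n R) A) : Nonempty (CHat.UniversalPair R A) := by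
  let i : Fin n := ⟨0, by omega⟩
  let D := GroupOverSL.full n R
  obtain ⟨ρ, hex, huniq⟩ := exists_lift_of_isUniversal (ρbar := D.residual) h
  obtain ⟨f, K, hK, χ, hρ, hχ, hχ1⟩ := D.exists_hom_of_lift hn hR ρ
  obtain ⟨pr, hprc, hpr, hprt⟩ := R.exists_retraction
  change ∀ γ : GL (Fin n) R, _ = K * (GeneralLinearGroup.scalar (Fin n) (χ γ) *
    GeneralLinearGroup.map f.toRingHom γ) * K⁻¹ at hρ
  have hχdet : ∀ γ, χ γ = χ (diagonalUnit R i (GeneralLinearGroup.det γ)) := by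
    intro γ
    obtain ⟨g, hg⟩ := D.exists_ofSL_eq (γ := γ * (diagonalUnit R i (GeneralLinearGroup.det γ))⁻¹)
      (by
        change GeneralLinearGroup.det (γ * _) = 1
        rw [map_mul, map_inv, det_diagonalUnit, mul_inv_cancel])
    have h1 := hχ1 g
    rwa [hg, map_mul, map_inv, mul_inv_eq_one] at h1
  -- The elements u and pr u differ by a (q-1)-st root of unity, on which a character with values of
  -- residue 1 is trivial.
  have hχpr : ∀ u, χ (diagonalUnit R i u) = χ (diagonalUnit R i (pr u)) := by
    intro u
    rw [← mul_inv_eq_one, ← map_inv, ← map_inv, ← map_mul, ← map_mul]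
    refine Units.ext (CHat.eq_one_of_pow_eq_one (hχ _) ?_)
    rw [← Units.val_pow_eq_pow_val, ← map_pow, ← map_pow, hprt, map_one, map_one, Units.val_one]
  refine ⟨⟨f, (χ.comp (diagonalUnit R i)).comp R.oneUnits.subtype, ?_, fun v => hχ _, ?_, ?_⟩⟩
  · have h1 : ∀ γ, GeneralLinearGroup.scalar (Fin n) (χ γ) =
        K⁻¹ * ρ.toHom γ * K * (GeneralLinearGroup.map f.toRingHom γ)⁻¹ := fun γ => by
      rw [hρ]; group
    have h2 : Continuous fun γ => GeneralLinearGroup.scalar (Fin n) (χ γ) := by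
      simp only [h1]
      exact ((continuous_const.mul ρ.continuous_toHom).mul continuous_const).mul
        (Continuous.units_map _ (continuous_id.matrix_map f.continuous)).inv
    have h3 : Continuous fun γ => (χ γ : A) := by
      have := (Units.continuous_val.comp h2).matrix_elem i i
      simpa [GeneralLinearGroup.coe_scalar] using! this
    exact h3.comp ((continuous_diagonalUnit i).comp continuous_subtype_val)
  · intro S h θ hθ hθ1
    have hτ : Continuous (θ.comp (pr.comp GeneralLinearGroup.det : GL (Fin n) R →* _)) :=
      hθ.comp (hprc.comp GeneralLinearGroup.continuous_det)
    -- The lift attached to the pair (h, θ). Restriction to SL_n(R) recovers h by traces; the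
    -- conjugating matrix is then scalar, and evaluation at diag(v, 1, …, 1) recovers θ.
    obtain ⟨φ, L, -, hL⟩ := hex S (D.twist h (θ.comp (pr.comp GeneralLinearGroup.det)) hτ
      fun γ => hθ1 _)
    have hL' : ∀ γ : GL (Fin n) R, GeneralLinearGroup.scalar (Fin n)
          (θ (pr (GeneralLinearGroup.det γ))) * GeneralLinearGroup.map h.toRingHom γ =
        (L * GeneralLinearGroup.map φ.toRingHom K) *
          (GeneralLinearGroup.scalar (Fin n) (Units.map (φ.toRingHom : A →* S) (χ γ)) *
            GeneralLinearGroup.map (φ.toRingHom.comp f.toRingHom) γ) *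
          (L * GeneralLinearGroup.map φ.toRingHom K)⁻¹ := by
      intro γ
      have h1 := hL γ
      change _ = L * GeneralLinearGroup.map φ.toRingHom (ρ.toHom γ) * L⁻¹ at h1
      rw [hρ, map_mul, map_mul, map_mul, map_inv, GeneralLinearGroup.map_scalar] at h1
      refine h1.trans ?_
      rw [GeneralLinearGroup.map_comp, MonoidHom.comp_apply]
      group
    generalize L * GeneralLinearGroup.map φ.toRingHom K = L' at hL'
    have hdetSL : ∀ g : SpecialLinearGroup (Fin n) R,
        GeneralLinearGroup.det (SpecialLinearGroup.toGL g : GL (Fin n) R) = 1 :=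
      fun g => Units.ext g.2
    have hSL : ∀ g : SpecialLinearGroup (Fin n) R,
        GeneralLinearGroup.map h.toRingHom (SpecialLinearGroup.toGL g) =
        L' * GeneralLinearGroup.map (φ.toRingHom.comp f.toRingHom) (SpecialLinearGroup.toGL g) *
          L'⁻¹ := by
      intro g
      have h1 := hL' (SpecialLinearGroup.toGL g)
      have h2 : χ (SpecialLinearGroup.toGL g) = 1 := hχ1 g
      rwa [hdetSL, map_one, map_one, map_one, one_mul, h2, map_one, map_one, one_mul] at h1
    have hfh : φ.toRingHom.comp f.toRingHom = h.toRingHom := by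
      have : (f ≫ φ : R ⟶ S) = h := CHat.Hom.eq_of_conj hn L' hSL
      exact congrArg CHat.Hom.toRingHom this
    refine ⟨φ, hfh, fun v => ?_⟩
    rw [hfh] at hSL hL'
    obtain ⟨c, rfl⟩ := exists_eq_scalar_of_commute hn (A := L') (by
      intro a b hab
      have h1 := hSL (SpecialLinearGroup.transvection hab 1)
      rw [eq_mul_inv_iff_mul_eq] at h1
      have h2 : GeneralLinearGroup.map h.toRingHom
          (SpecialLinearGroup.toGL (SpecialLinearGroup.transvection hab (1 : R))) =
          SpecialLinearGroup.toGL (SpecialLinearGroup.transvection hab (1 : S)) := by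
        refine Units.ext ?_
        change (1 + single a b (1 : R)).map h.toRingHom = 1 + single a b (1 : S)
        rw [Matrix.map_add _ (map_add _), Matrix.map_one _ (map_zero _) (map_one _), map_single,
          map_one]
      rwa [h2] at h1)
    have h1 := hL' (diagonalUnit R i v)
    rw [GeneralLinearGroup.scalar_commute c, mul_inv_cancel_right, mul_left_inj,
      det_diagonalUnit, hpr] at h1
    exact (congrArg Units.val (scalar_injective i h1)).symm
  · intro S φ φ' hff hχχ
    refine huniq S φ φ' ⟨GeneralLinearGroup.map φ'.toRingHom K *
      (GeneralLinearGroup.map φ.toRingHom K)⁻¹, ?_, fun γ => ?_⟩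
    · have : ∀ ψ : CHat.Hom A S, GeneralLinearGroup.map ψ.toRingHom K ∈
          (GeneralLinearGroup.map (n := Fin n) S.residue).ker := fun ψ => by
        rw [MonoidHom.mem_ker] at hK ⊢
        rw [← MonoidHom.comp_apply, ← GeneralLinearGroup.map_comp, ψ.residue_comp, hK]
      exact mul_mem (this φ') (inv_mem (this φ))
    · have key : ∀ ψ : CHat.Hom A S, (ρ.map ψ).toHom γ = GeneralLinearGroup.map ψ.toRingHom K *
          (GeneralLinearGroup.scalar (Fin n) (Units.map (ψ.toRingHom : A →* S) (χ γ)) *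
            GeneralLinearGroup.map (ψ.toRingHom.comp f.toRingHom) γ) *
          (GeneralLinearGroup.map ψ.toRingHom K)⁻¹ := fun ψ => by
        change GeneralLinearGroup.map ψ.toRingHom (ρ.toHom γ) = _
        rw [hρ, map_mul, map_mul, map_mul, map_inv, GeneralLinearGroup.map_scalar,
          GeneralLinearGroup.map_comp, MonoidHom.comp_apply]
      have h1 : Units.map (φ'.toRingHom : A →* S) (χ γ) = Units.map (φ.toRingHom : A →* S) (χ γ) :=
        Units.ext (by
          rw [hχdet, hχpr]
          exact (hχχ _).symm)
      rw [key, key, h1, ← hff]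
      group

end UniversalPair

/-! ### Identification of the universal ring with the completed group ring. -/

section CompletedGroupRingIso

open IsLocalRing

variable {k : Type u} [Field k] {R A : CHat k}

theorem RingHom.map_mem_pow_of_mem_pow {S T : Type*} [CommRing S] [CommRing T] (f : S →+* T)
    {I : Ideal S} {J : Ideal T} (h : ∀ a ∈ I, f a ∈ J) {i : ℕ} {b : S} (hb : b ∈ I ^ i) :
    f b ∈ J ^ i :=
  Ideal.le_comap_pow f i (Ideal.pow_right_mono h i hb)

theorem RingHom.sub_mem_pow_of_forall_eq {S T : Type u} [CommRing S] [CommRing T] (f : S →+* T)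
    {I : Ideal S} {J : Ideal T} (h : ∀ a ∈ I, f a ∈ J) {i : ℕ} {x y : T}
    (hxy : ∀ (T' : Type u) [CommRing T'] (π : T →+* T'),
      (∀ b ∈ I ^ i, π.comp f b = 0) → π x = π y) : x - y ∈ J ^ i :=
  Ideal.Quotient.eq.1 (hxy _ (Ideal.Quotient.mk (J ^ i)) fun _ hb =>
    Ideal.Quotient.eq_zero_iff_mem.2 (f.map_mem_pow_of_mem_pow h hb))

theorem MonoidAlgebra.ringHom_ext_quotient {S T Γ : Type*} [CommRing S] [CommRing T] [Group Γ]
    {N : Subgroup Γ} [N.Normal] {f g : MonoidAlgebra S (Γ ⧸ N) →+* T}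
    (h : ∀ r, f (algebraMap S _ r) = g (algebraMap S _ r))
    (h' : ∀ v : Γ, f (MonoidAlgebra.of S (Γ ⧸ N) v) = g (MonoidAlgebra.of S (Γ ⧸ N) v)) : f = g := by
  refine MonoidAlgebra.ringHom_ext h fun x => ?_
  obtain ⟨v, rfl⟩ := QuotientGroup.mk_surjective x
  exact h' v

theorem groupRingTransition_algebraMap {S Γ : Type u} [CommRing S] [Group Γ] [TopologicalSpace Γ]
    {N M : OpenNormalSubgroup Γ} (h : N ≤ M) (r : S) :
    groupRingTransition S Γ h (algebraMap S _ r) = algebraMap S _ r := by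
  simp [groupRingTransition]

theorem groupRingTransition_of {S Γ : Type u} [CommRing S] [Group Γ] [TopologicalSpace Γ]
    {N M : OpenNormalSubgroup Γ} (h : N ≤ M) (v : Γ) :
    groupRingTransition S Γ h (MonoidAlgebra.of S (Γ ⧸ N.toSubgroup) v) =
      MonoidAlgebra.of S (Γ ⧸ M.toSubgroup) v := by
  simp only [groupRingTransition, MonoidAlgebra.of_apply, MonoidAlgebra.mapDomainRingHom_apply,
    MonoidAlgebra.mapDomain_single]
  rfl

namespace CHat

theorem eq_zero_of_forall_mem_pow (S : CHat k) {x : S}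
    (hx : ∀ i, x ∈ RingHom.ker S.residue ^ i) : x = 0 := by
  refine IsHausdorff.haus (I := maximalIdeal S) (M := S) inferInstance x fun i => ?_
  rw [SModEq.zero, smul_eq_mul, Ideal.mul_top, ← S.ker_residue]
  exact hx i

theorem groupRingResidue_transition {N M : OpenNormalSubgroup R.oneUnits} (h : N ≤ M) :
    (R.groupRingResidue (R.oneUnits ⧸ M.toSubgroup)).comp (groupRingTransition R R.oneUnits h) =
      R.groupRingResidue (R.oneUnits ⧸ N.toSubgroup) := by
  refine MonoidAlgebra.ringHom_ext_quotient (fun r => ?_) fun v => ?_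
  · rw [RingHom.comp_apply, groupRingTransition_algebraMap, groupRingResidue_algebraMap,
      groupRingResidue_algebraMap]
  · rw [RingHom.comp_apply, groupRingTransition_of, groupRingResidue_of, groupRingResidue_of]

theorem groupRing_eq_zero [Finite k] (N : OpenNormalSubgroup R.oneUnits)
    {x : MonoidAlgebra R (R.oneUnits ⧸ N.toSubgroup)}
    (hx : ∀ i, x ∈ RingHom.ker (R.groupRingResidue (R.oneUnits ⧸ N.toSubgroup)) ^ i) : x = 0 := by
  let B : CHat k := R.groupRing (R.oneUnits ⧸ N.toSubgroup) (exists_pow_card_pow_eq_one N)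
  exact B.eq_zero_of_forall_mem_pow hx

namespace UniversalPair

variable (U : UniversalPair R A)

theorem exists_toGroupRing [Finite k] (N : OpenNormalSubgroup R.oneUnits) :
    ∃ φ : A →+* MonoidAlgebra R (R.oneUnits ⧸ N.toSubgroup),
      (R.groupRingResidue _).comp φ = A.residue ∧
      (∀ r, φ (U.hom.toRingHom r) = algebraMap R _ r) ∧
      ∀ v, φ (U.char v) = MonoidAlgebra.of R (R.oneUnits ⧸ N.toSubgroup) v := by
  let B : CHat k := R.groupRing (R.oneUnits ⧸ N.toSubgroup) (exists_pow_card_pow_eq_one N)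
  let h : CHat.Hom R B := CHat.Hom.ofRingHom
    (algebraMap R (MonoidAlgebra R (R.oneUnits ⧸ N.toSubgroup)))
    (RingHom.ext fun r => groupRingResidue_algebraMap r)
  let θ : R.oneUnits →* (B : Type u)ˣ := MonoidHom.toHomUnits
    ((MonoidAlgebra.of R (R.oneUnits ⧸ N.toSubgroup)).comp (QuotientGroup.mk' N.toSubgroup))
  -- The tautological character is trivial on the open subgroup N.
  have hθ : Continuous θ := by
    refine continuous_of_continuousAt_one θ ?_
    refine (continuousAt_const (y := 1)).congr (Filter.eventuallyEq_of_mem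
      (N.isOpen'.mem_nhds N.one_mem') fun v hv => Units.ext ?_)
    change (1 : MonoidAlgebra R (R.oneUnits ⧸ N.toSubgroup)) = MonoidAlgebra.of R _ _
    rw [QuotientGroup.mk'_apply, (QuotientGroup.eq_one_iff (N := N.toSubgroup) v).2 hv, map_one]
  obtain ⟨φ, hφ, hφ'⟩ := U.exists_hom B h θ hθ fun v => groupRingResidue_of _
  exact ⟨φ.toRingHom, φ.residue_comp, fun r => DFunLike.congr_fun hφ r, hφ'⟩

theorem toGroupRing_ext [Finite k] {N : OpenNormalSubgroup R.oneUnits}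
    {φ φ' : A →+* MonoidAlgebra R (R.oneUnits ⧸ N.toSubgroup)}
    (h : (R.groupRingResidue _).comp φ = A.residue)
    (h' : (R.groupRingResidue _).comp φ' = A.residue)
    (h1 : ∀ r, φ (U.hom.toRingHom r) = φ' (U.hom.toRingHom r))
    (h2 : ∀ v, φ (U.char v) = φ' (U.char v)) : φ = φ' := by
  let B : CHat k := R.groupRing (R.oneUnits ⧸ N.toSubgroup) (exists_pow_card_pow_eq_one N)
  exact congrArg CHat.Hom.toRingHom (U.hom_ext B (CHat.Hom.ofRingHom φ h)
    (CHat.Hom.ofRingHom φ' h') (RingHom.ext h1) h2)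

/-- The reduction of the universal character modulo a power of the maximal ideal. -/
noncomputable def charMod (j : ℕ) : R.oneUnits →* (A ⧸ maximalIdeal A ^ j)ˣ :=
  (Units.map (Ideal.Quotient.mk (maximalIdeal A ^ j) : A →* _)).comp U.char

theorem mem_ker_charMod {j : ℕ} {v : R.oneUnits} :
    v ∈ (U.charMod j).ker ↔ (U.char v : A) - 1 ∈ maximalIdeal A ^ j := by
  rw [MonoidHom.mem_ker, ← Ideal.Quotient.eq, map_one, Units.ext_iff]
  rfl

/-- The kernel of the reduction of the universal character. -/
noncomputable def kerCharMod (j : ℕ) : OpenNormalSubgroup R.oneUnits where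
  toSubgroup := (U.charMod j).ker
  isOpen' := by
    have : ((U.charMod j).ker : Set R.oneUnits) =
        {v | (U.char v : A) - 1 ∈ maximalIdeal A ^ j} := Set.ext fun v => U.mem_ker_charMod
    change IsOpen ((U.charMod j).ker : Set R.oneUnits)
    rw [this]
    exact isOpen_setOf_sub_mem U.continuous_char j

/-- The map from the group ring to the reduction of `A` induced by the universal pair. -/
theorem exists_ofGroupRing (j : ℕ) :
    ∃ θ : MonoidAlgebra R (R.oneUnits ⧸ (U.kerCharMod j).toSubgroup) →+* A ⧸ maximalIdeal A ^ j,
      (∀ r, θ (algebraMap R _ r) = Ideal.Quotient.mk _ (U.hom.toRingHom r)) ∧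
      ∀ v : R.oneUnits, θ (MonoidAlgebra.of R (R.oneUnits ⧸ (U.kerCharMod j).toSubgroup) v) =
        Ideal.Quotient.mk _ (U.char v : A) := by
  let η : R.oneUnits ⧸ (U.kerCharMod j).toSubgroup →* A ⧸ maximalIdeal A ^ j :=
    (Units.coeHom _).comp (QuotientGroup.kerLift (U.charMod j))
  refine ⟨MonoidAlgebra.liftNCRingHom ((Ideal.Quotient.mk _).comp U.hom.toRingHom) η
    fun _ _ => Commute.all _ _, fun r => ?_, fun v => ?_⟩
  · change MonoidAlgebra.liftNC _ _ (MonoidAlgebra.single 1 r) = _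
    rw [MonoidAlgebra.liftNC_single, map_one, mul_one]
    rfl
  · change MonoidAlgebra.liftNC _ _ (MonoidAlgebra.single _ 1) = _
    rw [MonoidAlgebra.liftNC_single, AddMonoidHom.coe_coe, map_one, one_mul]
    rfl

/-- Universality gives compatible maps φ_N : A → R[Γ/N]. In the other direction, the universal
character modulo 𝔪^j has open kernel N_j and induces θ_j : R[Γ/N_j] → A/𝔪^j. In the limit the two
systems are inverse to each other. -/
theorem exists_ringEquiv [Finite k] (U : UniversalPair R A) :
    ∃ e : A ≃+* CompletedGroupRing R R.oneUnits,
    ∀ a : A, R.residue (CompletedGroupRing.augmentation R R.oneUnits (e a)) = A.residue a := by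
  choose φ hφ hφR hφΓ using U.exists_toGroupRing
  choose θ hθR hθΓ using U.exists_ofGroupRing
  let Φ : A →+* CompletedGroupRing R R.oneUnits :=
    (RingHom.pi φ).codRestrict (CompletedGroupRing R R.oneUnits) fun a N M h => by
      have : (groupRingTransition R R.oneUnits h).comp (φ N) = φ M := by
        refine U.toGroupRing_ext ?_ (hφ M) (fun r => ?_) fun v => ?_
        · rw [← RingHom.comp_assoc, groupRingResidue_transition, hφ]
        · rw [RingHom.comp_apply, hφR, hφR, groupRingTransition_algebraMap]
        · rw [RingHom.comp_apply, hφΓ, hφΓ, groupRingTransition_of]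
      exact DFunLike.congr_fun this a
  have hinj : Function.Injective Φ := by
    refine (injective_iff_map_eq_zero Φ).2 fun a ha => A.eq_zero_of_forall_mem_pow fun j => ?_
    have hN : ∀ N, φ N a = 0 := fun N => congrFun (congrArg Subtype.val ha) N
    rcases eq_or_ne j 0 with rfl | hj
    · simp
    -- By the uniqueness half of universality, applied to A/𝔪^j. An element killed by all φ_N thus
    -- lies in every 𝔪^j and is zero. For j = 0 the quotient is not local, hence the separate case.
    have hcomp : (θ j).comp (φ (U.kerCharMod j)) = Ideal.Quotient.mk (maximalIdeal A ^ j) := by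
      let π : A ⧸ maximalIdeal A ^ j →+* k := (A.quotPow hj).residue
      have hres : π.comp (θ j) = R.groupRingResidue _ := by
        refine MonoidAlgebra.ringHom_ext_quotient (fun r => ?_) fun v => ?_
        · rw [RingHom.comp_apply, hθR, groupRingResidue_algebraMap]
          exact DFunLike.congr_fun U.hom.residue_comp r
        · rw [RingHom.comp_apply, hθΓ, groupRingResidue_of]
          exact U.residue_char v
      have hres' : π.comp ((θ j).comp (φ (U.kerCharMod j))) = A.residue := by
        rw [← RingHom.comp_assoc, hres, hφ]
      refine congrArg CHat.Hom.toRingHom (U.hom_ext (A.quotPow hj)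
        (CHat.Hom.ofRingHom ((θ j).comp (φ (U.kerCharMod j))) hres') (A.toQuotPow hj)
        (RingHom.ext fun r => ?_) fun v => ?_)
      · exact (congrArg (θ j) (hφR _ r)).trans (hθR j r)
      · exact (congrArg (θ j) (hφΓ _ v)).trans (hθΓ j v)
    rw [A.ker_residue, ← Ideal.Quotient.eq_zero_iff_mem, ← hcomp, RingHom.comp_apply, hN, map_zero]
  have hsurj : Function.Surjective Φ := by
    rintro ⟨x, hx⟩
    -- The preimage of a compatible family x is the limit of lifts to A of θ_j(x_{N_j}).
    choose a ha using fun j => Ideal.Quotient.mk_surjective (θ j (x (U.kerCharMod j)))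
    obtain ⟨L, hL⟩ := IsPrecomplete.prec (I := maximalIdeal A) (M := A) inferInstance (f := a) (by
      intro i j hij
      have hle : U.kerCharMod j ≤ U.kerCharMod i := fun v hv =>
        U.mem_ker_charMod.2 (Ideal.pow_le_pow_right hij (U.mem_ker_charMod.1 hv))
      have hcomp : (Ideal.Quotient.factor (Ideal.pow_le_pow_right hij)).comp (θ j) =
          (θ i).comp (groupRingTransition R R.oneUnits hle) := by
        refine MonoidAlgebra.ringHom_ext_quotient (fun r => ?_) fun v => ?_
        · rw [RingHom.comp_apply, RingHom.comp_apply, hθR, groupRingTransition_algebraMap, hθR,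
            Ideal.Quotient.factor_mk]
        · rw [RingHom.comp_apply, RingHom.comp_apply, hθΓ, groupRingTransition_of, hθΓ,
            Ideal.Quotient.factor_mk]
      have h1 := DFunLike.congr_fun hcomp (x (U.kerCharMod j))
      rw [RingHom.comp_apply, RingHom.comp_apply, hx, ← ha, ← ha, Ideal.Quotient.factor_mk,
        Ideal.Quotient.eq] at h1
      rw [SModEq.sub_mem, smul_eq_mul, Ideal.mul_top]
      simpa using neg_mem h1)
    refine ⟨L, Subtype.ext (funext fun N => sub_eq_zero.1 (groupRing_eq_zero N fun i => ?_))⟩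
    change φ N L - x N ∈ _
    have key : ∀ (T : Type u) [CommRing T]
        (π : MonoidAlgebra R (R.oneUnits ⧸ N.toSubgroup) →+* T),
        (∀ b ∈ maximalIdeal A ^ i, π.comp (φ N) b = 0) → π (φ N L) = π (x N) := by
      intro T _ π hπ
      -- The component at N and the one at N_i, which defines the limit modulo 𝔪^i, are compared on
      -- the common refinement N ⊓ N_i.
      have hcomp : ((Ideal.Quotient.lift _ _ hπ).comp (θ i)).comp (groupRingTransition R R.oneUnits
          (inf_le_right : N ⊓ U.kerCharMod i ≤ U.kerCharMod i)) =
          π.comp (groupRingTransition R R.oneUnits (inf_le_left : N ⊓ U.kerCharMod i ≤ N)) := by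
        refine MonoidAlgebra.ringHom_ext_quotient (fun r => ?_) fun v => ?_
        · simp only [RingHom.comp_apply, groupRingTransition_algebraMap, hθR,
            Ideal.Quotient.lift_mk, hφR]
        · simp only [RingHom.comp_apply, groupRingTransition_of, hθΓ, Ideal.Quotient.lift_mk, hφΓ]
      have h1 := DFunLike.congr_fun hcomp (x (N ⊓ U.kerCharMod i))
      simp only [RingHom.comp_apply] at h1
      rw [hx, hx, ← ha] at h1
      have h2 : Ideal.Quotient.mk (maximalIdeal A ^ i) (a i) = Ideal.Quotient.mk _ L := by
        have := SModEq.sub_mem.1 (hL i)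
        rw [smul_eq_mul, Ideal.mul_top] at this
        exact Ideal.Quotient.eq.2 this
      rwa [h2, Ideal.Quotient.lift_mk, RingHom.comp_apply] at h1
    refine RingHom.sub_mem_pow_of_forall_eq (S := A)
      (T := MonoidAlgebra R (R.oneUnits ⧸ N.toSubgroup)) (φ N) (fun c hc => ?_) key
    rw [RingHom.mem_ker, ← RingHom.comp_apply, hφ]
    exact A.residue_eq_zero_iff.2 hc
  refine ⟨RingEquiv.ofBijective Φ ⟨hinj, hsurj⟩, fun a => ?_⟩
  exact DFunLike.congr_fun (hφ (topOpenNormalSubgroup R.oneUnits)) a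

end UniversalPair

end CHat

end CompletedGroupRingIso

theorem mainTheorem10 {k : Type u} [Field k] [Finite k] (n : ℕ) (hn : 2 ≤ n)
    (hnk : (n, Nat.card k) ∉ ({(2, 2), (2, 3), (2, 5), (3, 2)} : Set (ℕ × ℕ)))
    (R : CHat k) :
    ((∃ A : CHat k, IsUniversalDeformationRing (naturalRep n R) A ∧
        ∃ e : A ≃+* CompletedGroupRing R R.oneUnits,
          ∀ a : A, R.residue (CompletedGroupRing.augmentation R R.oneUnits (e a)) = A.residue a) ∨
      ¬ (deformationFunctor (naturalRep n R)).IsCorepresentable) ∧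
    (IsUniversalDeformationRing (naturalRep n R) R ↔ Function.Bijective R.residue) ∧
    {G | G ∈ closedSubgroupsOverSL n R ∧
        IsUniversalDeformationRing ((naturalRep n R).comp G.subtype) R} =
      {G | G ∈ closedSubgroupsOverSL n R ∧ G ≤ muL n R} := by
  have hR := R.isRigidDegree hn hnk
  refine ⟨?_, isUniversal_naturalRep_iff hn hR, setOf_isUniversal_eq hn hR⟩
  by_cases h : (deformationFunctor (naturalRep n R)).IsCorepresentable
  · obtain ⟨A, hA⟩ := h.has_corepresentation
    obtain ⟨U⟩ := exists_universalPair hn hR hA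
    exact Or.inl ⟨A, hA, U.exists_ringEquiv⟩
  · exact Or.inr h
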